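/- Let $n\ge 1$ be an integer, let $z\cdot\bar w=\sum_j z_j\bar w_j$ and $|z|=(z\cdot\bar z)^{1/2}$ on $\mathbb C^n$, and let $dV$ be Lebesgue measure on $\mathbb C^n$ normalized so that $\int e^{-|z|^2}\,dV(z)=1$. For real $\alpha$ put $dV_\alpha(z)=(1+|z|)^{-\alpha}dV(z)$ and $dW_\alpha(z)=|z|^{-\alpha}dV(z)$; for $r>0$ put $\Omega_r=\{z\in\mathbb C^n:|z|\ge r\}$. For $1\le p\le\infty$ and $\beta$ real, let $F^p_\beta$ be the space of entire functions $f$ on $\mathbb C^n$ whose norm $$\|f\|_{F^p_\beta}=\Big(\int_{\mathbb C^n}|f(z)e^{-|z|^2/2}|^p\,dV_\beta(z)\Big)^{1/p}\ (p<\infty),\qquad \|f\|_{F^\infty_\beta}=\operatorname*{ess\,sup}_{z\in\mathbb C^n}\frac{|f(z)|e^{-|z|^2/2}}{(1+|z|)^\beta}$$ is finite, and let $\mathcal L^{p,r}_\beta$ be the space of Lebesgue measurable functions $\psi$ on $\Omega_r$ whose norm $$\|\psi\|_{\mathcal L^{p,r}_\beta}=\Big(\int_{\Omega_r}|\psi(z)e^{-|z|^2/2}|^p\,dW_\beta(z)\Big)^{1/p}\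 (p<\infty),\qquad \|\psi\|_{\mathcal L^{\infty,r}_\beta}=\operatorname*{ess\,sup}_{z\in\Omega_r}\frac{|\psi(z)|e^{-|z|^2/2}}{|z|^\beta}$$ is finite. Put $(\psi,\varphi)_\alpha=\int_{\mathbb C^n}\psi\,\bar\varphi\,e^{-|z|^2}\,dW_\alpha$, and for an entire function $f$ with homogeneous expansion $f=\sum_{k\ge0}f_k$ put $f_s^-=\sum_{k\le|s|}f_k$ and $f_s^+=f-f_s^-$. Let $F^2_\alpha$ carry the inner product $$\langle f,g\rangle_\alpha=\begin{cases}(f,g)_\alpha&\text{if }\alpha<2n,\\ (f^-_{\alpha/2},g^-_{\alpha/2})_0+(f^+_{\alpha/2},g^+_{\alpha/2})_\alpha&\text{if }\alpha\ge 2n.\end{cases}$$ It has a unique reproducing kernel, that is, a unique family $(K^\alpha_z)_{z\in\mathbb C^n}$ in $F^2_\alpha$ with $f(z)=\langle f,K_z^\alpha\rangle_\alpha$ for all $f\in F^2_\alpha$ and $z\in\mathbb C^n$. For $r>0$ consider the operator $$P^r_\alpha\psi(z)=\int_{\Omega_r}\psi(w)\,\overline{K^\alpha_z(w)}\,e^{-|w|^2}\,dW_\alpha(w),\qquad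 z\in\mathbb C^n .$$ **Theorem 5.4.** Let $1\le p\le\infty$ and let $\alpha,\beta$ be real. (1) For every $r>0$, the integral defining $P^r_\alpha\psi(z)$ converges absolutely for all $\psi\in\mathcal L^{p,r}_\beta$ and $z\in\mathbb C^n$, and $P^r_\alpha$ is a bounded linear operator from $\mathcal L^{p,r}_\beta$ into $F^p_\beta$. (2) There is $r_0>0$, depending only on $n,\alpha,\beta,p$, such that for every $0<r<r_0$ the operator $P^r_\alpha$ (applied to the restrictions to $\Omega_r$ of functions in $F^p_\beta$) is a bounded linear bijection of $F^p_\beta$ onto itself with bounded inverse. -/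

import Mathlib

open MeasureTheory
open scoped ENNReal NNReal ComplexConjugate

noncomputable section

namespace Fock

/-- The complex `n`-space with its Hermitian (Euclidean) norm. -/
abbrev Cn (n : ℕ) : Type := EuclideanSpace ℂ (Fin n)

/-- The volume measure `dV` on `ℂⁿ`, normalized so that `∫ e^{-|z|²} dV(z) = 1`,
see `integral_gaussian`. -/
def V (n : ℕ) : Measure (Cn n) := ENNReal.ofReal ((Real.pi ^ n)⁻¹) • volume

lemma integral_gaussian (n : ℕ) : ∫ z : Cn n, Real.exp (-‖z‖ ^ 2) ∂(V n) = 1 := by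
  have h := GaussianFourier.integral_rexp_neg_mul_sq_norm (V := Cn n) (b := 1) one_pos
  have hd : Module.finrank ℝ (Cn n) = 2 * n := by
    rw [← Module.finrank_mul_finrank ℝ ℂ (Cn n)]; simp
  have hp : (0 : ℝ) < Real.pi ^ n := by positivity
  rw [V, integral_smul_measure, ENNReal.toReal_ofReal (by positivity)]
  rw [hd] at h
  push_cast at h
  rw [mul_div_cancel_left₀ _ (two_ne_zero), div_one, Real.rpow_natCast] at h
  simp only [neg_mul, one_mul] at h
  rw [h, smul_eq_mul, inv_mul_cancel₀ hp.ne']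

/-- `dV_α(z) = (1 + |z|)^{-α} dV(z)`. -/
def Vw (n : ℕ) (α : ℝ) : Measure (Cn n) :=
  (V n).withDensity fun z => ENNReal.ofReal ((1 + ‖z‖) ^ (-α))

/-- `dW_α(z) = |z|^{-α} dV(z)`. -/
def W (n : ℕ) (α : ℝ) : Measure (Cn n) :=
  (V n).withDensity fun z => ENNReal.ofReal (‖z‖ ^ (-α))

/-- The norm of `L^p_α`, with values in `[0, ∞]`:
the `L^p(dV_α)`-norm of `f e^{-|z|²/2}` for `p < ∞`,
and the essential supremum of `|f| e^{-|z|²/2} (1 + |z|)^{-α}` for `p = ∞`. -/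
def normF (n : ℕ) (p : ℝ≥0∞) (α : ℝ) (f : Cn n → ℂ) : ℝ≥0∞ :=
  if p = ∞ then
    eLpNorm (fun z => f z * ((Real.exp (-‖z‖ ^ 2 / 2) / (1 + ‖z‖) ^ α : ℝ) : ℂ)) ∞ (V n)
  else
    eLpNorm (fun z => f z * ((Real.exp (-‖z‖ ^ 2 / 2) : ℝ) : ℂ)) p (Vw n α)

/-- `Ω_r`, the complement of the open ball of radius `r` about the origin. -/
def Om (n : ℕ) (r : ℝ) : Set (Cn n) := (Metric.ball 0 r)ᶜ

/-- The norm of `𝓛^{p,r}_α`, with values in `[0, ∞]`: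
the `L^p(Ω_r, dW_α)`-norm of `ψ e^{-|z|²/2}` for `p < ∞`,
and the essential supremum over `Ω_r` of `|ψ| e^{-|z|²/2} |z|^{-α}` for `p = ∞`. -/
def normL (n : ℕ) (p : ℝ≥0∞) (r α : ℝ) (ψ : Cn n → ℂ) : ℝ≥0∞ :=
  if p = ∞ then
    eLpNorm (fun z => ψ z * ((Real.exp (-‖z‖ ^ 2 / 2) / ‖z‖ ^ α : ℝ) : ℂ)) ∞
      ((V n).restrict (Om n r))
  else
    eLpNorm (fun z => ψ z * ((Real.exp (-‖z‖ ^ 2 / 2) : ℝ) : ℂ)) p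
      ((W n α).restrict (Om n r))

/-- A weighted `L^p` norm (as above) of a sum of two functions is finite if both norms are, and
the norm of a scalar multiple is finite. -/
lemma weighted_add {n : ℕ} {p : ℝ≥0∞} {μ : Measure (Cn n)} {f g : Cn n → ℂ} {w : Cn n → ℝ}
    (hw : Measurable w) (hf : AEStronglyMeasurable f μ) (hg : AEStronglyMeasurable g μ)
    (h1 : eLpNorm (fun z => f z * (w z : ℂ)) p μ < ∞)
    (h2 : eLpNorm (fun z => g z * (w z : ℂ)) p μ < ∞) :
    eLpNorm (fun z => (f + g) z * (w z : ℂ)) p μ < ∞ := by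
  have hw' : AEStronglyMeasurable (fun z => (w z : ℂ)) μ :=
    (Complex.measurable_ofReal.comp hw).aestronglyMeasurable
  have := (MemLp.add (μ := μ) (p := p) ⟨hf.mul hw', h1⟩ ⟨hg.mul hw', h2⟩).2
  refine lt_of_eq_of_lt (congrArg (fun F => eLpNorm F p μ) ?_) this
  funext z
  simp [add_mul]

lemma weighted_smul {n : ℕ} {p : ℝ≥0∞} {μ : Measure (Cn n)} {f : Cn n → ℂ} {w : Cn n → ℝ}
    (c : ℂ) (hw : Measurable w) (hf : AEStronglyMeasurable f μ)
    (h1 : eLpNorm (fun z => f z * (w z : ℂ)) p μ < ∞) :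
    eLpNorm (fun z => (c • f) z * (w z : ℂ)) p μ < ∞ := by
  have hw' : AEStronglyMeasurable (fun z => (w z : ℂ)) μ :=
    (Complex.measurable_ofReal.comp hw).aestronglyMeasurable
  have := (MemLp.const_smul (μ := μ) (p := p) (f := fun z => f z * (w z : ℂ))
    ⟨hf.mul hw', h1⟩ c).2
  refine lt_of_eq_of_lt (congrArg (fun F => eLpNorm F p μ) ?_) this
  funext z
  simp [mul_assoc]

/-- The weighted Fock space `F^p_α`: entire functions with finite `L^p_α`-norm. -/
def spaceF (n : ℕ) (p : ℝ≥0∞) (α : ℝ) : Submodule ℂ (Cn n → ℂ) where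
  carrier := {f | Differentiable ℂ f ∧ normF n p α f < ∞}
  zero_mem' := ⟨differentiable_const 0, by unfold normF; split_ifs <;> simp [← Pi.zero_def]⟩
  add_mem' := by
    rintro f g ⟨hf, hf'⟩ ⟨hg, hg'⟩
    refine ⟨hf.add hg, ?_⟩
    unfold normF at *
    split_ifs at * with h
    · exact weighted_add (by fun_prop) hf.continuous.aestronglyMeasurable
        hg.continuous.aestronglyMeasurable hf' hg'
    · exact weighted_add (by fun_prop) hf.continuous.aestronglyMeasurable
        hg.continuous.aestronglyMeasurable hf' hg'
  smul_mem' := by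
    rintro c f ⟨hf, hf'⟩
    refine ⟨hf.const_smul c, ?_⟩
    unfold normF at *
    split_ifs at * with h
    · exact weighted_smul c (by fun_prop) hf.continuous.aestronglyMeasurable hf'
    · exact weighted_smul c (by fun_prop) hf.continuous.aestronglyMeasurable hf'

lemma restrict_W_ac (n : ℕ) (r α : ℝ) :
    (W n α).restrict (Om n r) ≪ (V n).restrict (Om n r) :=
  (withDensity_absolutelyContinuous _ _).restrict _

/-- The space `𝓛^{p,r}_α` of Lebesgue measurable functions on `Ω_r` with finite norm. Its elements
are represented by functions on `ℂⁿ`, whose values outside `Ω_r` play no role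
(neither for membership, nor for the norm, nor for the operator `opP` below). -/
def spaceL (n : ℕ) (p : ℝ≥0∞) (r α : ℝ) : Submodule ℂ (Cn n → ℂ) where
  carrier := {ψ | AEStronglyMeasurable ψ ((V n).restrict (Om n r)) ∧ normL n p r α ψ < ∞}
  zero_mem' := ⟨aestronglyMeasurable_const, by unfold normL; split_ifs <;> simp [← Pi.zero_def]⟩
  add_mem' := by
    rintro f g ⟨hf, hf'⟩ ⟨hg, hg'⟩
    refine ⟨hf.add hg, ?_⟩
    unfold normL at *
    split_ifs at * with h
    · exact weighted_add (by fun_prop) hf hg hf' hg'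
    · exact weighted_add (by fun_prop) (hf.mono_ac (restrict_W_ac n r α))
        (hg.mono_ac (restrict_W_ac n r α)) hf' hg'
  smul_mem' := by
    rintro c f ⟨hf, hf'⟩
    refine ⟨hf.const_smul c, ?_⟩
    unfold normL at *
    split_ifs at * with h
    · exact weighted_smul c (by fun_prop) hf hf'
    · exact weighted_smul c (by fun_prop) (hf.mono_ac (restrict_W_ac n r α)) hf'

/-- The homogeneous part of degree `k` in the Taylor expansion of `f` at the origin. -/
def homPart {n : ℕ} (k : ℕ) (f : Cn n → ℂ) (z : Cn n) : ℂ :=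
  (k.factorial : ℂ)⁻¹ * iteratedFDeriv ℂ k f 0 (fun _ => z)

/-- `f_s^-`, the part of degree at most `|s|` of the Taylor expansion of `f` at the origin. -/
def lowPart {n : ℕ} (s : ℝ) (f : Cn n → ℂ) (z : Cn n) : ℂ :=
  ∑ k ∈ Finset.range (⌊|s|⌋₊ + 1), homPart k f z

/-- `f_s^+ = f - f_s^-`, the tail of degree bigger than `|s|` of the Taylor expansion. -/
def highPart {n : ℕ} (s : ℝ) (f : Cn n → ℂ) (z : Cn n) : ℂ :=
  f z - lowPart s f z

/-- The pairing `(ψ, φ)_α = ∫ ψ φ̄ e^{-|z|²} dW_α`. -/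
def pairing (n : ℕ) (α : ℝ) (ψ φ : Cn n → ℂ) : ℂ :=
  ∫ z, ψ z * conj (φ z) * ((Real.exp (-‖z‖ ^ 2) : ℝ) : ℂ) ∂(W n α)

/-- The inner product `⟨f, g⟩_α` with which `F^2_α` is endowed. -/
def innerF (n : ℕ) (α : ℝ) (f g : Cn n → ℂ) : ℂ :=
  if α < 2 * n then pairing n α f g
  else pairing n 0 (lowPart (α / 2) f) (lowPart (α / 2) g)
    + pairing n α (highPart (α / 2) f) (highPart (α / 2) g)

/-- `K` is the reproducing kernel of the Hilbert space `F^2_α` with inner product `⟨·,·⟩_α`, where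
`K w` stands for the function `K_w^α`, that is, `K w z = K_w^α(z) = K^α(z, w)`. -/
structure IsReproducingKernel (n : ℕ) (α : ℝ) (K : Cn n → Cn n → ℂ) : Prop where
  mem : ∀ w, K w ∈ spaceF n 2 α
  reproducing : ∀ f ∈ spaceF n 2 α, ∀ z, f z = innerF n α f (K z)

/-- The integrand (with respect to `dW_α`) of `[ψ, K_z^α]_α^r`. -/
def integrandP {n : ℕ} (K : Cn n → Cn n → ℂ) (ψ : Cn n → ℂ) (z w : Cn n) : ℂ :=
  ψ w * conj (K z w) * ((Real.exp (-‖w‖ ^ 2) : ℝ) : ℂ)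

/-- The operator `P_α^r ψ(z) = [ψ, K_z^α]_α^r = ∫_{Ω_r} ψ(w) conj(K_z^α(w)) e^{-|w|²} dW_α(w)`
induced by the kernel `K = K^α`. -/
def opP (n : ℕ) (α r : ℝ) (K : Cn n → Cn n → ℂ) (ψ : Cn n → ℂ) (z : Cn n) : ℂ :=
  ∫ w in Om n r, integrandP K ψ z w ∂(W n α)

end Fock

end

/-! The argument rests on rotation invariance. For a radial weight, averaging over the circle action
`z ↦ e^{iθ} z` isolates the homogeneous part `f_k`. Polar coordinates then show that integrating
`f(w) ⟨w, z⟩^k` against any radial density gives `k! f_k(z)` times the ratio of the `k`-th radial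
moment of that density to the Gaussian one (`integral_mul_inner_pow_mul_radial`); the constant comes
from the classical Fock kernel. Hence the reproducing kernel is a power series in the inner product
whose coefficients times `k!` are `Γ(k+n)/Γ(k+n-α/2)`, except that they are `1` in the low degrees
when `α ≥ 2n`, where the inner product is the unweighted one.

Boundedness from `𝓛^{p,r}_β` comes from a pointwise estimate. For `α < 0` a Beta integral writes the
kernel as an average of exponentials, giving the bound `(1+|x|)^{α/2} (e^{Re x} + e^{|x|/2})` with
`x` the inner product. Multiplication of the coefficients by linear factors in `k` carries this to
all `α` (`kernelGrowth_Gamma_ratio`). After the weights of the two spaces are inserted, the kernel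
is dominated by a Gaussian in `z - w` (`exists_weighted_kernel_le`), and Young's inequality finishes
for all `p` at once.

On `F^p_β` the operator multiplies `f_k` by a positive number `m_k`, namely the kernel coefficient
times a ratio of radial moments, now truncated to `t ≥ r`. For large `k`, `1/m_k - 1` is the
quotient of the moment over `(0, r]` by the moment over `(r, ∞)`. Comparing the latter with `(2r,
∞)` shows that it is `O(4^{-k})` (`summable_inv_multiplier_sub_one`). So the inverse is the identity
plus an average of rotations of `f` against a bounded function on the circle, and rotations are
isometries of `F^p_β`; Minkowski's inequality bounds it (`normF_circleMultiplier_le`). No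
perturbation argument in `r` is needed: every `r > 0` works. -/

noncomputable section

namespace Fock

/-! ### Circle averages and Taylor coefficients -/

/-- The normalized arc length measure on the circle, in the angular coordinate. -/
def circ : Measure ℝ :=
  ENNReal.ofReal (2 * Real.pi)⁻¹ • volume.restrict (Set.Ioc 0 (2 * Real.pi))

instance : IsProbabilityMeasure circ := ⟨by
  have : (0 : ℝ) < 2 * Real.pi := by positivity
  simp only [circ, Measure.smul_apply, Measure.restrict_apply_univ, Real.volume_Ioc, sub_zero,
    smul_eq_mul]
  rw [← ENNReal.ofReal_mul (by positivity), inv_mul_cancel₀ this.ne', ENNReal.ofReal_one]⟩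

/-- The point of the unit circle with the angular coordinate `θ`. -/
def rot (θ : ℝ) : ℂ := Complex.exp (θ * Complex.I)

@[simp] lemma norm_rot (θ : ℝ) : ‖rot θ‖ = 1 := Complex.norm_exp_ofReal_mul_I θ

lemma rot_ne_zero (θ : ℝ) : rot θ ≠ 0 := Complex.exp_ne_zero _

@[fun_prop] lemma continuous_rot : Continuous rot := by unfold rot; fun_prop

lemma integral_circ {E : Type*} [NormedAddCommGroup E] [NormedSpace ℝ E] (f : ℝ → E) :
    ∫ θ, f θ ∂circ = (2 * Real.pi)⁻¹ • ∫ θ in (0 : ℝ)..(2 * Real.pi), f θ := by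
  have : (0 : ℝ) < 2 * Real.pi := by positivity
  rw [circ, integral_smul_measure, ENNReal.toReal_ofReal (by positivity),
    intervalIntegral.integral_of_le this.le]

lemma integrable_circ_of_continuous {E : Type*} [NormedAddCommGroup E] {f : ℝ → E}
    (hf : Continuous f) : Integrable f circ := by
  have : IntegrableOn f (Set.Ioc 0 (2 * Real.pi)) :=
    (hf.integrableOn_Icc (a := 0) (b := 2 * Real.pi)).mono_set Set.Ioc_subset_Icc_self
  exact Integrable.smul_measure this ENNReal.ofReal_ne_top

lemma integral_rot_zpow (m : ℤ) : ∫ θ, rot θ ^ m ∂circ = if m = 0 then 1 else 0 := by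
  split_ifs with h
  · simp [h]
  · rw [integral_circ]
    have h1 : ∀ θ : ℝ, rot θ ^ m = Complex.exp ((m * Complex.I) * θ) := by
      intro θ
      rw [rot, ← Complex.exp_int_mul]
      congr 1; ring
    have h2 : (m * Complex.I : ℂ) ≠ 0 := by simp [h]
    simp_rw [h1]
    rw [integral_exp_mul_complex h2]
    have h3 : Complex.exp (m * Complex.I * ((2 * Real.pi : ℝ) : ℂ)) = 1 := by
      rw [Complex.exp_eq_one_iff]
      exact ⟨m, by push_cast; ring⟩
    rw [h3]
    simp

/-- Absolute summability permits termwise integration, and orthogonality of the characters leaves a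
single term. -/
lemma integral_circ_coeff {b : ℕ → ℂ} {F : ℝ → ℂ} (hb : Summable fun k => ‖b k‖)
    (hF : ∀ θ, HasSum (fun j => b j * rot θ ^ j) (F θ)) (k : ℕ) :
    ∫ θ, F θ * (rot θ ^ k)⁻¹ ∂circ = b k := by
  have h := hasSum_integral_of_summable_integral_norm (μ := circ)
    (F := fun j θ => b j * rot θ ^ j * (rot θ ^ k)⁻¹) (fun j =>
      integrable_circ_of_continuous (by
        have : ∀ θ, rot θ ^ k ≠ 0 := fun θ => pow_ne_zero _ (rot_ne_zero θ)
        fun_prop (disch := assumption))) (by simpa using hb)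
  have h1 : ∀ θ, ∑' j, b j * rot θ ^ j * (rot θ ^ k)⁻¹ = F θ * (rot θ ^ k)⁻¹ := fun θ =>
    ((hF θ).mul_right _).tsum_eq
  simp_rw [h1] at h
  have h2 : ∀ j, ∫ θ, b j * rot θ ^ j * (rot θ ^ k)⁻¹ ∂circ = if j = k then b k else 0 := by
    intro j
    have : ∀ θ, b j * rot θ ^ j * (rot θ ^ k)⁻¹ = b j * rot θ ^ ((j : ℤ) - k) := by
      intro θ
      rw [zpow_sub₀ (rot_ne_zero θ), zpow_natCast, zpow_natCast]; ring
    simp_rw [this]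
    rw [integral_const_mul, integral_rot_zpow]
    by_cases hjk : j = k
    · simp [hjk]
    · have : (j : ℤ) - k ≠ 0 := by omega
      simp [hjk, this]
  simp_rw [h2] at h
  exact h.unique (hasSum_ite_eq k (b k))

/-- The Taylor coefficients of an entire function of one variable as circle averages. -/
lemma integral_circ_entire {g : ℂ → ℂ} (hg : Differentiable ℂ g) (k : ℕ) :
    ∫ θ, g (rot θ) * (rot θ ^ k)⁻¹ ∂circ = (k.factorial : ℂ)⁻¹ * iteratedDeriv k g 0 := by
  have h : ∀ x, HasSum (fun j : ℕ => ((j.factorial : ℂ)⁻¹ * iteratedDeriv j g 0) * x ^ j) (g x) := by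
    intro x
    have h := Complex.hasSum_taylorSeries_of_entire hg 0 x
    simp only [sub_zero, smul_eq_mul] at h
    simpa only [mul_assoc, mul_comm (x ^ _)] using h
  refine integral_circ_coeff (b := fun j => (j.factorial : ℂ)⁻¹ * iteratedDeriv j g 0)
    ?_ (fun θ => h _) k
  simpa using (h 1).summable.norm

/-- Differentiation under the integral: joint continuity bounds the derivative on the compact set
(closed unit ball about the point) × (angles), which supplies the dominating constant. -/
lemma differentiable_integral_circ {E : Type*} [NormedAddCommGroup E] [NormedSpace ℂ E]
    [ProperSpace E] {F : E → ℝ → ℂ} {F' : E → ℝ → E →L[ℂ] ℂ}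
    (hF : Continuous fun x : E × ℝ => F x.1 x.2) (hF' : Continuous fun x : E × ℝ => F' x.1 x.2)
    (h : ∀ z θ, HasFDerivAt (fun x => F x θ) (F' z θ) z) :
    Differentiable ℂ fun z => ∫ θ, F z θ ∂circ := by
  intro z
  have hK : IsCompact (Metric.closedBall z 1 ×ˢ Set.Icc (0 : ℝ) (2 * Real.pi)) :=
    (isCompact_closedBall z 1).prod isCompact_Icc
  obtain ⟨C, hC⟩ := hK.exists_bound_of_continuousOn hF'.continuousOn
  refine (hasFDerivAt_integral_of_dominated_of_fderiv_le (μ := circ) (F := F) (F' := F')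
    (bound := fun _ => C) (Metric.closedBall_mem_nhds z one_pos)
    (.of_forall fun x => Continuous.aestronglyMeasurable (by fun_prop))
    (integrable_circ_of_continuous (by fun_prop))
    (Continuous.aestronglyMeasurable (by fun_prop)) ?_ (integrable_const _)
    (.of_forall fun θ x _ => h x θ)).differentiableAt
  refine Measure.ae_smul_measure ?_ _
  filter_upwards [ae_restrict_mem measurableSet_Ioc] with θ hθ x hx
  exact hC (x, θ) ⟨hx, Set.Ioc_subset_Icc_self hθ⟩

/-! ### Smoothness of entire functions of several variables -/

section Entire

variable {E : Type*} [NormedAddCommGroup E] [NormedSpace ℂ E]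

/-- Cauchy's formula on the complex line through `z` in direction `v`. The right side involves
values of `f` only, so regularity of `f` passes to its derivative; this drives the bootstrap to
smoothness. -/
lemma fderiv_apply_eq_integral_circ {f : E → ℂ} (hf : Differentiable ℂ f) (z v : E) :
    fderiv ℂ f z v = ∫ θ, f (z + rot θ • v) * (rot θ)⁻¹ ∂circ := by
  have hg : Differentiable ℂ fun x : ℂ => f (z + x • v) := by fun_prop
  have h := integral_circ_entire hg 1
  simp only [pow_one, Nat.factorial_one, Nat.cast_one, inv_one, one_mul, iteratedDeriv_one] at h
  rw [h]
  have h1 : HasDerivAt (fun x : ℂ => z + x • v) v 0 := by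
    simpa using ((hasDerivAt_id (0 : ℂ)).smul_const v).const_add z
  have h2 : HasFDerivAt f (fderiv ℂ f z) (z + (0 : ℂ) • v) := by
    simpa using (hf z).hasFDerivAt
  exact (h2.comp_hasDerivAt (0 : ℂ) h1).deriv.symm

variable [FiniteDimensional ℂ E]

lemma continuous_fderiv_of_entire {f : E → ℂ} (hf : Differentiable ℂ f) :
    Continuous (fderiv ℂ f) := by
  rw [continuous_clm_apply]
  intro v
  simp_rw [fderiv_apply_eq_integral_circ hf, integral_circ]
  refine Continuous.const_smul
    (intervalIntegral.continuous_parametric_intervalIntegral_of_continuous' ?_ _ _) _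
  have := hf.continuous
  unfold Function.uncurry
  fun_prop (disch := intros; apply rot_ne_zero)

lemma differentiable_fderiv_apply {f : E → ℂ} (hf : Differentiable ℂ f) (v : E) :
    Differentiable ℂ fun z => fderiv ℂ f z v := by
  have : ProperSpace E := FiniteDimensional.proper ℂ E
  simp_rw [fderiv_apply_eq_integral_circ hf]
  have h1 := hf.continuous
  have h2 := continuous_fderiv_of_entire hf
  refine differentiable_integral_circ
    (F' := fun z θ => (rot θ)⁻¹ • fderiv ℂ f (z + rot θ • v)) ?_ ?_ fun z θ => ?_
  · fun_prop (disch := intros; apply rot_ne_zero)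
  · fun_prop (disch := intros; apply rot_ne_zero)
  · refine HasFDerivAt.mul_const ?_ _
    have h3 : HasFDerivAt f (fderiv ℂ f (z + rot θ • v)) (z + rot θ • v) := (hf _).hasFDerivAt
    exact h3.comp z ((hasFDerivAt_id z).add_const _)

/-- An entire function on a finite dimensional space is smooth. -/
lemma contDiff_of_entire {f : E → ℂ} (hf : Differentiable ℂ f) (k : ℕ) : ContDiff ℂ k f := by
  induction k generalizing f with
  | zero => exact contDiff_zero.2 hf.continuous
  | succ k ih =>
    push_cast
    rw [contDiff_succ_iff_fderiv]
    refine ⟨hf, fun h => absurd h (by simp), ?_⟩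
    rw [contDiff_clm_apply_iff]
    exact fun v => ih (differentiable_fderiv_apply hf v)

end Entire

/-! ### The homogeneous expansion -/

section HomPart

variable {n : ℕ}

lemma differentiable_slice {f : Cn n → ℂ} (hf : Differentiable ℂ f) (z : Cn n) :
    Differentiable ℂ fun x : ℂ => f (x • z) := by fun_prop

/-- Chain rule along the linear map `x ↦ x • z`; this is where smoothness in several variables is
needed. Everything else about homogeneous parts reduces to one-variable slices. -/
lemma homPart_eq_iteratedDeriv {f : Cn n → ℂ} (hf : Differentiable ℂ f) (k : ℕ) (z : Cn n) :
    homPart k f z = (k.factorial : ℂ)⁻¹ * iteratedDeriv k (fun x : ℂ => f (x • z)) 0 := by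
  have h := ContinuousLinearMap.iteratedFDeriv_comp_right
    ((ContinuousLinearMap.id ℂ ℂ).smulRight z) (contDiff_of_entire hf k) (0 : ℂ) (i := k) le_rfl
  rw [homPart, iteratedDeriv_eq_iteratedFDeriv]
  have h2 : (f ∘ ⇑((ContinuousLinearMap.id ℂ ℂ).smulRight z)) = fun x : ℂ => f (x • z) := by
    ext x; simp
  rw [h2] at h
  rw [h]
  simp

lemma homPart_eq_integral_circ {f : Cn n → ℂ} (hf : Differentiable ℂ f) (k : ℕ) (z : Cn n) :
    homPart k f z = ∫ θ, f (rot θ • z) * (rot θ ^ k)⁻¹ ∂circ := by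
  rw [homPart_eq_iteratedDeriv hf, integral_circ_entire (differentiable_slice hf z)]

lemma homPart_smul (f : Cn n → ℂ) (k : ℕ) (c : ℂ) (z : Cn n) :
    homPart k f (c • z) = c ^ k * homPart k f z := by
  unfold homPart
  rw [(iteratedFDeriv ℂ k f 0).map_smul_univ (fun _ => c) (fun _ => z)]
  simp; ring

lemma hasSum_homPart {f : Cn n → ℂ} (hf : Differentiable ℂ f) (z : Cn n) :
    HasSum (fun k => homPart k f z) (f z) := by
  have h := Complex.hasSum_taylorSeries_of_entire (differentiable_slice hf z) 0 1
  simp only [sub_zero, one_pow, one_smul, smul_eq_mul, one_mul] at h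
  simpa only [homPart_eq_iteratedDeriv hf] using h

/-- Uniqueness of the expansion: a power series along the complex line through `z` identifies the
homogeneous parts at `z`. -/
lemma homPart_eq_of_hasSum {f : Cn n → ℂ} (hf : Differentiable ℂ f) {z : Cn n} {b : ℕ → ℂ}
    (h : ∀ c : ℂ, HasSum (fun k => b k * c ^ k) (f (c • z))) (k : ℕ) : homPart k f z = b k := by
  rw [homPart_eq_integral_circ hf]
  refine integral_circ_coeff ?_ (fun θ => h (rot θ)) k
  simpa using (h 1).summable.norm

lemma differentiable_homPart (f : Cn n → ℂ) (k : ℕ) : Differentiable ℂ (homPart k f) := by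
  unfold homPart
  have h := (iteratedFDeriv ℂ k f 0).contDiff (n := 1)
  have h2 : Differentiable ℂ (iteratedFDeriv ℂ k f 0) := h.differentiable (by simp)
  exact (h2.comp (by fun_prop)).const_mul _

lemma norm_homPart_le {f : Cn n → ℂ} (hf : Differentiable ℂ f) (k : ℕ) {z : Cn n} {M : ℝ}
    (hM : ∀ w : Cn n, ‖w‖ = ‖z‖ → ‖f w‖ ≤ M) : ‖homPart k f z‖ ≤ M := by
  rw [homPart_eq_integral_circ hf]
  refine (norm_integral_le_of_norm_le_const (C := M) (.of_forall fun θ => ?_)).trans (by simp)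
  simpa using hM (rot θ • z) (by simp [norm_smul])

lemma lowPart_differentiable (f : Cn n → ℂ) (s : ℝ) : Differentiable ℂ (lowPart s f) := by
  unfold lowPart
  exact Differentiable.fun_sum fun k _ => differentiable_homPart f k

lemma highPart_differentiable {f : Cn n → ℂ} (hf : Differentiable ℂ f) (s : ℝ) :
    Differentiable ℂ (highPart s f) :=
  hf.sub (lowPart_differentiable f s)

lemma homPart_lowPart {f : Cn n → ℂ} (s : ℝ) (k : ℕ) (z : Cn n) :
    homPart k (lowPart s f) z = if k ≤ ⌊|s|⌋₊ then homPart k f z else 0 := by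
  refine homPart_eq_of_hasSum (lowPart_differentiable f s)
    (b := fun k => if k ≤ ⌊|s|⌋₊ then homPart k f z else 0) (fun c => ?_) k
  have h := hasSum_sum_of_ne_finset_zero (L := .unconditional ℕ) (s := Finset.range (⌊|s|⌋₊ + 1))
    (f := fun k => (if k ≤ ⌊|s|⌋₊ then homPart k f z else 0) * c ^ k) (by
      intro k hk
      have : ¬ k ≤ ⌊|s|⌋₊ := by simpa using hk
      simp [this])
  convert h using 1
  refine Finset.sum_congr rfl fun k hk => ?_
  have : k ≤ ⌊|s|⌋₊ := by simpa [Nat.lt_succ_iff] using hk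
  simp [this, homPart_smul, mul_comm]

lemma homPart_highPart {f : Cn n → ℂ} (hf : Differentiable ℂ f) (s : ℝ) (k : ℕ) (z : Cn n) :
    homPart k (highPart s f) z = if k ≤ ⌊|s|⌋₊ then 0 else homPart k f z := by
  have h1 : ∀ g : Cn n → ℂ, Differentiable ℂ g →
      Integrable (fun θ => g (rot θ • z) * (rot θ ^ k)⁻¹) circ := by
    intro g hg
    have := hg.continuous
    exact integrable_circ_of_continuous
      (by fun_prop (disch := intros; exact pow_ne_zero _ (rot_ne_zero _)))
  have h2 := homPart_lowPart (f := f) s k z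
  rw [homPart_eq_integral_circ (lowPart_differentiable f s)] at h2
  rw [homPart_eq_integral_circ (highPart_differentiable hf s)]
  simp only [highPart, sub_mul]
  rw [integral_sub (h1 _ hf) (h1 _ (lowPart_differentiable f s)), h2,
    ← homPart_eq_integral_circ hf]
  split_ifs <;> simp

/-- A function vanishing to order `m` at the origin is `O(|z|^m)` on the unit ball. -/
lemma exists_norm_le_pow {f : Cn n → ℂ} (hf : Differentiable ℂ f) {m : ℕ}
    (h0 : ∀ k < m, ∀ z, homPart k f z = 0) :
    ∃ C : ℝ, 0 ≤ C ∧ ∀ z : Cn n, ‖z‖ ≤ 1 → ‖f z‖ ≤ C * ‖z‖ ^ m := by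
  obtain ⟨M, hM⟩ := (isCompact_closedBall (0 : Cn n) 2).exists_bound_of_continuousOn
    hf.continuous.continuousOn
  have hM0 : 0 ≤ M := (norm_nonneg _).trans (hM 0 (by simp))
  refine ⟨M * 2, by positivity, fun z hz => ?_⟩
  by_cases hz0 : z = 0
  · subst hz0
    rcases Nat.eq_zero_or_pos m with rfl | hm
    · simpa using (hM 0 (by simp)).trans (by linarith)
    · have h1 : (fun k => homPart k f 0) = fun _ => 0 := by
        ext k
        rcases Nat.eq_zero_or_pos k with rfl | hk
        · exact h0 0 hm 0
        · have := homPart_smul f k 0 0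
          simpa [hk.ne'] using this
      have h2 := hasSum_homPart hf 0
      rw [h1] at h2
      simp [h2.unique hasSum_zero, hm.ne']
  have hzp : 0 < ‖z‖ := norm_pos_iff.2 hz0
  have hb : ∀ k, ‖homPart k f z‖ ≤ (M * ‖z‖ ^ m) * (1 / 2) ^ k := by
    intro k
    by_cases hk : k < m
    · rw [h0 k hk]; simp; positivity
    -- Scaling `z` out to the sphere of radius `2`, where `|f| ≤ M`, produces a factor `(‖z‖/2)^k`;
    -- the `2^{-k}` makes the sum over `k ≥ m` converge.
    have h1 : z = ((‖z‖ / 2 : ℝ) : ℂ) • (((2 / ‖z‖ : ℝ) : ℂ) • z) := by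
      rw [smul_smul, ← Complex.ofReal_mul]
      field_simp
      simp
    have h2 : ‖homPart k f (((2 / ‖z‖ : ℝ) : ℂ) • z)‖ ≤ M := by
      refine norm_homPart_le hf k fun w hw => hM w ?_
      rw [norm_smul, Complex.norm_real, norm_div, norm_norm, div_mul_cancel₀ _ hzp.ne'] at hw
      simp [hw]
    rw [h1, homPart_smul, norm_mul, norm_pow, Complex.norm_real, norm_div, norm_norm,
      Real.norm_ofNat, ← h1, div_pow]
    have h3 : ‖z‖ ^ k ≤ ‖z‖ ^ m := pow_le_pow_of_le_one hzp.le hz (not_lt.1 hk)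
    calc ‖z‖ ^ k / 2 ^ k * ‖homPart k f (((2 / ‖z‖ : ℝ) : ℂ) • z)‖
        ≤ ‖z‖ ^ m / 2 ^ k * M := by gcongr
      _ = _ := by rw [div_pow]; ring
  have hs : HasSum (fun k : ℕ => (M * ‖z‖ ^ m) * (1 / 2 : ℝ) ^ k) ((M * ‖z‖ ^ m) * 2) :=
    hasSum_geometric_two.mul_left _
  calc ‖f z‖ = ‖∑' k, homPart k f z‖ := by rw [(hasSum_homPart hf z).tsum_eq]
    _ ≤ (M * ‖z‖ ^ m) * 2 := tsum_of_norm_bounded hs hb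
    _ = _ := by ring

end HomPart

/-! ### Polynomial growth against exponentials -/

lemma exists_growth_le (M R : ℝ) {c : ℝ} (hc : 0 < c) :
    ∃ C : ℝ, 0 < C ∧ ∀ t : ℝ, 0 ≤ t → (1 + t) ^ M * Real.exp (R * t) ≤ C * Real.exp (c * t ^ 2) := by
  refine ⟨Real.exp ((|M| + R) ^ 2 / (4 * c)), Real.exp_pos _, fun t ht => ?_⟩
  have h1 : (1 + t) ^ M ≤ Real.exp (|M| * t) := by
    calc (1 + t) ^ M ≤ (1 + t) ^ |M| := Real.rpow_le_rpow_of_exponent_le (by linarith) (le_abs_self M)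
      _ ≤ Real.exp t ^ |M| := by
        refine Real.rpow_le_rpow (by linarith) ?_ (abs_nonneg M)
        linarith [Real.add_one_le_exp t]
      _ = _ := by rw [← Real.exp_mul, mul_comm]
  calc (1 + t) ^ M * Real.exp (R * t) ≤ Real.exp (|M| * t) * Real.exp (R * t) := by gcongr
    _ = Real.exp ((|M| + R) * t) := by rw [← Real.exp_add]; ring_nf
    _ ≤ Real.exp ((|M| + R) ^ 2 / (4 * c) + c * t ^ 2) := by
      refine Real.exp_le_exp.2 ?_
      -- Completing the square is the origin of the constant.
      have h2 : (|M| + R) ^ 2 / (4 * c) + c * t ^ 2 - (|M| + R) * t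
          = (|M| + R - 2 * c * t) ^ 2 / (4 * c) := by field_simp; ring
      have h3 : 0 ≤ (|M| + R - 2 * c * t) ^ 2 / (4 * c) := by positivity
      linarith
    _ = _ := Real.exp_add _ _

lemma exists_growth_le_exp (M : ℝ) {c : ℝ} (hc : 0 < c) :
    ∃ C : ℝ, 0 < C ∧ ∀ t : ℝ, 0 ≤ t → (1 + t) ^ M ≤ C * Real.exp (c * t) := by
  obtain ⟨C, hC, h⟩ := exists_growth_le (2 * M) 0 hc
  refine ⟨2 ^ |M| * C, by positivity, fun t ht => ?_⟩
  -- The Gaussian version at `√t`, with exponent `2M` because `1 + t` and `(1 + √t)²` agree up to a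
  -- factor `2`.
  have h1 := h (Real.sqrt t) (Real.sqrt_nonneg t)
  rw [Real.sq_sqrt ht, zero_mul, Real.exp_zero, mul_one] at h1
  have hs : 0 ≤ Real.sqrt t := Real.sqrt_nonneg t
  have h4 : Real.sqrt t ^ 2 = t := Real.sq_sqrt ht
  have h2 : (1 + t) ^ M ≤ 2 ^ |M| * (1 + Real.sqrt t) ^ (2 * M) := by
    rw [Real.rpow_mul (by positivity), Real.rpow_two]
    rcases le_total 0 M with hM | hM
    · rw [abs_of_nonneg hM, ← Real.mul_rpow (by norm_num) (by positivity)]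
      exact Real.rpow_le_rpow (by positivity) (by nlinarith) hM
    · rw [abs_of_nonpos hM, Real.rpow_neg (by norm_num), ← Real.inv_rpow (by norm_num),
        ← Real.mul_rpow (by norm_num) (by positivity)]
      refine Real.rpow_le_rpow_of_nonpos (by positivity) ?_ hM
      nlinarith [sq_nonneg (Real.sqrt t - 1)]
  calc (1 + t) ^ M ≤ 2 ^ |M| * (1 + Real.sqrt t) ^ (2 * M) := h2
    _ ≤ 2 ^ |M| * (C * Real.exp (c * t)) := by gcongr
    _ = _ := by ring

/-! ### Gaussian integrability and rotation invariance -/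

section Measure

variable {n : ℕ}

instance : (V n).IsAddHaarMeasure :=
  Measure.IsAddHaarMeasure.smul volume
    (by simp only [ne_eq, ENNReal.ofReal_eq_zero, not_le]; positivity) ENNReal.ofReal_ne_top

lemma integrable_gaussian {c : ℝ} (hc : 0 < c) :
    Integrable (fun z : Cn n => Real.exp (-c * ‖z‖ ^ 2)) (V n) := by
  refine Integrable.smul_measure ?_ ENNReal.ofReal_ne_top
  -- A non-integrable function has integral `0` by convention, so a nonzero closed form proves
  -- integrability.
  refine Integrable.of_integral_ne_zero ?_
  rw [GaussianFourier.integral_rexp_neg_mul_sq_norm hc]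
  positivity

/-- Functions of at most exponential growth are integrable against the Gaussian. -/
lemma integrable_of_growth {f : Cn n → ℂ} (hf : AEStronglyMeasurable f (V n)) {A M R c : ℝ}
    (hc : 0 < c)
    (h : ∀ z, ‖f z‖ ≤ A * ((1 + ‖z‖) ^ M * Real.exp (R * ‖z‖)) * Real.exp (-c * ‖z‖ ^ 2)) :
    Integrable f (V n) := by
  obtain ⟨C, hC, hC'⟩ := exists_growth_le M R (half_pos hc)
  refine ((integrable_gaussian (n := n) (half_pos hc)).const_mul (|A| * C)).mono' hf
    (.of_forall fun z => (h z).trans ?_)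
  have h1 := hC' ‖z‖ (norm_nonneg z)
  calc A * ((1 + ‖z‖) ^ M * Real.exp (R * ‖z‖)) * Real.exp (-c * ‖z‖ ^ 2)
      ≤ |A| * (C * Real.exp (c / 2 * ‖z‖ ^ 2)) * Real.exp (-c * ‖z‖ ^ 2) := by
        gcongr
        exact le_abs_self A
    _ = |A| * C * (Real.exp (c / 2 * ‖z‖ ^ 2) * Real.exp (-c * ‖z‖ ^ 2)) := by ring
    _ = _ := by rw [← Real.exp_add]; ring_nf

lemma measurePreserving_rot (θ : ℝ) :
    MeasurePreserving (fun z : Cn n => rot θ • z) (V n) (V n) := by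
  have h0 : rot θ ≠ 0 := rot_ne_zero θ
  let e : Cn n ≃ₗᵢ[ℝ] Cn n :=
    { toLinearEquiv := (LinearEquiv.smulOfNeZero ℂ (Cn n) (rot θ) h0).restrictScalars ℝ
      norm_map' := fun z => by
        change ‖rot θ • z‖ = ‖z‖
        rw [norm_smul, norm_rot, one_mul] }
  have h := e.measurePreserving
  exact h.smul_measure _

/-- A skew product of rotations followed by projection from a probability space. It makes `(θ, z) ↦
g (rot θ • z)` integrable whenever `g` is, as Fubini requires. -/
lemma measurePreserving_rot_prod :
    MeasurePreserving (fun x : ℝ × Cn n => rot x.1 • x.2) (circ.prod (V n)) (V n) := by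
  have h : MeasurePreserving (fun x : ℝ × Cn n => (x.1, rot x.1 • x.2)) (circ.prod (V n))
      (circ.prod (V n)) := by
    refine (MeasurePreserving.id circ).skew_product (g := fun θ (z : Cn n) => rot θ • z) ?_
      (.of_forall fun θ => (measurePreserving_rot θ).map_eq)
    unfold Function.uncurry
    exact Continuous.measurable (by fun_prop)
  exact measurePreserving_snd.comp h

lemma integral_rot_smul (g : Cn n → ℂ) (θ : ℝ) : ∫ z, g (rot θ • z) ∂(V n) = ∫ z, g z ∂(V n) :=
  (measurePreserving_rot θ).integral_comp
    (Homeomorph.smulOfNeZero (rot θ) (rot_ne_zero θ)).measurableEmbedding g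

/-- An integral is not changed by averaging the integrand over circles. -/
lemma integral_eq_integral_circ {g : Cn n → ℂ} (hg : Integrable g (V n)) :
    ∫ z, g z ∂(V n) = ∫ z, ∫ θ, g (rot θ • z) ∂circ ∂(V n) := by
  have h : Integrable (Function.uncurry fun θ (z : Cn n) => g (rot θ • z)) (circ.prod (V n)) :=
    measurePreserving_rot_prod.integrable_comp_of_integrable hg
  rw [← integral_integral_swap h]
  simp_rw [integral_rot_smul]
  simp

end Measure

/-! ### Polar coordinates -/

section Polar

variable {n : ℕ}

/-- The radial factor in polar coordinates of the integral of a function which is homogeneous of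
degree `2k` against the radial weight `ρ`. -/
def radialMoment (n : ℕ) (ρ : ℝ → ℝ) (k : ℕ) : ℝ :=
  ∫ t in Set.Ioi (0 : ℝ), t ^ (2 * n - 1) * (t ^ (2 * k) * ρ t)

/-- The sphere factor does not depend on `ρ`, so two radial weights can be compared through their
moments alone. The product formula for integrals needs no integrability. -/
lemma integral_homogeneous_mul_radial (hn : 1 ≤ n) {h : Cn n → ℂ} {k : ℕ}
    (hh : ∀ (t : ℝ) z, 0 < t → h ((t : ℂ) • z) = (t : ℂ) ^ (2 * k) * h z) (ρ : ℝ → ℝ) :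
    ∫ z, h z * (ρ ‖z‖ : ℂ) ∂(V n) =
      (∫ x : Metric.sphere (0 : Cn n) 1, h x ∂(V n).toSphere) * (radialMoment n ρ k : ℂ) := by
  have hd : Module.finrank ℝ (Cn n) = 2 * n := by
    rw [← Module.finrank_mul_finrank ℝ ℂ (Cn n)]; simp
  have : Nontrivial (Cn n) := by
    have : Nonempty (Fin n) := ⟨⟨0, hn⟩⟩
    infer_instance
  let g : Metric.sphere (0 : Cn n) 1 × Set.Ioi (0 : ℝ) → ℂ :=
    fun x => h x.1 * (((x.2 : ℝ) ^ (2 * k) * ρ x.2 : ℝ) : ℂ)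
  calc ∫ z, h z * (ρ ‖z‖ : ℂ) ∂(V n)
      = ∫ z : ({(0)}ᶜ : Set (Cn n)), h z.1 * (ρ ‖z.1‖ : ℂ) ∂((V n).comap (↑)) := by
        rw [integral_subtype_comap (measurableSet_singleton _).compl
          fun z => h z * (ρ ‖z‖ : ℂ), restrict_compl_singleton]
    _ = ∫ z : ({(0)}ᶜ : Set (Cn n)), g (homeomorphUnitSphereProd (Cn n) z)
          ∂((V n).comap (↑)) := by
        refine integral_congr_ae (.of_forall fun z => ?_)
        have hz : (0 : ℝ) < ‖z.1‖ := norm_pos_iff.2 z.2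
        have h1 : (z : Cn n) = ((‖z.1‖ : ℝ) : ℂ) • ((homeomorphUnitSphereProd (Cn n) z).1 : Cn n) := by
          rw [homeomorphUnitSphereProd_apply_fst_coe]
          rw [← Complex.coe_smul, smul_smul, ← Complex.ofReal_mul, mul_inv_cancel₀ hz.ne']
          simp
        simp only [g, homeomorphUnitSphereProd_apply_snd_coe]
        conv_lhs => rw [h1, hh _ _ hz, ← h1]
        push_cast
        ring
    _ = ∫ x, g x ∂(V n).toSphere.prod (.volumeIoiPow (Module.finrank ℝ (Cn n) - 1)) :=
        (V n).measurePreserving_homeomorphUnitSphereProd.integral_comp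
          (Homeomorph.measurableEmbedding _) g
    _ = (∫ x : Metric.sphere (0 : Cn n) 1, h x ∂(V n).toSphere) *
          ∫ t : Set.Ioi (0 : ℝ), (((t : ℝ) ^ (2 * k) * ρ t : ℝ) : ℂ)
            ∂.volumeIoiPow (Module.finrank ℝ (Cn n) - 1) :=
        integral_prod_mul (fun x : Metric.sphere (0 : Cn n) 1 => h x)
          (fun t : Set.Ioi (0 : ℝ) => (((t : ℝ) ^ (2 * k) * ρ t : ℝ) : ℂ))
    _ = _ := by
        congr 1
        rw [integral_complex_ofReal, hd, radialMoment]
        simp only [Measure.volumeIoiPow, ENNReal.ofReal]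
        rw [integral_withDensity_eq_integral_smul,
          integral_subtype_comap measurableSet_Ioi fun a : ℝ =>
            Real.toNNReal (a ^ (2 * n - 1)) • (a ^ (2 * k) * ρ a),
          setIntegral_congr_fun measurableSet_Ioi fun x hx => ?_]
        · rw [NNReal.smul_def, Real.coe_toNNReal _ (pow_nonneg hx.out.le _), smul_eq_mul]
        · exact (measurable_subtype_coe.pow_const _).real_toNNReal

end Polar

/-! ### The classical Fock kernel -/

section Gaussian

variable {n : ℕ}

lemma norm_cexp_inner_le (w z : Cn n) : ‖Complex.exp (inner ℂ w z)‖ ≤ Real.exp (‖z‖ * ‖w‖) := by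
  rw [Complex.norm_exp]
  refine Real.exp_le_exp.2 ((Complex.re_le_norm _).trans ((norm_inner_le_norm w z).trans_eq ?_))
  ring

/-- The reproducing property of the classical Fock kernel on functions of polynomial growth. -/
lemma integral_mul_cexp_inner {q : Cn n → ℂ} (hq : Differentiable ℂ q) {A M : ℝ}
    (hA : ∀ w, ‖q w‖ ≤ A * (1 + ‖w‖) ^ M) (z : Cn n) :
    Integrable (fun w => q w * Complex.exp (inner ℂ w z) * (Real.exp (-‖w‖ ^ 2) : ℂ)) (V n) ∧
    ∫ w, q w * Complex.exp (inner ℂ w z) * (Real.exp (-‖w‖ ^ 2) : ℂ) ∂(V n) = q z := by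
  have hqc := hq.continuous
  have hint : Integrable (fun w => q w * Complex.exp (inner ℂ w z) *
      (Real.exp (-‖w‖ ^ 2) : ℂ)) (V n) := by
    refine integrable_of_growth (Continuous.aestronglyMeasurable (by fun_prop)) (A := A) (M := M)
      (R := ‖z‖) one_pos fun w => ?_
    rw [norm_mul, norm_mul, Complex.norm_real, Real.norm_of_nonneg (Real.exp_nonneg _), neg_mul,
      one_mul, ← mul_assoc]
    gcongr
    · exact (norm_nonneg _).trans (hA w)
    · exact hA w
    · exact norm_cexp_inner_le w z
  refine ⟨hint, ?_⟩
  -- Substituting `w = u + z` and expanding the square leaves a pure Gaussian in `u` times this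
  -- entire function, whose mean over each circle about `0` is `G 0 = q z`.
  let G : Cn n → ℂ := fun u => q (u + z) * Complex.exp (-inner ℂ z u)
  have hG : Differentiable ℂ G := by
    have : Differentiable ℂ fun u : Cn n => inner ℂ z u := (innerSL ℂ z).differentiable
    fun_prop
  have h1 : ∀ u : Cn n, q (u + z) * Complex.exp (inner ℂ (u + z) z) *
      (Real.exp (-‖u + z‖ ^ 2) : ℂ) = G u * (Real.exp (-‖u‖ ^ 2) : ℂ) := by
    intro u
    simp only [G, Complex.ofReal_exp, mul_assoc, ← Complex.exp_add]
    congr 2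
    push_cast
    have hs : ∀ x : Cn n, ((‖x‖ : ℝ) : ℂ) ^ 2 = inner ℂ x x := fun x =>
      (inner_self_eq_norm_sq_to_K x).symm
    rw [hs, hs]
    simp only [inner_add_left, inner_add_right]
    ring
  have h2 := integral_add_right_eq_self (μ := V n) (fun w => q w * Complex.exp (inner ℂ w z) *
    (Real.exp (-‖w‖ ^ 2) : ℂ)) z
  have h3 := hint.comp_add_right z
  simp only [h1] at h2 h3
  rw [← h2, integral_eq_integral_circ h3]
  have h4 : ∀ u : Cn n, ∫ θ, G (rot θ • u) * (Real.exp (-‖rot θ • u‖ ^ 2) : ℂ) ∂circ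
      = q z * (Real.exp (-‖u‖ ^ 2) : ℂ) := by
    intro u
    simp only [norm_smul, norm_rot, one_mul]
    rw [integral_mul_const]
    have h5 := integral_circ_entire (differentiable_slice hG u) 0
    simp only [pow_zero, inv_one, mul_one, Nat.factorial_zero, Nat.cast_one, one_mul,
      iteratedDeriv_zero, zero_smul] at h5
    rw [h5]
    simp [G]
  simp_rw [h4]
  rw [integral_const_mul, integral_complex_ofReal, integral_gaussian]
  simp

/-- Reproduction of homogeneous entire functions. -/
lemma integral_homogeneous_mul_inner_pow {q : Cn n → ℂ} (hq : Differentiable ℂ q) {k : ℕ}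
    (hk : ∀ (c : ℂ) w, q (c • w) = c ^ k * q w) (z : Cn n) :
    ∫ w, q w * (inner ℂ w z) ^ k * (Real.exp (-‖w‖ ^ 2) : ℂ) ∂(V n) = k.factorial * q z := by
  obtain ⟨A, hA⟩ := (isCompact_sphere (0 : Cn n) 1).exists_bound_of_continuousOn
    hq.continuous.continuousOn
  have hA' : ∀ w : Cn n, ‖q w‖ ≤ (|A| + ‖q 0‖) * (1 + ‖w‖) ^ (k : ℝ) := by
    intro w
    rw [Real.rpow_natCast]
    by_cases hw : w = 0
    · subst hw; simp
    have hw' : 0 < ‖w‖ := norm_pos_iff.2 hw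
    have h1 : w = ((‖w‖ : ℝ) : ℂ) • (((‖w‖⁻¹ : ℝ) : ℂ) • w) := by
      rw [smul_smul, ← Complex.ofReal_mul, mul_inv_cancel₀ hw'.ne']; simp
    have h2 : ‖q (((‖w‖⁻¹ : ℝ) : ℂ) • w)‖ ≤ A := hA _ (by
      simp only [mem_sphere_iff_norm, sub_zero, norm_smul, Complex.norm_real, norm_inv, norm_norm]
      exact inv_mul_cancel₀ hw'.ne')
    rw [h1, hk, ← h1, norm_mul, norm_pow, Complex.norm_real, norm_norm, mul_comm]
    gcongr
    · exact h2.trans ((le_abs_self A).trans (by linarith [norm_nonneg (q 0)]))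
    · linarith
  obtain ⟨h1, h2⟩ := integral_mul_cexp_inner hq hA' z
  rw [← h2, integral_eq_integral_circ h1, ← integral_const_mul]
  refine integral_congr_ae (.of_forall fun w => ?_)
  simp only [norm_smul, norm_rot, one_mul]
  rw [integral_mul_const, ← mul_assoc]
  congr 1
  have h3 : ∀ x : ℂ, HasSum (fun j : ℕ => (j.factorial : ℂ)⁻¹ * x ^ j) (Complex.exp x) := by
    intro x
    have := NormedSpace.expSeries_div_hasSum_exp (𝔸 := ℂ) x
    rw [← Complex.exp_eq_exp_ℂ] at this
    simpa [div_eq_inv_mul] using this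
  -- Since `q` picks up the character `e^{ikθ}`, averaging `q(w) e^{⟨w,z⟩}` over the circle keeps
  -- only the degree-`k` term of the exponential, which accounts for the `k!`.
  have h4 := integral_circ_coeff (b := fun j => (j.factorial : ℂ)⁻¹ * (conj (inner ℂ w z)) ^ j)
    (F := fun θ => Complex.exp (conj (inner ℂ w z) * rot θ)) (by
      simpa using (h3 (conj (inner ℂ w z))).summable.norm)
    (fun θ => by simpa [mul_pow, mul_assoc] using h3 (conj (inner ℂ w z) * rot θ)) k
  have h5 : ∀ θ, q (rot θ • w) * Complex.exp (inner ℂ (rot θ • w) z) =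
      q w * conj (Complex.exp (conj (inner ℂ w z) * rot θ) * (rot θ ^ k)⁻¹) := by
    intro θ
    have h6 : conj (rot θ) = (rot θ)⁻¹ := by
      rw [Complex.inv_def, Complex.normSq_eq_norm_sq]; simp
    rw [hk, inner_smul_left, map_mul, map_inv₀, map_pow, h6, ← Complex.exp_conj, map_mul, h6]
    simp only [Complex.conj_conj, inv_pow, inv_inv]
    ring_nf
  simp_rw [h5]
  rw [integral_const_mul, integral_conj, h4]
  simp only [map_mul, map_inv₀, map_natCast, map_pow, Complex.conj_conj]
  field_simp [Nat.factorial_ne_zero k]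

end Gaussian

/-! ### Pairing with power series in the inner product -/

section RadialPairing

variable {n : ℕ}

lemma radialMoment_rpow_mul_exp (hn : 1 ≤ n) {α : ℝ} {k : ℕ} (h : 0 < k + n - α / 2) :
    radialMoment n (fun t => t ^ (-α) * Real.exp (-t ^ 2)) k = Real.Gamma (k + n - α / 2) / 2 := by
  have h1 := integral_rpow_mul_exp_neg_rpow (p := 2) (q := 2 * n - 1 + 2 * k - α) two_pos
    (by linarith)
  have h2 : (2 * (n : ℝ) - 1 + 2 * k - α + 1) / 2 = k + n - α / 2 := by ring
  rw [h2] at h1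
  have h3 : radialMoment n (fun t => t ^ (-α) * Real.exp (-t ^ 2)) k
      = ∫ t in Set.Ioi (0 : ℝ), t ^ (2 * (n : ℝ) - 1 + 2 * k - α) * Real.exp (-t ^ (2 : ℝ)) := by
    refine setIntegral_congr_fun measurableSet_Ioi fun t ht => ?_
    have ht : 0 < t := ht
    have h4 : (2 * (n : ℝ) - 1 + 2 * k - α) = ((2 * n - 1 : ℕ) : ℝ) + ((2 * k : ℕ) : ℝ) + -α := by
      push_cast [Nat.cast_sub (show 1 ≤ 2 * n by omega)]; ring
    simp only
    rw [h4, Real.rpow_add ht, Real.rpow_add ht, Real.rpow_natCast, Real.rpow_natCast,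
      Real.rpow_two]
    ring
  rw [h3, h1]; ring

/-- The radial moments of the Gaussian. -/
lemma radialMoment_gaussian (hn : 1 ≤ n) (k : ℕ) :
    radialMoment n (fun t => Real.exp (-t ^ 2)) k = Real.Gamma (k + n) / 2 := by
  have hn' : (0 : ℝ) < n := by exact_mod_cast hn
  have h := radialMoment_rpow_mul_exp hn (α := 0) (k := k) (by simp; positivity)
  simpa using h

lemma radialMoment_gaussian_pos (hn : 1 ≤ n) (k : ℕ) :
    0 < radialMoment n (fun t => Real.exp (-t ^ 2)) k := by
  have hn' : (0 : ℝ) < n := by exact_mod_cast hn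
  rw [radialMoment_gaussian hn]
  have := Real.Gamma_pos_of_pos (show (0 : ℝ) < k + n by positivity)
  positivity

lemma conj_rot (θ : ℝ) : conj (rot θ) = (rot θ)⁻¹ := by
  rw [Complex.inv_def, Complex.normSq_eq_norm_sq]; simp

/-- Circle averaging replaces `f` by `homPart k f`, so the integrand becomes homogeneous of degree
`2k` times a radial weight. The same sphere integral occurs for the Gaussian, where the value is
already known; dividing eliminates it. -/
lemma integral_mul_inner_pow_mul_radial (hn : 1 ≤ n) {f : Cn n → ℂ} (hf : Differentiable ℂ f)
    {ρ : ℝ → ℝ} {k : ℕ} {z : Cn n}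
    (hi : Integrable (fun w => f w * (inner ℂ w z) ^ k * (ρ ‖w‖ : ℂ)) (V n)) :
    ∫ w, f w * (inner ℂ w z) ^ k * (ρ ‖w‖ : ℂ) ∂(V n) =
      k.factorial * ((radialMoment n ρ k / radialMoment n (fun t => Real.exp (-t ^ 2)) k : ℝ) : ℂ)
        * homPart k f z := by
  have h1 : ∀ w : Cn n, ∫ θ, f (rot θ • w) * (inner ℂ (rot θ • w) z) ^ k * (ρ ‖rot θ • w‖ : ℂ) ∂circ
      = homPart k f w * (inner ℂ w z) ^ k * (ρ ‖w‖ : ℂ) := by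
    intro w
    rw [homPart_eq_integral_circ hf, ← integral_mul_const, ← integral_mul_const]
    refine integral_congr_ae (.of_forall fun θ => ?_)
    simp only [norm_smul, norm_rot, one_mul, inner_smul_left, conj_rot, mul_pow, inv_pow]
    ring
  rw [integral_eq_integral_circ hi]
  simp_rw [h1]
  have hh : ∀ (t : ℝ) w, 0 < t → (fun w => homPart k f w * (inner ℂ w z) ^ k) ((t : ℂ) • w) =
      (t : ℂ) ^ (2 * k) * (fun w => homPart k f w * (inner ℂ w z) ^ k) w := by
    intro t w _
    simp only [homPart_smul, inner_smul_left, Complex.conj_ofReal]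
    ring
  have h2 := integral_homogeneous_mul_radial hn (h := fun w => homPart k f w * (inner ℂ w z) ^ k) hh ρ
  have h3 := integral_homogeneous_mul_radial hn (h := fun w => homPart k f w * (inner ℂ w z) ^ k) hh
    fun t => Real.exp (-t ^ 2)
  have h4 := integral_homogeneous_mul_inner_pow (differentiable_homPart f k)
    (fun c w => homPart_smul f k c w) z
  have h5 : ((radialMoment n (fun t => Real.exp (-t ^ 2)) k : ℝ) : ℂ) ≠ 0 :=
    Complex.ofReal_ne_zero.2 (radialMoment_gaussian_pos hn k).ne'
  rw [h4] at h3
  rw [h2]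
  push_cast
  field_simp
  linear_combination (-(radialMoment n ρ k : ℂ)) * h3

/-- The entire function with Taylor coefficients `a k / k!`. -/
def expSeries (a : ℕ → ℝ) (x : ℂ) : ℂ := ∑' k, ((a k / k.factorial : ℝ) : ℂ) * x ^ k

/-- The real version of `expSeries`, used for majorants. -/
def expSeriesReal (a : ℕ → ℝ) (x : ℝ) : ℝ := ∑' k, a k / k.factorial * x ^ k

/-- The pairing of an entire function with `w ↦ expSeries a ⟪z, w⟫` against a radial weight. -/
lemma hasSum_integral_mul_expSeries (hn : 1 ≤ n) {f : Cn n → ℂ} (hf : Differentiable ℂ f)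
    {ρ : ℝ → ℝ} (hρ : Measurable ρ) (hρ0 : ∀ t, 0 ≤ t → 0 ≤ ρ t) {a : ℕ → ℝ} (ha : ∀ k, 0 ≤ a k)
    (hs : ∀ x : ℝ, Summable fun k => a k / k.factorial * x ^ k) {z : Cn n}
    (hi : Integrable (fun w => ‖f w‖ * expSeriesReal a (‖w‖ * ‖z‖) * ρ ‖w‖) (V n)) :
    HasSum (fun k => ((a k * (radialMoment n ρ k /
        radialMoment n (fun t => Real.exp (-t ^ 2)) k) : ℝ) : ℂ) * homPart k f z)
      (∫ w, f w * expSeries a (inner ℂ w z) * (ρ ‖w‖ : ℂ) ∂(V n)) := by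
  have hfc := hf.continuous
  let F : ℕ → Cn n → ℂ := fun k w =>
    ((a k / k.factorial : ℝ) : ℂ) * (f w * (inner ℂ w z) ^ k * (ρ ‖w‖ : ℂ))
  let b : ℕ → Cn n → ℝ := fun k w =>
    ‖f w‖ * (a k / k.factorial * (‖w‖ * ‖z‖) ^ k) * ρ ‖w‖
  have hFm : ∀ k, AEStronglyMeasurable (F k) (V n) := by
    intro k
    have h1 : Measurable fun w : Cn n => (ρ ‖w‖ : ℂ) :=
      Complex.measurable_ofReal.comp (hρ.comp measurable_norm)
    have h2 : Measurable fun w : Cn n => f w * (inner ℂ w z) ^ k :=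
      Continuous.measurable (by fun_prop)
    exact ((h2.mul h1).const_mul _).aestronglyMeasurable
  have hFb : ∀ k w, ‖F k w‖ ≤ b k w := by
    intro k w
    have h0 : 0 ≤ a k / k.factorial := div_nonneg (ha k) (by positivity)
    have h1 : 0 ≤ ρ ‖w‖ := hρ0 _ (norm_nonneg w)
    simp only [F, b, norm_mul, norm_pow, Complex.norm_real, Real.norm_of_nonneg h0,
      Real.norm_of_nonneg h1]
    have h2 := norm_inner_le_norm (𝕜 := ℂ) w z
    calc a k / k.factorial * (‖f w‖ * ‖inner ℂ w z‖ ^ k * ρ ‖w‖)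
        ≤ a k / k.factorial * (‖f w‖ * (‖w‖ * ‖z‖) ^ k * ρ ‖w‖) := by gcongr
      _ = _ := by ring
  have hbs : ∀ w, HasSum (fun k => b k w) (‖f w‖ * expSeriesReal a (‖w‖ * ‖z‖) * ρ ‖w‖) :=
    fun w => ((hs _).hasSum.mul_left _).mul_right _
  have hFi : ∀ k, Integrable (F k) (V n) := by
    intro k
    refine hi.mono' (hFm k) (.of_forall fun w => (hFb k w).trans ?_)
    refine le_hasSum (hbs w) k fun j _ => (norm_nonneg _).trans (hFb j w)
  have hsC : ∀ w : Cn n, HasSum (fun k => F k w)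
      (f w * expSeries a (inner ℂ w z) * (ρ ‖w‖ : ℂ)) := by
    intro w
    have h1 : Summable fun k => ((a k / k.factorial : ℝ) : ℂ) * (inner ℂ w z) ^ k := by
      refine Summable.of_norm_bounded (hs ‖inner ℂ w z‖) fun k => ?_
      rw [norm_mul, norm_pow, Complex.norm_real,
        Real.norm_of_nonneg (div_nonneg (ha k) (by positivity))]
    have h2 := (h1.hasSum.mul_left (f w)).mul_right (ρ ‖w‖ : ℂ)
    have e : (fun k => F k w) = fun k =>
        f w * (((a k / k.factorial : ℝ) : ℂ) * (inner ℂ w z) ^ k) * (ρ ‖w‖ : ℂ) := by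
      funext k; simp only [F]; ring
    rw [e]; exact h2
  have h := hasSum_integral_of_dominated_convergence b hFm (fun k => .of_forall (hFb k))
    (.of_forall fun w => (hbs w).summable)
    (hi.congr (.of_forall fun w => (hbs w).tsum_eq.symm)) (.of_forall hsC)
  have e : ∀ k, ((a k * (radialMoment n ρ k / radialMoment n (fun t => Real.exp (-t ^ 2)) k) : ℝ) : ℂ)
      * homPart k f z = ∫ w, F k w ∂(V n) := fun k => ?_
  · simpa only [e] using h
  simp only [F]
  rw [integral_const_mul]
  have h0 : (k.factorial : ℂ) ≠ 0 := Nat.cast_ne_zero.2 (Nat.factorial_ne_zero k)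
  -- Integrability of the `k`-th moment is obtained by dividing out `a k`. Where `a k = 0` the
  -- moment may diverge, but the term vanishes.
  by_cases hak : a k = 0
  · simp [hak]
  have h1 : Integrable (fun w => f w * (inner ℂ w z) ^ k * (ρ ‖w‖ : ℂ)) (V n) := by
    have h2 : ((a k / k.factorial : ℝ) : ℂ) ≠ 0 := by
      push_cast
      exact div_ne_zero (Complex.ofReal_ne_zero.2 hak) h0
    have := (hFi k).const_mul ((a k / k.factorial : ℝ) : ℂ)⁻¹
    simpa only [F, inv_mul_cancel_left₀ h2] using this
  rw [integral_mul_inner_pow_mul_radial hn hf h1]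
  push_cast
  field_simp

end RadialPairing

/-! ### Growth of the kernel series -/

section BetaIntegral

lemma integrableOn_beta {u v : ℝ} (hu : 0 < u) (hv : 0 < v) :
    IntegrableOn (fun t : ℝ => t ^ (u - 1) * (1 - t) ^ (v - 1)) (Set.Ioo 0 1) := by
  have h := Complex.betaIntegral_convergent (u := u) (v := v) (by simpa) (by simpa)
  rw [intervalIntegrable_iff_integrableOn_Ioo_of_le zero_le_one] at h
  refine IntegrableOn.congr_fun (f := fun t : ℝ =>
    RCLike.re ((t : ℂ) ^ ((u : ℂ) - 1) * (1 - (t : ℂ)) ^ ((v : ℂ) - 1))) h.re (fun t ht => ?_)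
    measurableSet_Ioo
  have h1 : (1 - (t : ℂ)) = ((1 - t : ℝ) : ℂ) := by push_cast; ring
  have h2 : ((u : ℂ) - 1) = ((u - 1 : ℝ) : ℂ) := by push_cast; ring
  have h3 : ((v : ℂ) - 1) = ((v - 1 : ℝ) : ℂ) := by push_cast; ring
  simp only
  rw [h1, h2, h3, ← Complex.ofReal_cpow ht.1.le, ← Complex.ofReal_cpow (by linarith [ht.2]),
    ← Complex.ofReal_mul]
  exact Complex.ofReal_re _

lemma integral_beta {u v : ℝ} (hu : 0 < u) (hv : 0 < v) :
    ∫ t in Set.Ioo (0 : ℝ) 1, t ^ (u - 1) * (1 - t) ^ (v - 1) =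
      Real.Gamma u * Real.Gamma v / Real.Gamma (u + v) := by
  have h := Complex.Gamma_mul_Gamma_eq_betaIntegral (s := u) (t := v) (by simpa) (by simpa)
  have h0 : (∫ t in Set.Ioo (0 : ℝ) 1, ((t ^ (u - 1) * (1 - t) ^ (v - 1) : ℝ) : ℂ))
      = Complex.betaIntegral u v := by
    rw [Complex.betaIntegral, intervalIntegral.integral_of_le zero_le_one,
      integral_Ioc_eq_integral_Ioo]
    refine setIntegral_congr_fun measurableSet_Ioo fun t ht => ?_
    have h1 : (1 - (t : ℂ)) = ((1 - t : ℝ) : ℂ) := by push_cast; ring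
    have h2 : ((u : ℂ) - 1) = ((u - 1 : ℝ) : ℂ) := by push_cast; ring
    have h3 : ((v : ℂ) - 1) = ((v - 1 : ℝ) : ℂ) := by push_cast; ring
    rw [h1, h2, h3, ← Complex.ofReal_cpow ht.1.le, ← Complex.ofReal_cpow (by linarith [ht.2]),
      ← Complex.ofReal_mul]
  rw [integral_complex_ofReal] at h0
  rw [← h0, ← Complex.ofReal_add, Complex.Gamma_ofReal, Complex.Gamma_ofReal,
    Complex.Gamma_ofReal] at h
  have h4 := Real.Gamma_pos_of_pos (add_pos hu hv)
  rw [eq_div_iff h4.ne', mul_comm]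
  exact_mod_cast h.symm

/-- The comparison function in the estimates of the kernels. -/
def kernelBound (σ : ℝ) (x : ℂ) : ℝ :=
  (1 + ‖x‖) ^ σ * (Real.exp x.re + Real.exp (‖x‖ / 2))

lemma kernelBound_nonneg (σ : ℝ) (x : ℂ) : 0 ≤ kernelBound σ x := by
  unfold kernelBound; positivity

/-- If `|x| ≥ 1` and `Re x ≥ |x|/4`, extending the integral to `(0, ∞)` gives `Γ(γ) (Re x)^{-γ}
e^{Re x}`, and `1 + |x| ≤ 8 Re x`. Otherwise the exponent is at most `1 + |x|/4`, which leaves room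
inside `e^{|x|/2}` to absorb `(1 + |x|)^γ`. -/
lemma integral_exp_mul_rpow_le {γ : ℝ} (hγ : 0 < γ) :
    ∃ C : ℝ, ∀ x : ℂ, IntegrableOn (fun u : ℝ => Real.exp ((1 - u) * x.re) * u ^ (γ - 1))
      (Set.Ioo 0 1) ∧
      ∫ u in Set.Ioo (0 : ℝ) 1, Real.exp ((1 - u) * x.re) * u ^ (γ - 1) ≤ C * kernelBound (-γ) x := by
  have hJi : IntegrableOn (fun u : ℝ => u ^ (γ - 1)) (Set.Ioo 0 1) := by
    simpa using integrableOn_beta hγ one_pos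
  have hi : ∀ x : ℂ, IntegrableOn (fun u : ℝ => Real.exp ((1 - u) * x.re) * u ^ (γ - 1))
      (Set.Ioo 0 1) := by
    intro x
    have h1 : IntegrableOn (fun u : ℝ => u ^ (γ - 1)) (Set.Icc 0 1) :=
      (integrableOn_Icc_iff_integrableOn_Ioo).2 hJi
    exact (h1.continuousOn_mul (by fun_prop) isCompact_Icc).mono_set Set.Ioo_subset_Icc_self
  set J : ℝ := ∫ u in Set.Ioo (0 : ℝ) 1, u ^ (γ - 1) with hJ
  have hJ0 : 0 ≤ J := setIntegral_nonneg measurableSet_Ioo fun u hu => Real.rpow_nonneg hu.1.le _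
  obtain ⟨C, hC, hC'⟩ := exists_growth_le_exp γ (c := 1 / 4) (by norm_num)
  have hG := Real.Gamma_pos_of_pos hγ
  refine ⟨8 ^ γ * Real.Gamma γ + Real.exp 1 * J * C, fun x => ⟨hi x, ?_⟩⟩
  have hx0 := norm_nonneg x
  have hpos : 0 < (1 + ‖x‖) ^ γ := by positivity
  by_cases hx : 1 ≤ ‖x‖ ∧ ‖x‖ / 4 ≤ x.re
  · obtain ⟨hx1, hx2⟩ := hx
    have hρ : 0 < x.re := by linarith
    have h1 := Real.integral_rpow_mul_exp_neg_mul_Ioi hγ hρ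
    have h1i : IntegrableOn (fun u : ℝ => u ^ (γ - 1) * Real.exp (-(x.re * u))) (Set.Ioi 0) := by
      refine Integrable.of_integral_ne_zero ?_
      rw [h1]; positivity
    calc ∫ u in Set.Ioo (0 : ℝ) 1, Real.exp ((1 - u) * x.re) * u ^ (γ - 1)
        = ∫ u in Set.Ioo (0 : ℝ) 1, Real.exp x.re * (u ^ (γ - 1) * Real.exp (-(x.re * u))) := by
          refine setIntegral_congr_fun measurableSet_Ioo fun u _ => ?_
          rw [show (1 - u) * x.re = x.re + -(x.re * u) by ring, Real.exp_add]; ring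
      _ = Real.exp x.re * ∫ u in Set.Ioo (0 : ℝ) 1, u ^ (γ - 1) * Real.exp (-(x.re * u)) :=
          integral_const_mul _ _
      _ ≤ Real.exp x.re * ∫ u in Set.Ioi (0 : ℝ), u ^ (γ - 1) * Real.exp (-(x.re * u)) := by
          refine mul_le_mul_of_nonneg_left ?_ (Real.exp_nonneg _)
          refine setIntegral_mono_set h1i ?_ Set.Ioo_subset_Ioi_self.eventuallyLE
          filter_upwards [ae_restrict_mem measurableSet_Ioi] with u hu
          have hu : 0 < u := hu
          simp only [Pi.zero_apply]; positivity
      _ = Real.exp x.re * ((1 / x.re) ^ γ * Real.Gamma γ) := by rw [h1]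
      _ ≤ Real.exp x.re * ((8 / (1 + ‖x‖)) ^ γ * Real.Gamma γ) := by
          have : 1 / x.re ≤ 8 / (1 + ‖x‖) := by
            rw [div_le_div_iff₀ hρ (by positivity)]
            linarith
          gcongr Real.exp x.re * (?_ ^ γ * Real.Gamma γ)
      _ = (8 ^ γ * Real.Gamma γ + 0) * ((1 + ‖x‖) ^ (-γ) * (Real.exp x.re + 0)) := by
          rw [Real.div_rpow (by norm_num) (by positivity), Real.rpow_neg (by positivity)]
          ring
      _ ≤ _ := by
          unfold kernelBound
          gcongr <;> positivity
  · have h1 : ∀ u ∈ Set.Ioo (0 : ℝ) 1, (1 - u) * x.re ≤ 1 + ‖x‖ / 4 := by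
      intro u hu
      have hre := Complex.re_le_norm x
      have hre0 : (1 - u) * x.re ≤ max x.re 0 := by
        rcases le_total 0 x.re with h | h
        · exact le_trans (by nlinarith [hu.1, hu.2]) (le_max_left _ _)
        · exact le_trans (mul_nonpos_of_nonneg_of_nonpos (by linarith [hu.2]) h) (le_max_right _ _)
      refine hre0.trans (max_le ?_ (by positivity))
      by_contra hcon
      push Not at hcon
      exact hx ⟨by linarith, by linarith⟩
    calc ∫ u in Set.Ioo (0 : ℝ) 1, Real.exp ((1 - u) * x.re) * u ^ (γ - 1)
        ≤ ∫ u in Set.Ioo (0 : ℝ) 1, Real.exp (1 + ‖x‖ / 4) * u ^ (γ - 1) := by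
          refine setIntegral_mono_on (hi x) (hJi.const_mul _) measurableSet_Ioo fun u hu => ?_
          have := Real.rpow_nonneg hu.1.le (γ - 1)
          gcongr
          exact h1 u hu
      _ = Real.exp 1 * J * Real.exp (‖x‖ / 4) := by
          rw [integral_const_mul, Real.exp_add]; ring
      _ = Real.exp 1 * J * ((1 + ‖x‖) ^ (-γ) * ((1 + ‖x‖) ^ γ * Real.exp (‖x‖ / 4))) := by
          rw [← mul_assoc ((1 + ‖x‖) ^ (-γ)), ← Real.rpow_add (by positivity)]; simp
      _ ≤ Real.exp 1 * J * ((1 + ‖x‖) ^ (-γ) * (C * Real.exp (1 / 4 * ‖x‖) * Real.exp (‖x‖ / 4))) := by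
          gcongr
          exact hC' _ hx0
      _ = (0 + Real.exp 1 * J * C) * ((1 + ‖x‖) ^ (-γ) * (0 + Real.exp (‖x‖ / 2))) := by
          have : Real.exp (‖x‖ / 2) = Real.exp (1 / 4 * ‖x‖) * Real.exp (‖x‖ / 4) := by
            rw [← Real.exp_add]; ring_nf
          rw [this]; ring
      _ ≤ _ := by
          unfold kernelBound
          gcongr <;> positivity

/-- All the shifts of the sequence `a` have exponential generating functions
dominated by `kernelBound σ`. -/
def KernelGrowth (σ : ℝ) (a : ℕ → ℝ) : Prop :=
  ∀ j : ℕ, ∃ C : ℝ, ∀ x : ℂ, ∃ y : ℂ,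
    HasSum (fun k => ((a (k + j) / k.factorial : ℝ) : ℂ) * x ^ k) y ∧ ‖y‖ ≤ C * kernelBound σ x

/-- The Gamma quotient is a Beta integral of `u^{γ-1} (1-u)^{k+b-1}` divided by `Γ(γ)`. Summing over
`k` turns `(1-u)^k` into `e^{(1-u)x}`, and `b ≥ 1` lets the remaining power of `1 - u` be dropped.
-/
lemma kernelGrowth_beta {b γ : ℝ} (hb : 1 ≤ b) (hγ : 0 < γ) :
    ∃ C : ℝ, ∀ x : ℂ, ∃ y : ℂ,
      HasSum (fun k : ℕ => ((Real.Gamma (k + b) / Real.Gamma (k + b + γ) / k.factorial : ℝ) : ℂ)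
        * x ^ k) y ∧ ‖y‖ ≤ C * kernelBound (-γ) x := by
  obtain ⟨C, hC⟩ := integral_exp_mul_rpow_le hγ
  have hG := Real.Gamma_pos_of_pos hγ
  refine ⟨(Real.Gamma γ)⁻¹ * C, fun x => ?_⟩
  obtain ⟨hi, hle⟩ := hC x
  let w : ℝ → ℝ := fun u => u ^ (γ - 1) * (1 - u) ^ (b - 1)
  have hwi : IntegrableOn w (Set.Ioo 0 1) := integrableOn_beta hγ (by linarith)
  have hw0 : ∀ u ∈ Set.Ioo (0 : ℝ) 1, 0 ≤ w u := fun u hu =>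
    mul_nonneg (Real.rpow_nonneg hu.1.le _) (Real.rpow_nonneg (by linarith [hu.2]) _)
  let F : ℕ → ℝ → ℂ := fun k u => (x * (1 - u : ℝ)) ^ k / k.factorial * (w u : ℂ)
  have hFm : ∀ k, AEStronglyMeasurable (F k) (volume.restrict (Set.Ioo 0 1)) := fun k =>
    (Continuous.aestronglyMeasurable (by fun_prop)).mul
      (Complex.continuous_ofReal.comp_aestronglyMeasurable hwi.aestronglyMeasurable)
  have hexp : ∀ c : ℝ, HasSum (fun k : ℕ => c ^ k / k.factorial) (Real.exp c) := fun c => by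
    have := NormedSpace.expSeries_div_hasSum_exp (𝔸 := ℝ) c
    rwa [← Real.exp_eq_exp_ℝ] at this
  have hexpC : ∀ c : ℂ, HasSum (fun k : ℕ => c ^ k / k.factorial) (Complex.exp c) := fun c => by
    have := NormedSpace.expSeries_div_hasSum_exp (𝔸 := ℂ) c
    rwa [← Complex.exp_eq_exp_ℂ] at this
  have h := hasSum_integral_of_dominated_convergence
    (F := F) (f := fun u => Complex.exp (x * (1 - u : ℝ)) * (w u : ℂ))
    (μ := volume.restrict (Set.Ioo 0 1)) (fun k u => ‖x‖ ^ k / k.factorial * w u) hFm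
    (fun k => by
      filter_upwards [ae_restrict_mem measurableSet_Ioo] with u hu
      have h1 : |1 - u| ≤ 1 := by rw [abs_le]; constructor <;> linarith [hu.1, hu.2]
      simp only [F, norm_mul, norm_div, norm_pow, Complex.norm_real, Complex.norm_natCast,
        Real.norm_eq_abs, abs_of_nonneg (hw0 u hu)]
      have := hw0 u hu
      gcongr
      exact mul_le_of_le_one_right (norm_nonneg x) h1)
    (.of_forall fun u => (hexp ‖x‖).summable.mul_right _)
    (by
      simp_rw [tsum_mul_right]
      exact hwi.const_mul _)
    (.of_forall fun u => (hexpC _).mul_right _)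
  refine ⟨((Real.Gamma γ)⁻¹ : ℝ) * ∫ u in Set.Ioo (0 : ℝ) 1,
    Complex.exp (x * (1 - u : ℝ)) * (w u : ℂ), ?_, ?_⟩
  · have e : ∀ k : ℕ, ((Real.Gamma (k + b) / Real.Gamma (k + b + γ) / k.factorial : ℝ) : ℂ) * x ^ k
        = ((Real.Gamma γ)⁻¹ : ℝ) * ∫ u in Set.Ioo (0 : ℝ) 1, F k u := by
      intro k
      have h1 := integral_beta hγ (show 0 < k + b by positivity)
      have h2 : ∫ u in Set.Ioo (0 : ℝ) 1, F k u = x ^ k / k.factorial *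
          ((∫ u in Set.Ioo (0 : ℝ) 1, u ^ (γ - 1) * (1 - u) ^ ((k : ℝ) + b - 1) : ℝ) : ℂ) := by
        rw [← integral_complex_ofReal, ← integral_const_mul]
        refine setIntegral_congr_fun measurableSet_Ioo fun u hu => ?_
        have hu1 : 0 < 1 - u := by linarith [hu.2]
        simp only [F, w]
        rw [show (k : ℝ) + b - 1 = k + (b - 1) by ring, Real.rpow_add hu1, Real.rpow_natCast]
        rw [mul_pow]
        push_cast
        ring
      rw [h2, h1, add_comm γ]
      push_cast
      have : (Real.Gamma γ : ℂ) ≠ 0 := Complex.ofReal_ne_zero.2 hG.ne'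
      field_simp
    simp_rw [e]
    exact h.mul_left _
  · rw [norm_mul, Complex.norm_real, Real.norm_of_nonneg (inv_nonneg.2 hG.le), mul_assoc]
    refine mul_le_mul_of_nonneg_left (le_trans ?_ hle) (inv_nonneg.2 hG.le)
    refine (norm_integral_le_integral_norm _).trans
      (integral_mono_of_nonneg (.of_forall fun _ => norm_nonneg _) hi ?_)
    filter_upwards [ae_restrict_mem measurableSet_Ioo] with u hu
    have hu1 : 0 ≤ 1 - u := by linarith [hu.2]
    have h1 : (1 - u) ^ (b - 1) ≤ 1 := Real.rpow_le_one hu1 (by linarith [hu.1]) (by linarith)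
    have h2 := Real.rpow_nonneg hu.1.le (γ - 1)
    rw [norm_mul, Complex.norm_exp, Complex.norm_real, Real.norm_of_nonneg (hw0 u hu)]
    have h3 : (x * ((1 - u : ℝ) : ℂ)).re = (1 - u) * x.re := by
      rw [Complex.re_mul_ofReal]; ring
    rw [h3]
    exact mul_le_mul_of_nonneg_left (mul_le_of_le_one_right h2 h1) (Real.exp_nonneg _)

/-- Multiplication by `k` is the operator `x · d/dx` on generating functions, and `d/dx` is the
shift of the sequence. This is why `KernelGrowth` controls all shifts; the factor `x` raises the
exponent by one. -/
lemma KernelGrowth.mul_natCast_add {σ : ℝ} {a : ℕ → ℝ} (h : KernelGrowth σ a) (c : ℝ) :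
    KernelGrowth (σ + 1) fun k => (k + c) * a k := by
  intro j
  obtain ⟨C0, h0⟩ := h j
  obtain ⟨C1, h1⟩ := h (j + 1)
  refine ⟨|C1| + |(j + c) * C0|, fun x => ?_⟩
  obtain ⟨y0, hy0, hb0⟩ := h0 x
  obtain ⟨y1, hy1, hb1⟩ := h1 x
  refine ⟨x * y1 + ((j + c : ℝ) : ℂ) * y0, ?_, ?_⟩
  · have h2 : HasSum (fun k : ℕ => (((k : ℝ) * a (k + j) / k.factorial : ℝ) : ℂ) * x ^ k)
        (x * y1) := by
      rw [← hasSum_nat_add_iff' 1]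
      simp only [Finset.range_one, Finset.sum_singleton, Nat.cast_zero, zero_mul, zero_div,
        Complex.ofReal_zero, sub_zero]
      have e : ∀ k : ℕ, ((((k + 1 : ℕ) : ℝ) * a (k + 1 + j) / (k + 1).factorial : ℝ) : ℂ) *
          x ^ (k + 1) = x * (((a (k + (j + 1)) / k.factorial : ℝ) : ℂ) * x ^ k) := by
        intro k
        rw [show k + 1 + j = k + (j + 1) by ring, Nat.factorial_succ]
        have : (k : ℂ) + 1 ≠ 0 := Nat.cast_add_one_ne_zero k
        have : (k.factorial : ℂ) ≠ 0 := Nat.cast_ne_zero.2 (Nat.factorial_ne_zero k)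
        push_cast
        field_simp
        ring
      simp_rw [e]
      exact hy1.mul_left x
    have h3 := h2.add (hy0.mul_left ((j + c : ℝ) : ℂ))
    have e : ∀ k : ℕ, ((((k + j : ℕ) + c) * a (k + j) / k.factorial : ℝ) : ℂ) * x ^ k =
        (((k : ℝ) * a (k + j) / k.factorial : ℝ) : ℂ) * x ^ k +
          ((j + c : ℝ) : ℂ) * (((a (k + j) / k.factorial : ℝ) : ℂ) * x ^ k) := by
      intro k; push_cast; ring
    simp_rw [e]
    exact h3
  · have hB : 0 ≤ kernelBound σ x := kernelBound_nonneg σ x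
    have hx1 : (1 : ℝ) ≤ 1 + ‖x‖ := by linarith [norm_nonneg x]
    have e : kernelBound (σ + 1) x = (1 + ‖x‖) * kernelBound σ x := by
      unfold kernelBound
      rw [Real.rpow_add (by positivity), Real.rpow_one]; ring
    calc ‖x * y1 + ((j + c : ℝ) : ℂ) * y0‖ ≤ ‖x‖ * ‖y1‖ + |j + c| * ‖y0‖ := by
          refine (norm_add_le _ _).trans_eq ?_
          rw [norm_mul, norm_mul, Complex.norm_real, Real.norm_eq_abs]
      _ ≤ (1 + ‖x‖) * (|C1| * kernelBound σ x) + |j + c| * ((1 + ‖x‖) * (|C0| * kernelBound σ x)) := by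
          have h1 : ‖y1‖ ≤ |C1| * kernelBound σ x := hb1.trans (by gcongr; exact le_abs_self _)
          have h2 : ‖y0‖ ≤ |C0| * kernelBound σ x := hb0.trans (by gcongr; exact le_abs_self _)
          gcongr
          · linarith
          · exact h2.trans (le_mul_of_one_le_left (by positivity) hx1)
      _ = _ := by rw [e, abs_mul]; ring

/-- Negative `s` is the Beta case. The functional equation `Γ(y+1) = y Γ(y)` with `y = k + b - s`
turns multiplication by `k + b - s` into the passage from `s - 1` to `s`, so induction reaches every
real `s`. -/
lemma kernelGrowth_Gamma_ratio {b : ℝ} (hb : 1 ≤ b) (s : ℝ) :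
    KernelGrowth s fun k => Real.Gamma (k + b) / Real.Gamma (k + b - s) := by
  have hbase : ∀ s < 0, KernelGrowth s fun k => Real.Gamma (k + b) / Real.Gamma (k + b - s) := by
    intro s hs j
    obtain ⟨C, hC⟩ := kernelGrowth_beta (b := j + b) (γ := -s)
      (by have : (0 : ℝ) ≤ j := Nat.cast_nonneg j
          linarith) (by linarith)
    refine ⟨C, fun x => ?_⟩
    obtain ⟨y, hy, hy'⟩ := hC x
    refine ⟨y, ?_, by simpa using hy'⟩
    have e : ∀ k : ℕ, Real.Gamma ((k + j : ℕ) + b) / Real.Gamma ((k + j : ℕ) + b - s)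
        = Real.Gamma (k + (j + b)) / Real.Gamma (k + (j + b) + -s) := by
      intro k; push_cast; ring_nf
    simp_rw [e]
    exact hy
  have hstep : ∀ m : ℕ, ∀ s < (m : ℝ),
      KernelGrowth s fun k => Real.Gamma (k + b) / Real.Gamma (k + b - s) := by
    intro m
    induction m with
    | zero => simpa using hbase
    | succ m ih =>
      intro s hs
      have h := (ih (s - 1) (by push_cast at hs; linarith)).mul_natCast_add (b - s)
      rw [sub_add_cancel] at h
      have e : (fun k : ℕ => ((k : ℝ) + (b - s)) * (Real.Gamma (k + b) /
          Real.Gamma (k + b - (s - 1)))) = fun k : ℕ => Real.Gamma (k + b) / Real.Gamma (k + b - s) := by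
        funext k
        rw [show (k : ℝ) + (b - s) = k + b - s by ring,
          show (k : ℝ) + b - (s - 1) = k + b - s + 1 by ring]
        -- At this pole both sides are `0`: the linear factor vanishes on the left, and `Real.Gamma
        -- 0 = 0` makes the right-hand quotient zero.
        by_cases h0 : (k : ℝ) + b - s = 0
        · rw [h0]; simp
        · rw [Real.Gamma_add_one h0]
          field_simp
      rwa [e] at h
  obtain ⟨m, hm⟩ := exists_nat_gt s
  exact hstep m s hm

/-- A finite change of the coefficients does not affect the growth estimate. -/
lemma KernelGrowth.estimate {σ : ℝ} {a a' : ℕ → ℝ} (h : KernelGrowth σ a) {N : ℕ}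
    (ha : ∀ k, N ≤ k → a' k = a k) :
    ∃ C : ℝ, 0 ≤ C ∧ ∀ x : ℂ, ∃ y : ℂ,
      HasSum (fun k => ((a' k / k.factorial : ℝ) : ℂ) * x ^ k) y ∧ ‖y‖ ≤ C * kernelBound σ x := by
  obtain ⟨C, hC⟩ := h 0
  obtain ⟨C', hC'0, hC'⟩ := exists_growth_le_exp (-σ) (c := 1 / 4) (by norm_num)
  refine ⟨|C| + ∑ k ∈ Finset.range N, |a' k - a k| * 4 ^ k * C',
    add_nonneg (abs_nonneg _) (Finset.sum_nonneg fun k _ => by positivity), fun x => ?_⟩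
  obtain ⟨y, hy, hyb⟩ := hC x
  have h1 := hasSum_sum_of_ne_finset_zero (L := .unconditional ℕ) (s := Finset.range N)
    (f := fun k => (((a' k - a k) / k.factorial : ℝ) : ℂ) * x ^ k) (by
      intro k hk
      have : N ≤ k := by simpa using hk
      simp [ha k this])
  refine ⟨y + ∑ k ∈ Finset.range N, (((a' k - a k) / k.factorial : ℝ) : ℂ) * x ^ k, ?_, ?_⟩
  · have e : ∀ k : ℕ, ((a' k / k.factorial : ℝ) : ℂ) * x ^ k = ((a (k + 0) / k.factorial : ℝ) : ℂ)
        * x ^ k + (((a' k - a k) / k.factorial : ℝ) : ℂ) * x ^ k := by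
      intro k; rw [add_zero]; push_cast; ring
    simp_rw [e]
    exact hy.add h1
  · have hB := kernelBound_nonneg σ x
    rw [add_mul, Finset.sum_mul]
    refine (norm_add_le _ _).trans (add_le_add (hyb.trans ?_) ((norm_sum_le _ _).trans ?_))
    · gcongr; exact le_abs_self _
    refine Finset.sum_le_sum fun k _ => ?_
    rw [norm_mul, norm_pow, Complex.norm_real, norm_div, Real.norm_eq_abs, Real.norm_natCast]
    -- Each corrected monomial costs only `e^{|x|/4}`; the term `e^{|x|/2}` of `kernelBound` absorbs
    -- it together with `(1+|x|)^{-σ}`.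
    have h2 : ‖x‖ ^ k / k.factorial ≤ 4 ^ k * Real.exp (‖x‖ / 4) := by
      have := Real.pow_div_factorial_le_exp (‖x‖ / 4) (by positivity) k
      rw [div_pow] at this
      calc ‖x‖ ^ k / k.factorial = 4 ^ k * (‖x‖ ^ k / 4 ^ k / k.factorial) := by field_simp
        _ ≤ _ := by gcongr
    have h3 : Real.exp (‖x‖ / 4) ≤ C' * kernelBound σ x := by
      have h4 := hC' ‖x‖ (norm_nonneg x)
      have h5 : (1 : ℝ) ≤ (1 + ‖x‖) ^ σ * (C' * Real.exp (1 / 4 * ‖x‖)) := by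
        calc (1 : ℝ) = (1 + ‖x‖) ^ σ * (1 + ‖x‖) ^ (-σ) := by
              rw [← Real.rpow_add (by positivity)]; simp
          _ ≤ _ := by gcongr
      calc Real.exp (‖x‖ / 4) ≤ (1 + ‖x‖) ^ σ * (C' * Real.exp (1 / 4 * ‖x‖)) * Real.exp (‖x‖ / 4) :=
            le_mul_of_one_le_left (Real.exp_nonneg _) h5
        _ = C' * ((1 + ‖x‖) ^ σ * (0 + Real.exp (‖x‖ / 2))) := by
            have : Real.exp (‖x‖ / 2) = Real.exp (1 / 4 * ‖x‖) * Real.exp (‖x‖ / 4) := by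
              rw [← Real.exp_add]; ring_nf
            rw [this]; ring
        _ ≤ _ := by unfold kernelBound; gcongr; positivity
    calc |a' k - a k| / k.factorial * ‖x‖ ^ k = |a' k - a k| * (‖x‖ ^ k / k.factorial) := by ring
      _ ≤ |a' k - a k| * (4 ^ k * (C' * kernelBound σ x)) := by
          gcongr; exact h2.trans (by gcongr)
      _ = _ := by ring

end BetaIntegral

/-! ### The norms as weighted `L^p` norms over `V` -/

section Norms

variable {n : ℕ}

/-- Moving the density into the function as its `1/p`-th power puts finite `p` and `p = ∞` on the
same footing: a single measure and a single weight. -/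
lemma eLpNorm_withDensity_rpow {X : Type*} [MeasurableSpace X] {μ : Measure X} {p : ℝ≥0∞}
    (hp0 : p ≠ 0) (hp : p ≠ ∞) {d : X → ℝ} (hd : Measurable d) (hd0 : ∀ x, 0 ≤ d x) (F : X → ℂ) :
    eLpNorm F p (μ.withDensity fun x => ENNReal.ofReal (d x)) =
      eLpNorm (fun x => F x * ((d x ^ (1 / p.toReal) : ℝ) : ℂ)) p μ := by
  have hpp : 0 < p.toReal := ENNReal.toReal_pos hp0 hp
  rw [eLpNorm_eq_lintegral_rpow_enorm_toReal hp0 hp, eLpNorm_eq_lintegral_rpow_enorm_toReal hp0 hp,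
    lintegral_withDensity_eq_lintegral_mul_non_measurable _ (by fun_prop)
      (.of_forall fun _ => ENNReal.ofReal_lt_top)]
  congr 1
  refine lintegral_congr fun x => ?_
  have h1 : ‖((d x ^ (1 / p.toReal) : ℝ) : ℂ)‖ₑ ^ p.toReal = ENNReal.ofReal (d x) := by
    have h2 : 0 ≤ d x ^ (1 / p.toReal) := Real.rpow_nonneg (hd0 x) _
    rw [← ofReal_norm, Complex.norm_real, Real.norm_of_nonneg h2,
      ENNReal.ofReal_rpow_of_nonneg h2 hpp.le, ← Real.rpow_mul (hd0 x),
      one_div_mul_cancel hpp.ne', Real.rpow_one]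
  rw [enorm_mul, ENNReal.mul_rpow_of_nonneg _ _ hpp.le, h1, Pi.mul_apply, mul_comm]

/-- The exponent `γ` such that the norm of `F^p_β` is the `L^p` norm with the weight
`e^{-|z|²/2} (1 + |z|)^{-γ}`. -/
def weightExp (p : ℝ≥0∞) (β : ℝ) : ℝ := if p = ∞ then β else β / p.toReal

/-- The weight of the space `F^p_β`. -/
def weightF (γ : ℝ) (z : Cn n) : ℝ := Real.exp (-‖z‖ ^ 2 / 2) * (1 + ‖z‖) ^ (-γ)

/-- The weight of the space `𝓛^{p,r}_β`. -/
def weightL (γ : ℝ) (z : Cn n) : ℝ := Real.exp (-‖z‖ ^ 2 / 2) * ‖z‖ ^ (-γ)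

lemma weightF_pos (γ : ℝ) (z : Cn n) : 0 < weightF γ z := by
  unfold weightF; positivity

lemma weightL_nonneg (γ : ℝ) (z : Cn n) : 0 ≤ weightL γ z := by
  unfold weightL; positivity

lemma measurable_weightL (γ : ℝ) : Measurable (weightL γ : Cn n → ℝ) := by
  unfold weightL; fun_prop

lemma continuous_weightF (γ : ℝ) : Continuous (weightF γ : Cn n → ℝ) := by
  unfold weightF
  have h : ∀ z : Cn n, (1 + ‖z‖ ≠ 0 ∨ 0 ≤ -γ) := fun z => Or.inl (by positivity)
  exact (by fun_prop : Continuous fun z : Cn n => Real.exp (-‖z‖ ^ 2 / 2)).mul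
    (Continuous.rpow_const (by fun_prop) h)

lemma normF_eq {p : ℝ≥0∞} (hp : 1 ≤ p) (β : ℝ) (f : Cn n → ℂ) :
    normF n p β f = eLpNorm (fun z => f z * (weightF (weightExp p β) z : ℂ)) p (V n) := by
  unfold normF weightExp
  split_ifs with h
  · subst h
    congr 1
    funext z
    rw [weightF, Real.rpow_neg (by positivity), div_eq_mul_inv]
  · have hpp : 0 < p.toReal := ENNReal.toReal_pos (zero_lt_one.trans_le hp).ne' h
    rw [Vw, eLpNorm_withDensity_rpow (zero_lt_one.trans_le hp).ne' h (by fun_prop)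
      (fun z => by positivity)]
    congr 1
    funext z
    rw [weightF, ← Real.rpow_mul (by positivity), mul_assoc, ← Complex.ofReal_mul]
    congr 4
    ring

lemma measurableSet_Om (r : ℝ) : MeasurableSet (Om n r) := Metric.isOpen_ball.measurableSet.compl

lemma mem_Om {r : ℝ} {z : Cn n} : z ∈ Om n r ↔ r ≤ ‖z‖ := by simp [Om]

lemma restrict_W (r α : ℝ) : (W n α).restrict (Om n r) =
    ((V n).restrict (Om n r)).withDensity fun z => ENNReal.ofReal (‖z‖ ^ (-α)) :=
  restrict_withDensity (measurableSet_Om r) _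

lemma normL_eq {p : ℝ≥0∞} (hp : 1 ≤ p) (r β : ℝ) (f : Cn n → ℂ) :
    normL n p r β f =
      eLpNorm (fun z => f z * (weightL (weightExp p β) z : ℂ)) p ((V n).restrict (Om n r)) := by
  unfold normL weightExp
  split_ifs with h
  · subst h
    congr 1
    funext z
    rw [weightL, Real.rpow_neg (by positivity), div_eq_mul_inv]
  · have hpp : 0 < p.toReal := ENNReal.toReal_pos (zero_lt_one.trans_le hp).ne' h
    rw [restrict_W, eLpNorm_withDensity_rpow (zero_lt_one.trans_le hp).ne' h (by fun_prop)
      (fun z => by positivity)]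
    congr 1
    funext z
    rw [weightL, ← Real.rpow_mul (by positivity), mul_assoc, ← Complex.ofReal_mul]
    congr 4
    ring

/-- Away from the origin, powers of `t` and of `1 + t` are comparable. -/
lemma exists_rpow_le_one_add_rpow {r : ℝ} (hr : 0 < r) (M : ℝ) :
    ∃ C : ℝ, 0 < C ∧ ∀ t, r ≤ t → t ^ M ≤ C * (1 + t) ^ M := by
  rcases le_total 0 M with hM | hM
  · refine ⟨1, one_pos, fun t ht => ?_⟩
    rw [one_mul]
    exact Real.rpow_le_rpow (by linarith) (by linarith) hM
  · refine ⟨(r / (1 + r)) ^ M, by positivity, fun t ht => ?_⟩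
    rw [← Real.mul_rpow (by positivity) (by linarith)]
    refine Real.rpow_le_rpow_of_nonpos (by positivity [hr.trans_le ht]) ?_ hM
    rw [div_mul_eq_mul_div, div_le_iff₀ (by positivity)]
    nlinarith

lemma exists_weightL_le {r : ℝ} (hr : 0 < r) (γ : ℝ) :
    ∃ C : ℝ≥0, ∀ z ∈ Om n r, weightL γ z ≤ C * weightF γ z := by
  obtain ⟨C, hC, h⟩ := exists_rpow_le_one_add_rpow hr (-γ)
  refine ⟨C.toNNReal, fun z hz => ?_⟩
  rw [Real.coe_toNNReal _ hC.le]
  have := h ‖z‖ (mem_Om.1 hz)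
  unfold weightL weightF
  calc _ ≤ Real.exp (-‖z‖ ^ 2 / 2) * (C * (1 + ‖z‖) ^ (-γ)) := by gcongr
    _ = _ := by ring

/-- Functions of `F^p_β` restrict to `Ω_r`. -/
lemma exists_normL_le_normF {p : ℝ≥0∞} (hp : 1 ≤ p) {r : ℝ} (hr : 0 < r) (β : ℝ) :
    ∃ C : ℝ≥0, ∀ f : Cn n → ℂ, normL n p r β f ≤ C * normF n p β f := by
  obtain ⟨C, hC⟩ := exists_weightL_le (n := n) hr (weightExp p β)
  refine ⟨C, fun f => ?_⟩
  rw [normL_eq hp, normF_eq hp]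
  calc _ ≤ C • eLpNorm (fun z => f z * (weightF (weightExp p β) z : ℂ)) p
        ((V n).restrict (Om n r)) := by
        refine eLpNorm_le_nnreal_smul_eLpNorm_of_ae_le_mul ?_ p
        filter_upwards [ae_restrict_mem (measurableSet_Om r)] with z hz
        rw [← NNReal.coe_le_coe]
        push_cast
        rw [norm_mul, norm_mul, Complex.norm_real, Complex.norm_real,
          Real.norm_of_nonneg (weightL_nonneg _ z), Real.norm_of_nonneg (weightF_pos _ z).le]
        have := hC z hz
        calc _ ≤ ‖f z‖ * (C * weightF (weightExp p β) z) := by gcongr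
          _ = _ := by ring
    _ ≤ C • eLpNorm (fun z => f z * (weightF (weightExp p β) z : ℂ)) p (V n) := by
        exact mul_le_mul_right (eLpNorm_mono_measure _ Measure.restrict_le_self) (C : ℝ≥0∞)
    _ = _ := rfl

lemma spaceF_le_spaceL {p : ℝ≥0∞} (hp : 1 ≤ p) {r : ℝ} (hr : 0 < r) (β : ℝ) :
    spaceF n p β ≤ spaceL n p r β := by
  rintro f ⟨hf, hf'⟩
  obtain ⟨C, hC⟩ := exists_normL_le_normF (n := n) hp hr β
  exact ⟨hf.continuous.aestronglyMeasurable,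
    (hC f).trans_lt (ENNReal.mul_lt_top ENNReal.coe_lt_top hf')⟩

lemma memLp_gaussian {c : ℝ} (hc : 0 < c) {q : ℝ≥0∞} (hq : q ≠ 0) :
    MemLp (fun z : Cn n => Real.exp (-c * ‖z‖ ^ 2)) q (V n) := by
  have hm : AEStronglyMeasurable (fun z : Cn n => Real.exp (-c * ‖z‖ ^ 2)) (V n) :=
    Continuous.aestronglyMeasurable (by fun_prop)
  by_cases h : q = ∞
  · subst h
    refine memLp_top_of_bound hm 1 (.of_forall fun z => ?_)
    rw [Real.norm_of_nonneg (Real.exp_nonneg _), Real.exp_le_one_iff]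
    have : 0 ≤ c * ‖z‖ ^ 2 := by positivity
    linarith
  · have hq' := ENNReal.toReal_pos hq h
    rw [← integrable_norm_rpow_iff hm hq h]
    refine (integrable_gaussian (n := n) (mul_pos hc hq')).congr (.of_forall fun z => ?_)
    simp only
    rw [Real.norm_of_nonneg (Real.exp_nonneg _), ← Real.exp_mul]
    ring_nf

/-- A function of `𝓛^{p,r}_β` times a weight slightly smaller than `e^{-|w|²/2}` is integrable. -/
lemma integrableOn_mul_of_spaceL {p : ℝ≥0∞} (hp : 1 ≤ p) {r : ℝ} (hr : 0 < r) {β : ℝ}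
    {ψ : Cn n → ℂ} (hψ : ψ ∈ spaceL n p r β) {g : Cn n → ℂ} (hg : Measurable g) {A M R c : ℝ}
    (hc : 0 < c) (h : ∀ w ∈ Om n r, ‖g w‖ ≤ A * ((1 + ‖w‖) ^ M * Real.exp (R * ‖w‖)) *
      Real.exp (-c * ‖w‖ ^ 2) * Real.exp (-‖w‖ ^ 2 / 2)) :
    IntegrableOn (fun w => ψ w * g w) (Om n r) (V n) := by
  obtain ⟨hψm, hψn⟩ := hψ
  rw [normL_eq hp] at hψn
  set γ := weightExp p β
  have hwm : Measurable fun w : Cn n => (weightL γ w : ℂ) :=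
    Complex.measurable_ofReal.comp (measurable_weightL γ)
  have h1 : MemLp (fun z => ψ z * (weightL γ z : ℂ)) p ((V n).restrict (Om n r)) :=
    ⟨hψm.mul hwm.aestronglyMeasurable, hψn⟩
  have hw0 : ∀ w ∈ Om n r, 0 < weightL γ w := fun w hw => by
    have : 0 < ‖w‖ := hr.trans_le (mem_Om.1 hw)
    unfold weightL; positivity
  obtain ⟨C1, hC1, h1'⟩ := exists_rpow_le_one_add_rpow hr γ
  obtain ⟨C2, hC2, h2'⟩ := exists_growth_le (M + γ) R (half_pos hc)
  have hq0 : p.conjExponent ≠ 0 := by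
    unfold ENNReal.conjExponent
    exact (zero_lt_one.trans_le le_self_add).ne'
  -- Hölder: `ψ · weightL` lies in `L^p`, and `g / weightL` is still dominated by a Gaussian on
  -- `Ω_r`, hence lies in the dual space for every `p`.
  have h2 : MemLp (fun w => g w * (weightL γ w : ℂ)⁻¹) p.conjExponent
      ((V n).restrict (Om n r)) := by
    have h3 := ((memLp_gaussian (n := n) (half_pos hc) hq0).restrict (Om n r)).const_mul
      (|A| * C1 * C2)
    refine h3.of_le (hg.mul hwm.inv).aestronglyMeasurable ?_
    filter_upwards [ae_restrict_mem (measurableSet_Om r)] with w hw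
    have hw1 := mem_Om.1 hw
    have hw2 : 0 < ‖w‖ := hr.trans_le hw1
    rw [norm_mul, norm_inv, Complex.norm_real, Real.norm_of_nonneg (hw0 w hw).le,
      Real.norm_of_nonneg (by positivity), ← div_eq_mul_inv, div_le_iff₀ (hw0 w hw)]
    have e1 : (1 : ℝ) ≤ ‖w‖ ^ (-γ) * (C1 * (1 + ‖w‖) ^ γ) := by
      calc (1 : ℝ) = ‖w‖ ^ (-γ) * ‖w‖ ^ γ := by rw [← Real.rpow_add hw2]; simp
        _ ≤ _ := by gcongr; exact h1' _ hw1
    calc ‖g w‖ ≤ A * ((1 + ‖w‖) ^ M * Real.exp (R * ‖w‖)) *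
          Real.exp (-c * ‖w‖ ^ 2) * Real.exp (-‖w‖ ^ 2 / 2) := h w hw
      _ ≤ |A| * ((1 + ‖w‖) ^ M * Real.exp (R * ‖w‖)) *
          Real.exp (-c * ‖w‖ ^ 2) * Real.exp (-‖w‖ ^ 2 / 2) := by
          gcongr; exact le_abs_self A
      _ ≤ (|A| * ((1 + ‖w‖) ^ M * Real.exp (R * ‖w‖)) *
          Real.exp (-c * ‖w‖ ^ 2) * Real.exp (-‖w‖ ^ 2 / 2)) *
          (‖w‖ ^ (-γ) * (C1 * (1 + ‖w‖) ^ γ)) := le_mul_of_one_le_right (by positivity) e1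
      _ = |A| * C1 * ((1 + ‖w‖) ^ (M + γ) * Real.exp (R * ‖w‖)) *
          Real.exp (-c * ‖w‖ ^ 2) * weightL γ w := by
          rw [Real.rpow_add (by positivity), weightL]; ring
      _ ≤ |A| * C1 * (C2 * Real.exp (c / 2 * ‖w‖ ^ 2)) *
          Real.exp (-c * ‖w‖ ^ 2) * weightL γ w := by
          have := (hw0 w hw).le
          gcongr ?_ * Real.exp (-c * ‖w‖ ^ 2) * weightL γ w
          exact mul_le_mul_of_nonneg_left (h2' _ hw2.le) (by positivity)
      _ = |A| * C1 * C2 * (Real.exp (c / 2 * ‖w‖ ^ 2) * Real.exp (-c * ‖w‖ ^ 2)) * weightL γ w := by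
          ring
      _ = _ := by rw [← Real.exp_add]; ring_nf
  have := ENNReal.HolderConjugate.conjExponent hp
  refine (h1.integrable_mul h2).congr ?_
  filter_upwards [ae_restrict_mem (measurableSet_Om r)] with w hw
  have : (weightL γ w : ℂ) ≠ 0 := Complex.ofReal_ne_zero.2 (hw0 w hw).ne'
  simp only [Pi.mul_apply]
  field_simp

lemma integral_W (α : ℝ) (g : Cn n → ℂ) :
    ∫ z, g z ∂(W n α) = ∫ z, g z * ((‖z‖ ^ (-α) : ℝ) : ℂ) ∂(V n) := by
  rw [W, integral_withDensity_eq_integral_toReal_smul (by fun_prop)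
    (.of_forall fun _ => ENNReal.ofReal_lt_top)]
  refine integral_congr_ae (.of_forall fun z => ?_)
  simp only
  rw [ENNReal.toReal_ofReal (by positivity), Complex.real_smul, mul_comm]

lemma setIntegral_W (r α : ℝ) (g : Cn n → ℂ) :
    ∫ z in Om n r, g z ∂(W n α) = ∫ z in Om n r, g z * ((‖z‖ ^ (-α) : ℝ) : ℂ) ∂(V n) := by
  rw [restrict_W, integral_withDensity_eq_integral_toReal_smul (by fun_prop)
    (.of_forall fun _ => ENNReal.ofReal_lt_top)]
  refine integral_congr_ae (.of_forall fun z => ?_)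
  simp only
  rw [ENNReal.toReal_ofReal (by positivity), Complex.real_smul, mul_comm]

lemma integrableOn_W_iff {r α : ℝ} {g : Cn n → ℂ} :
    IntegrableOn g (Om n r) (W n α) ↔
      IntegrableOn (fun z => g z * ((‖z‖ ^ (-α) : ℝ) : ℂ)) (Om n r) (V n) := by
  rw [IntegrableOn, restrict_W, integrable_withDensity_iff_integrable_smul' (by fun_prop)
    (.of_forall fun _ => ENNReal.ofReal_lt_top)]
  refine integrable_congr (.of_forall fun z => ?_)
  simp only
  rw [ENNReal.toReal_ofReal (by positivity), Complex.real_smul, mul_comm]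

end Norms

/-! ### Series with nonnegative coefficients -/

section CoeffBound

/-- Nonnegative sequences whose exponential generating function is dominated by `kernelBound σ`. -/
def CoeffBound (σ : ℝ) (a : ℕ → ℝ) : Prop :=
  (∀ k, 0 ≤ a k) ∧ ∃ C : ℝ, 0 ≤ C ∧ ∀ x : ℂ, ∃ y : ℂ,
    HasSum (fun k => ((a k / k.factorial : ℝ) : ℂ) * x ^ k) y ∧ ‖y‖ ≤ C * kernelBound σ x

variable {σ : ℝ} {a : ℕ → ℝ}

lemma CoeffBound.hasSum (h : CoeffBound σ a) (x : ℂ) :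
    HasSum (fun k => ((a k / k.factorial : ℝ) : ℂ) * x ^ k) (expSeries a x) := by
  obtain ⟨-, C, -, hC⟩ := h
  obtain ⟨y, hy, -⟩ := hC x
  exact hy.summable.hasSum

lemma CoeffBound.exists_bound (h : CoeffBound σ a) :
    ∃ C : ℝ, 0 ≤ C ∧ ∀ x : ℂ, ‖expSeries a x‖ ≤ C * kernelBound σ x := by
  obtain ⟨C, hC0, hC⟩ := h.2
  refine ⟨C, hC0, fun x => ?_⟩
  obtain ⟨y, hy, hyb⟩ := hC x
  rwa [expSeries, hy.tsum_eq]

/-- A cruder bound, sufficient wherever the series is only integrated against a Gaussian for fixed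
`z`. -/
lemma CoeffBound.exists_exp_bound (h : CoeffBound σ a) :
    ∃ C : ℝ, 0 ≤ C ∧ ∀ x : ℂ, ‖expSeries a x‖ ≤ C * Real.exp (2 * ‖x‖) := by
  obtain ⟨C, hC0, hC⟩ := h.exists_bound
  obtain ⟨D, hD0, hD⟩ := exists_growth_le_exp σ one_pos
  refine ⟨C * (D * 2), by positivity, fun x => (hC x).trans ?_⟩
  have h1 := hD ‖x‖ (norm_nonneg x)
  have h2 : Real.exp x.re ≤ Real.exp ‖x‖ := Real.exp_le_exp.2 (Complex.re_le_norm x)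
  have h3 : Real.exp (‖x‖ / 2) ≤ Real.exp ‖x‖ :=
    Real.exp_le_exp.2 (by linarith [norm_nonneg x])
  rw [one_mul] at h1
  unfold kernelBound
  calc C * ((1 + ‖x‖) ^ σ * (Real.exp x.re + Real.exp (‖x‖ / 2)))
      ≤ C * ((D * Real.exp ‖x‖) * (Real.exp ‖x‖ + Real.exp ‖x‖)) := by gcongr
    _ = C * (D * 2) * (Real.exp ‖x‖ * Real.exp ‖x‖) := by ring
    _ = _ := by rw [← Real.exp_add]; ring_nf

lemma CoeffBound.summable (h : CoeffBound σ a) (x : ℝ) :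
    Summable fun k => a k / k.factorial * x ^ k := by
  have := (h.hasSum (x : ℂ)).summable
  rw [← Complex.summable_ofReal]
  simpa using this

lemma CoeffBound.ofReal_expSeriesReal (h : CoeffBound σ a) (x : ℝ) :
    ((expSeriesReal a x : ℝ) : ℂ) = expSeries a x := by
  have h1 := (Complex.hasSum_ofReal).2 (h.summable x).hasSum
  refine h1.unique ?_
  simpa using h.hasSum (x : ℂ)

lemma CoeffBound.expSeriesReal_nonneg (h : CoeffBound σ a) {x : ℝ} (hx : 0 ≤ x) :
    0 ≤ expSeriesReal a x :=
  tsum_nonneg fun k => by have := h.1 k; positivity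

lemma CoeffBound.differentiable (h : CoeffBound σ a) : Differentiable ℂ (expSeries a) := by
  intro x
  have hd : DifferentiableOn ℂ (expSeries a) (Metric.ball 0 (‖x‖ + 1)) := by
    refine Complex.differentiableOn_tsum_of_summable_norm (u := fun k =>
      a k / k.factorial * (‖x‖ + 1) ^ k) (h.summable _) (fun k => by fun_prop) Metric.isOpen_ball ?_
    intro k w hw
    have h0 := h.1 k
    have hw' : ‖w‖ ≤ ‖x‖ + 1 := by simpa using (Metric.mem_ball.1 hw).le
    rw [norm_mul, norm_pow, Complex.norm_real, Real.norm_of_nonneg (by positivity)]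
    gcongr
  exact hd.differentiableAt (Metric.isOpen_ball.mem_nhds (by simp))

lemma conj_expSeries (a : ℕ → ℝ) (x : ℂ) : conj (expSeries a x) = expSeries a (conj x) := by
  unfold expSeries
  rw [Complex.conj_tsum]
  simp

lemma CoeffBound.of_kernelGrowth {b : ℕ → ℝ} (h : KernelGrowth σ a) {N : ℕ}
    (hb : ∀ k, N ≤ k → b k = a k) (hb0 : ∀ k, 0 ≤ b k) : CoeffBound σ b :=
  ⟨hb0, h.estimate hb⟩

lemma kernelGrowth_zero (σ : ℝ) : KernelGrowth σ fun _ => 0 := fun _ =>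
  ⟨0, fun x => ⟨0, by simp, by simp⟩⟩

lemma expSeriesReal_mul_le (h : CoeffBound σ a) {m : ℕ} (hm : ∀ k < m, a k = 0) {t x : ℝ}
    (ht0 : 0 ≤ t) (ht : t ≤ 1) (hx : 0 ≤ x) :
    expSeriesReal a (t * x) ≤ t ^ m * expSeriesReal a x := by
  unfold expSeriesReal
  rw [← tsum_mul_left]
  refine (h.summable _).tsum_le_tsum (fun k => ?_) ((h.summable x).mul_left _)
  by_cases hk : k < m
  · simp [hm k hk]
  · have h0 := h.1 k
    have h1 : t ^ k ≤ t ^ m := pow_le_pow_of_le_one ht0 ht (not_lt.1 hk)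
    rw [mul_pow]
    calc a k / k.factorial * (t ^ k * x ^ k) ≤ a k / k.factorial * (t ^ m * x ^ k) := by gcongr
      _ = _ := by ring

end CoeffBound

/-! ### Membership in the Fock spaces -/

section Membership

variable {n : ℕ}

lemma mem_spaceF_of_growth {p : ℝ≥0∞} (hp : 1 ≤ p) (β : ℝ) {f : Cn n → ℂ}
    (hf : Differentiable ℂ f) {A M R : ℝ}
    (h : ∀ z, ‖f z‖ ≤ A * ((1 + ‖z‖) ^ M * Real.exp (R * ‖z‖))) : f ∈ spaceF n p β := by
  refine ⟨hf, ?_⟩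
  rw [normF_eq hp]
  set γ := weightExp p β
  obtain ⟨C, hC, hC'⟩ := exists_growth_le (M + -γ) R (c := 1 / 4) (by norm_num)
  have h3 := (memLp_gaussian (n := n) (c := 1 / 4) (by norm_num)
    (zero_lt_one.trans_le hp).ne').const_mul (|A| * C)
  refine (h3.of_le ?_ (.of_forall fun z => ?_)).2
  · exact (hf.continuous.mul
      (Complex.continuous_ofReal.comp (continuous_weightF γ))).aestronglyMeasurable
  · rw [norm_mul, Complex.norm_real, Real.norm_of_nonneg (weightF_pos _ z).le,
      Real.norm_of_nonneg (by positivity), weightF]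
    calc ‖f z‖ * (Real.exp (-‖z‖ ^ 2 / 2) * (1 + ‖z‖) ^ (-γ))
        ≤ (|A| * ((1 + ‖z‖) ^ M * Real.exp (R * ‖z‖))) *
          (Real.exp (-‖z‖ ^ 2 / 2) * (1 + ‖z‖) ^ (-γ)) := by
          gcongr
          exact (h z).trans (by gcongr; exact le_abs_self A)
      _ = |A| * ((1 + ‖z‖) ^ (M + -γ) * Real.exp (R * ‖z‖)) * Real.exp (-‖z‖ ^ 2 / 2) := by
          rw [Real.rpow_add (by positivity)]; ring
      _ ≤ |A| * (C * Real.exp (1 / 4 * ‖z‖ ^ 2)) * Real.exp (-‖z‖ ^ 2 / 2) := by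
          gcongr ?_ * Real.exp (-‖z‖ ^ 2 / 2)
          exact mul_le_mul_of_nonneg_left (hC' _ (norm_nonneg z)) (abs_nonneg A)
      _ = |A| * C * (Real.exp (1 / 4 * ‖z‖ ^ 2) * Real.exp (-‖z‖ ^ 2 / 2)) := by ring
      _ = _ := by rw [← Real.exp_add]; ring_nf

lemma homPart_mem_spaceF {p : ℝ≥0∞} (hp : 1 ≤ p) (β : ℝ) (f : Cn n → ℂ) (k : ℕ) :
    homPart k f ∈ spaceF n p β := by
  refine mem_spaceF_of_growth hp β (differentiable_homPart f k)
    (A := (k.factorial : ℝ)⁻¹ * ‖iteratedFDeriv ℂ k f 0‖) (M := k) (R := 0) fun z => ?_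
  rw [zero_mul, Real.exp_zero, mul_one, Real.rpow_natCast, homPart, norm_mul, norm_inv,
    Complex.norm_natCast, mul_assoc]
  gcongr
  refine ((iteratedFDeriv ℂ k f 0).le_opNorm _).trans ?_
  rw [Finset.prod_const, Finset.card_univ, Fintype.card_fin]
  gcongr
  linarith

lemma lowPart_mem_spaceF {p : ℝ≥0∞} (hp : 1 ≤ p) (β : ℝ) (f : Cn n → ℂ) (s : ℝ) :
    lowPart s f ∈ spaceF n p β := by
  have : lowPart s f = ∑ k ∈ Finset.range (⌊|s|⌋₊ + 1), homPart k f := by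
    funext z; simp [lowPart]
  rw [this]
  exact Submodule.sum_mem _ fun k _ => homPart_mem_spaceF hp β f k

lemma highPart_mem_spaceF {p : ℝ≥0∞} (hp : 1 ≤ p) (β : ℝ) {f : Cn n → ℂ}
    (hf : f ∈ spaceF n p β) (s : ℝ) : highPart s f ∈ spaceF n p β :=
  Submodule.sub_mem _ hf (lowPart_mem_spaceF hp β f s)

variable {σ : ℝ} {a : ℕ → ℝ}

lemma CoeffBound.differentiable_inner (h : CoeffBound σ a) (z : Cn n) :
    Differentiable ℂ fun w : Cn n => expSeries a (inner ℂ z w) :=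
  h.differentiable.comp (innerSL ℂ z).differentiable

lemma CoeffBound.inner_mem_spaceF (h : CoeffBound σ a) {p : ℝ≥0∞} (hp : 1 ≤ p) (β : ℝ)
    (z : Cn n) : (fun w : Cn n => expSeries a (inner ℂ z w)) ∈ spaceF n p β := by
  obtain ⟨C, hC0, hC⟩ := h.exists_exp_bound
  refine mem_spaceF_of_growth hp β (h.differentiable_inner z) (A := C) (M := 0) (R := 2 * ‖z‖)
    fun w => (hC _).trans ?_
  rw [Real.rpow_zero, one_mul, mul_assoc]
  gcongr
  exact norm_inner_le_norm z w

lemma CoeffBound.homPart_inner (h : CoeffBound σ a) (z w : Cn n) (k : ℕ) :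
    homPart k (fun w : Cn n => expSeries a (inner ℂ z w)) w =
      ((a k / k.factorial : ℝ) : ℂ) * (inner ℂ z w) ^ k := by
  refine homPart_eq_of_hasSum (h.differentiable_inner z)
    (b := fun k => ((a k / k.factorial : ℝ) : ℂ) * (inner ℂ z w) ^ k) (fun c => ?_) k
  have := h.hasSum (inner ℂ z (c • w))
  simpa only [inner_smul_right, mul_pow, mul_assoc, mul_comm (c ^ _)] using this

end Membership

/-! ### The pairing with a kernel function -/

section Pairing

variable {n : ℕ} {σ : ℝ} {a : ℕ → ℝ}

lemma integrableOn_ball_norm_rpow (hn : 1 ≤ n) {c : ℝ} (hc : 0 < c + 2 * n) :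
    IntegrableOn (fun w : Cn n => ‖w‖ ^ c) (Metric.ball 0 1) (V n) := by
  have hd : Module.finrank ℝ (Cn n) = 2 * n := by
    rw [← Module.finrank_mul_finrank ℝ ℂ (Cn n)]; simp
  have : Nontrivial (Cn n) := by
    have : Nonempty (Fin n) := ⟨⟨0, hn⟩⟩
    infer_instance
  rw [integrableOn_fun_norm_addHaar (V n) (f := fun t => t ^ c), hd]
  have h : IntegrableOn (fun t : ℝ => t ^ (2 * (n : ℝ) - 1 + c)) (Set.Ioo 0 1) :=
    (intervalIntegral.integrableOn_Ioo_rpow_iff one_pos).2 (by linarith)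
  refine h.congr_fun (fun t ht => ?_) measurableSet_Ioo
  simp only
  rw [Real.rpow_add ht.1, smul_eq_mul, ← Real.rpow_natCast t (2 * n - 1)]
  push_cast [Nat.cast_sub (show 1 ≤ 2 * n by omega)]
  rfl

lemma continuous_expSeriesReal (h : CoeffBound σ a) : Continuous (expSeriesReal a) := by
  have h1 : expSeriesReal a = fun x : ℝ => (expSeries a x).re := by
    funext x
    rw [← h.ofReal_expSeriesReal, Complex.ofReal_re]
  rw [h1]
  have := h.differentiable.continuous
  fun_prop

/-- The majorant of the integrand in the pairing with a kernel is integrable over `Ω_r`. -/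
lemma integrableOn_Om_majorant {p : ℝ≥0∞} (hp : 1 ≤ p) {r : ℝ} (hr : 0 < r) {β : ℝ} (α : ℝ)
    {ψ : Cn n → ℂ} (hψ : ψ ∈ spaceL n p r β) (ha : CoeffBound σ a) (R : ℝ) (hR : 0 ≤ R) :
    IntegrableOn (fun w => ‖ψ w‖ * expSeriesReal a (‖w‖ * R) *
      (‖w‖ ^ (-α) * Real.exp (-‖w‖ ^ 2))) (Om n r) (V n) := by
  obtain ⟨C, hC0, hC⟩ := ha.exists_exp_bound
  obtain ⟨D, hD0, hD⟩ := exists_rpow_le_one_add_rpow hr (-α)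
  have h0 : ∀ w : Cn n, 0 ≤ expSeriesReal a (‖w‖ * R) := fun w =>
    ha.expSeriesReal_nonneg (by positivity)
  have hg : Measurable fun w : Cn n =>
      ((expSeriesReal a (‖w‖ * R) * (‖w‖ ^ (-α) * Real.exp (-‖w‖ ^ 2)) : ℝ) : ℂ) := by
    have h1 : Continuous fun w : Cn n => expSeriesReal a (‖w‖ * R) :=
      (continuous_expSeriesReal ha).comp (by fun_prop)
    exact Complex.measurable_ofReal.comp (h1.measurable.mul (by fun_prop))
  have h := integrableOn_mul_of_spaceL hp hr hψ hg (A := C * D) (M := -α) (R := 2 * R) (c := 1 / 2)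
    (by norm_num) (fun w hw => by
      have h1 := hC ((‖w‖ * R : ℝ) : ℂ)
      rw [← ha.ofReal_expSeriesReal, Complex.norm_real, Complex.norm_real,
        Real.norm_of_nonneg (h0 w), Real.norm_of_nonneg (by positivity)] at h1
      have h2 := hD ‖w‖ (mem_Om.1 hw)
      have := h0 w
      rw [Complex.norm_real, Real.norm_of_nonneg (by positivity)]
      calc expSeriesReal a (‖w‖ * R) * (‖w‖ ^ (-α) * Real.exp (-‖w‖ ^ 2))
          ≤ C * Real.exp (2 * (‖w‖ * R)) * (D * (1 + ‖w‖) ^ (-α) * Real.exp (-‖w‖ ^ 2)) := by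
            gcongr
        _ = C * D * ((1 + ‖w‖) ^ (-α) * Real.exp (2 * R * ‖w‖)) *
            (Real.exp (-(1 / 2) * ‖w‖ ^ 2) * Real.exp (-‖w‖ ^ 2 / 2)) := by
            rw [← Real.exp_add]; ring_nf
        _ = _ := by ring)
  refine h.norm.congr (.of_forall fun w => ?_)
  have := h0 w
  simp only
  rw [norm_mul, Complex.norm_real, Real.norm_of_nonneg (by positivity), mul_assoc]

/-- The only danger is the singularity of `|w|^{-α}` at the origin. Both `f` and the series vanish
there to order `m`, leaving `|w|^{2m-α}`, integrable exactly because `α/2 < m + n`. Away from the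
origin the estimate on `Ω_1` applies. -/
lemma integrable_majorant (hn : 1 ≤ n) {α : ℝ} {f : Cn n → ℂ} (hf : f ∈ spaceF n 2 α)
    (ha : CoeffBound σ a) {m : ℕ} (hfm : ∀ k < m, ∀ z, homPart k f z = 0) (ham : ∀ k < m, a k = 0)
    (hm : α / 2 < m + n) (R : ℝ) (hR : 0 ≤ R) :
    Integrable (fun w => ‖f w‖ * expSeriesReal a (‖w‖ * R) *
      (‖w‖ ^ (-α) * Real.exp (-‖w‖ ^ 2))) (V n) := by
  have hOm := integrableOn_Om_majorant one_le_two one_pos α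
    (spaceF_le_spaceL one_le_two one_pos α hf) ha R hR
  have hfc := hf.1.continuous
  obtain ⟨C, hC0, hC⟩ := exists_norm_le_pow hf.1 hfm
  have hball : IntegrableOn (fun w => ‖f w‖ * expSeriesReal a (‖w‖ * R) *
      (‖w‖ ^ (-α) * Real.exp (-‖w‖ ^ 2))) (Metric.ball 0 1) (V n) := by
    have h1 := (integrableOn_ball_norm_rpow hn (c := 2 * m - α) (by linarith)).const_mul
      (C * expSeriesReal a R)
    refine h1.mono' ?_ ?_
    · have h2 : Continuous fun w : Cn n => ‖f w‖ * expSeriesReal a (‖w‖ * R) :=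
        (by fun_prop : Continuous fun w : Cn n => ‖f w‖).mul
          ((continuous_expSeriesReal ha).comp (by fun_prop))
      have h3 : Measurable fun w : Cn n => ‖w‖ ^ (-α) * Real.exp (-‖w‖ ^ 2) := by fun_prop
      exact (h2.measurable.mul h3).aestronglyMeasurable
    · have h0 : ∀ᵐ w : Cn n ∂(V n).restrict (Metric.ball 0 1), w ≠ 0 := by
        have : Nontrivial (Cn n) := by
          have : Nonempty (Fin n) := ⟨⟨0, hn⟩⟩
          infer_instance
        exact ae_restrict_of_ae (Measure.ae_ne _ _)
      filter_upwards [ae_restrict_mem measurableSet_ball, h0] with w hw hw0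
      have hw1 : ‖w‖ ≤ 1 := by simpa using (Metric.mem_ball.1 hw).le
      have hwp : 0 < ‖w‖ := norm_pos_iff.2 hw0
      have h2 := hC w hw1
      have h3 := expSeriesReal_mul_le ha ham (norm_nonneg w) hw1 hR
      have h4 := ha.expSeriesReal_nonneg (x := ‖w‖ * R) (by positivity)
      have h6 := ha.expSeriesReal_nonneg hR
      have h5 : Real.exp (-‖w‖ ^ 2) ≤ 1 := Real.exp_le_one_iff.2 (by nlinarith)
      rw [Real.norm_of_nonneg (by positivity)]
      calc ‖f w‖ * expSeriesReal a (‖w‖ * R) * (‖w‖ ^ (-α) * Real.exp (-‖w‖ ^ 2))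
          ≤ (C * ‖w‖ ^ m) * (‖w‖ ^ m * expSeriesReal a R) * (‖w‖ ^ (-α) * 1) := by gcongr
        _ = C * expSeriesReal a R * (‖w‖ ^ m * ‖w‖ ^ m * ‖w‖ ^ (-α)) := by ring
        _ = _ := by
          rw [← Real.rpow_natCast, ← Real.rpow_add hwp, ← Real.rpow_add hwp]
          ring_nf
  have hu : Metric.ball (0 : Cn n) 1 ∪ Om n 1 = Set.univ := Set.union_compl_self _
  rw [← integrableOn_univ, ← hu]
  exact hball.union hOm

/-- The pairing of a function of `F^2_α` with a kernel function. -/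
lemma hasSum_pairing (hn : 1 ≤ n) {α : ℝ} {f : Cn n → ℂ} (hf : f ∈ spaceF n 2 α)
    (ha : CoeffBound σ a) {m : ℕ} (hfm : ∀ k < m, ∀ z, homPart k f z = 0) (ham : ∀ k < m, a k = 0)
    (hm : α / 2 < m + n) (z : Cn n) :
    HasSum (fun k => ((a k * (Real.Gamma (k + n - α / 2) / Real.Gamma (k + n)) : ℝ) : ℂ)
      * homPart k f z) (pairing n α f fun w => expSeries a (inner ℂ z w)) := by
  have h := hasSum_integral_mul_expSeries hn hf.1 (ρ := fun t => t ^ (-α) * Real.exp (-t ^ 2))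
    (by fun_prop) (fun t ht => by positivity) ha.1 ha.summable (z := z)
    (integrable_majorant hn hf ha hfm ham hm ‖z‖ (norm_nonneg z))
  have e1 : pairing n α f (fun w => expSeries a (inner ℂ z w)) =
      ∫ w, f w * expSeries a (inner ℂ w z) *
        ((‖w‖ ^ (-α) * Real.exp (-‖w‖ ^ 2) : ℝ) : ℂ) ∂(V n) := by
    rw [pairing, integral_W]
    refine integral_congr_ae (.of_forall fun w => ?_)
    simp only
    rw [conj_expSeries, inner_conj_symm]
    push_cast
    ring
  rw [e1]
  have e2 : ∀ k : ℕ, a k * (Real.Gamma (k + n - α / 2) / Real.Gamma (k + n)) =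
      a k * (radialMoment n (fun t => t ^ (-α) * Real.exp (-t ^ 2)) k /
        radialMoment n (fun t => Real.exp (-t ^ 2)) k) := by
    intro k
    -- Below degree `m` the Gamma quotient need not be a convergent moment, but there `a k = 0`.
    by_cases hk : k < m
    · rw [ham k hk]; simp
    · have : (m : ℝ) ≤ k := by exact_mod_cast not_lt.1 hk
      rw [radialMoment_rpow_mul_exp hn (by linarith), radialMoment_gaussian hn]
      rw [div_div_div_cancel_right₀ two_ne_zero]
  simp_rw [e2]
  exact h

end Pairing

/-! ### The reproducing kernel -/

section Kernel

variable {n : ℕ}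

/-- The coefficients of the reproducing kernel. -/
def kernelCoeff (n : ℕ) (α : ℝ) (k : ℕ) : ℝ :=
  if α < 2 * n ∨ ⌊|α / 2|⌋₊ < k then Real.Gamma (k + n) / Real.Gamma (k + n - α / 2) else 1

/-- The reproducing kernel of `F^2_α`. -/
def kernel (n : ℕ) (α : ℝ) (z w : Cn n) : ℂ := expSeries (kernelCoeff n α) (inner ℂ z w)

lemma Gamma_args_pos (hn : 1 ≤ n) {α : ℝ} {k : ℕ} (h : α < 2 * n ∨ ⌊|α / 2|⌋₊ < k) :
    (0 : ℝ) < k + n ∧ 0 < k + n - α / 2 := by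
  have hn' : (1 : ℝ) ≤ n := by exact_mod_cast hn
  have hk : (0 : ℝ) ≤ k := Nat.cast_nonneg k
  refine ⟨by linarith, ?_⟩
  rcases h with h | h
  · linarith
  · have h1 := (Nat.floor_lt (abs_nonneg (α / 2))).1 h
    have h2 := le_abs_self (α / 2)
    linarith

lemma kernelCoeff_pos (hn : 1 ≤ n) (α : ℝ) (k : ℕ) : 0 < kernelCoeff n α k := by
  unfold kernelCoeff
  split_ifs with h
  · obtain ⟨h1, h2⟩ := Gamma_args_pos hn h
    exact div_pos (Real.Gamma_pos_of_pos h1) (Real.Gamma_pos_of_pos h2)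
  · exact one_pos

lemma kernelCoeff_mul (hn : 1 ≤ n) {α : ℝ} {k : ℕ} (h : α < 2 * n ∨ ⌊|α / 2|⌋₊ < k) :
    kernelCoeff n α k * (Real.Gamma (k + n - α / 2) / Real.Gamma (k + n)) = 1 := by
  obtain ⟨h1, h2⟩ := Gamma_args_pos hn h
  have h3 := Real.Gamma_pos_of_pos h1
  have h4 := Real.Gamma_pos_of_pos h2
  rw [kernelCoeff, if_pos h, div_mul_div_cancel₀ h4.ne', div_self h3.ne']

lemma kernelGrowth_kernelCoeff_aux (hn : 1 ≤ n) (α : ℝ) : KernelGrowth (α / 2)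
    fun k => Real.Gamma (k + n) / Real.Gamma (k + n - α / 2) :=
  kernelGrowth_Gamma_ratio (by exact_mod_cast hn) _

lemma coeffBound_kernelCoeff (hn : 1 ≤ n) (α : ℝ) : CoeffBound (α / 2) (kernelCoeff n α) :=
  .of_kernelGrowth (kernelGrowth_kernelCoeff_aux hn α) (N := ⌊|α / 2|⌋₊ + 1)
    (fun k hk => by rw [kernelCoeff, if_pos (Or.inr (Nat.lt_of_succ_le hk))]) fun k => (kernelCoeff_pos hn α k).le

/-- The low part is a polynomial, a finite change of the zero sequence, so the exponent `0` is just
a convenient choice. -/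
lemma coeffBound_kernelCoeff_low (hn : 1 ≤ n) (α : ℝ) :
    CoeffBound 0 fun k => if k ≤ ⌊|α / 2|⌋₊ then kernelCoeff n α k else 0 :=
  .of_kernelGrowth (kernelGrowth_zero 0) (N := ⌊|α / 2|⌋₊ + 1)
    (fun k hk => if_neg (by omega)) fun k => by
      split_ifs
      exacts [(kernelCoeff_pos hn α k).le, le_rfl]

lemma coeffBound_kernelCoeff_high (hn : 1 ≤ n) (α : ℝ) :
    CoeffBound (α / 2) fun k => if k ≤ ⌊|α / 2|⌋₊ then 0 else kernelCoeff n α k :=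
  .of_kernelGrowth (kernelGrowth_kernelCoeff_aux hn α) (N := ⌊|α / 2|⌋₊ + 1)
    (fun k hk => by
      rw [if_neg (by omega), kernelCoeff, if_pos (Or.inr (Nat.lt_of_succ_le hk))]) fun k => by
      split_ifs
      exacts [le_rfl, (kernelCoeff_pos hn α k).le]

lemma lowPart_kernel (hn : 1 ≤ n) (α : ℝ) (z : Cn n) :
    lowPart (α / 2) (kernel n α z) = fun w =>
      expSeries (fun k => if k ≤ ⌊|α / 2|⌋₊ then kernelCoeff n α k else 0) (inner ℂ z w) := by
  funext w
  have h1 := (coeffBound_kernelCoeff_low hn α).hasSum (inner ℂ z w)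
  have h2 := hasSum_homPart (lowPart_differentiable (kernel n α z) (α / 2)) w
  refine h2.unique ?_
  have e : ∀ k, homPart k (lowPart (α / 2) (kernel n α z)) w =
      (((if k ≤ ⌊|α / 2|⌋₊ then kernelCoeff n α k else 0) / k.factorial : ℝ) : ℂ) *
        (inner ℂ z w) ^ k := by
    intro k
    rw [homPart_lowPart]
    unfold kernel
    rw [(coeffBound_kernelCoeff hn α).homPart_inner]
    split_ifs <;> simp
  simp_rw [e]
  exact h1

lemma highPart_kernel (hn : 1 ≤ n) (α : ℝ) (z : Cn n) :
    highPart (α / 2) (kernel n α z) = fun w =>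
      expSeries (fun k => if k ≤ ⌊|α / 2|⌋₊ then 0 else kernelCoeff n α k) (inner ℂ z w) := by
  funext w
  have h1 := (coeffBound_kernelCoeff_high hn α).hasSum (inner ℂ z w)
  have hd : Differentiable ℂ (kernel n α z) := (coeffBound_kernelCoeff hn α).differentiable_inner z
  have h2 := hasSum_homPart (highPart_differentiable hd (α / 2)) w
  refine h2.unique ?_
  have e : ∀ k, homPart k (highPart (α / 2) (kernel n α z)) w =
      (((if k ≤ ⌊|α / 2|⌋₊ then 0 else kernelCoeff n α k) / k.factorial : ℝ) : ℂ) *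
        (inner ℂ z w) ^ k := by
    intro k
    rw [homPart_highPart hd]
    unfold kernel
    rw [(coeffBound_kernelCoeff hn α).homPart_inner]
    split_ifs <;> simp
  simp_rw [← e] at h1
  exact h1

/-- The pairing multiplies `homPart k f` by coefficient times moment ratio, and the coefficients are
chosen to make this `1`. For `α ≥ 2n` the low degrees are paired with weight `0`, where the moment
ratio is already `1`; the high parts vanish to order `⌊|α/2|⌋ + 1`, enough for the singular weight
to be integrable. -/
lemma isReproducingKernel_kernel (hn : 1 ≤ n) (α : ℝ) : IsReproducingKernel n α (kernel n α) where
  mem w := (coeffBound_kernelCoeff hn α).inner_mem_spaceF one_le_two α w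
  reproducing f hf z := by
    have hn' : (1 : ℝ) ≤ n := by exact_mod_cast hn
    unfold innerF
    split_ifs with h
    · have h1 := hasSum_pairing hn hf (coeffBound_kernelCoeff hn α) (m := 0) (by simp) (by simp)
        (by simp; linarith) z
      simp_rw [kernelCoeff_mul hn (Or.inl h), Complex.ofReal_one, one_mul] at h1
      exact (hasSum_homPart hf.1 z).unique h1
    · rw [lowPart_kernel hn, highPart_kernel hn]
      have h1 := hasSum_pairing hn (lowPart_mem_spaceF one_le_two 0 f (α / 2))
        (coeffBound_kernelCoeff_low hn α) (m := 0) (by simp) (by simp)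
        (by simp; linarith) z
      have h2 := hasSum_pairing hn (highPart_mem_spaceF one_le_two α hf (α / 2))
        (coeffBound_kernelCoeff_high hn α) (m := ⌊|α / 2|⌋₊ + 1)
        (fun k hk z => by rw [homPart_highPart hf.1, if_pos (by omega)])
        (fun k hk => if_pos (by omega))
        (by have h3 := Nat.lt_floor_add_one |α / 2|
            have h4 := le_abs_self (α / 2)
            push_cast
            linarith) z
      refine (hasSum_homPart hf.1 z).unique ?_
      have e : ∀ k : ℕ, (((if k ≤ ⌊|α / 2|⌋₊ then kernelCoeff n α k else 0) *
            (Real.Gamma (k + n - 0 / 2) / Real.Gamma (k + n)) : ℝ) : ℂ)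
            * homPart k (lowPart (α / 2) f) z +
          (((if k ≤ ⌊|α / 2|⌋₊ then 0 else kernelCoeff n α k) *
            (Real.Gamma (k + n - α / 2) / Real.Gamma (k + n)) : ℝ) : ℂ)
            * homPart k (highPart (α / 2) f) z = homPart k f z := by
        intro k
        rw [homPart_lowPart, homPart_highPart hf.1]
        by_cases hk : k ≤ ⌊|α / 2|⌋₊
        · have h5 : (0 : ℝ) < k + n := by positivity
          have h6 := (Real.Gamma_pos_of_pos h5).ne'
          have h7 : kernelCoeff n α k = 1 := if_neg (by
            push Not
            exact ⟨not_lt.1 h, hk⟩)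
          simp [hk, h7, div_self h6]
        · simp only [if_neg hk]
          rw [kernelCoeff_mul hn (Or.inr (not_le.1 hk))]
          simp
      have h3 := h1.add h2
      simp_rw [e] at h3
      exact h3

lemma pairing_conj_symm (α : ℝ) (f g : Cn n → ℂ) : conj (pairing n α f g) = pairing n α g f := by
  unfold pairing
  rw [← integral_conj]
  refine integral_congr_ae (.of_forall fun w => ?_)
  simp only [map_mul, Complex.conj_conj, Complex.conj_ofReal]
  ring

lemma innerF_conj_symm (α : ℝ) (f g : Cn n → ℂ) : conj (innerF n α f g) = innerF n α g f := by
  unfold innerF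
  split_ifs <;> simp [pairing_conj_symm]

/-- Evaluating `⟨K_z, K'_w⟩` by either kernel gives `K_z(w)` and the conjugate of `K'_w(z)`; the
latter is `K'_z(w)` by the Hermitian symmetry of `K'`. -/
lemma IsReproducingKernel.unique {α : ℝ} {K K' : Cn n → Cn n → ℂ}
    (h : IsReproducingKernel n α K) (h' : IsReproducingKernel n α K') : K = K' := by
  funext z w
  rw [h'.reproducing (K z) (h.mem z) w, ← innerF_conj_symm, ← h.reproducing (K' w) (h'.mem w) z,
    h'.reproducing (K' w) (h'.mem w) z, innerF_conj_symm, ← h'.reproducing (K' z) (h'.mem z) w]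

end Kernel

/-! ### Minkowski's inequality -/

section Minkowski

/-- A form of Minkowski's integral inequality. -/
lemma eLpNorm_lintegral_le {X Y : Type*} [MeasurableSpace X] [MeasurableSpace Y] {μ : Measure X}
    {ν : Measure Y} [SFinite μ] [IsFiniteMeasure ν] {p : ℝ≥0∞} (hp : 1 ≤ p) {F : X → Y → ℝ≥0∞}
    (hF : Measurable (Function.uncurry F)) {A : ℝ≥0∞} (hA : ∀ y, eLpNorm (fun x => F x y) p μ ≤ A) :
    eLpNorm (fun x => ∫⁻ y, F x y ∂ν) p μ ≤ ν Set.univ * A := by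
  by_cases htop : p = ∞
  · subst htop
    simp only [eLpNorm_exponent_top] at hA ⊢
    have h1 : ∀ᵐ y ∂ν, ∀ᵐ x ∂μ, F x y ≤ A := .of_forall fun y => by
      filter_upwards [enorm_ae_le_eLpNormEssSup (fun x => F x y) μ] with x hx
      exact hx.trans (hA y)
    have hm : MeasurableSet {x : X × Y | F x.1 x.2 ≤ A} := measurableSet_le hF measurable_const
    rw [← Measure.ae_ae_comm hm] at h1
    refine eLpNormEssSup_le_of_ae_enorm_bound ?_
    filter_upwards [h1] with x hx
    calc ∫⁻ y, F x y ∂ν ≤ ∫⁻ _, A ∂ν := lintegral_mono_ae hx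
      _ = ν Set.univ * A := by rw [lintegral_const, mul_comm]
  have hp0 : p ≠ 0 := (zero_lt_one.trans_le hp).ne'
  have hq : 0 < p.toReal := ENNReal.toReal_pos hp0 htop
  have hq1 : 1 ≤ p.toReal := by
    rw [← ENNReal.toReal_one]; exact ENNReal.toReal_mono htop hp
  set q := p.toReal
  set N := ν Set.univ
  have hNt : N ≠ ∞ := measure_ne_top _ _
  -- Hölder in `y` over the finite measure `ν`; Tonelli then reduces to the uniform bound for fixed
  -- `y`.
  have h1 : ∀ x, (∫⁻ y, F x y ∂ν) ^ q ≤ N ^ (q - 1) * ∫⁻ y, F x y ^ q ∂ν := by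
    intro x
    have h2 := eLpNorm_le_eLpNorm_mul_rpow_measure_univ (μ := ν) hp (f := fun y => F x y)
      (hF.comp measurable_prodMk_left).aestronglyMeasurable
    rw [eLpNorm_one_eq_lintegral_enorm, eLpNorm_eq_lintegral_rpow_enorm_toReal hp0 htop] at h2
    simp only [enorm_eq_self, ENNReal.toReal_one] at h2
    calc (∫⁻ y, F x y ∂ν) ^ q
        ≤ ((∫⁻ y, F x y ^ q ∂ν) ^ (1 / q) * N ^ (1 / 1 - 1 / q)) ^ q := by gcongr
      _ = _ := by
        rw [ENNReal.mul_rpow_of_nonneg _ _ hq.le, ← ENNReal.rpow_mul, ← ENNReal.rpow_mul,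
          one_div_mul_cancel hq.ne', ENNReal.rpow_one, mul_comm]
        congr 2
        field_simp
  have h3 : ∀ y, ∫⁻ x, F x y ^ q ∂μ ≤ A ^ q := by
    intro y
    have h4 := hA y
    rw [eLpNorm_eq_lintegral_rpow_enorm_toReal hp0 htop] at h4
    simp only [enorm_eq_self] at h4
    rwa [one_div, ENNReal.rpow_inv_le_iff hq] at h4
  rw [eLpNorm_eq_lintegral_rpow_enorm_toReal hp0 htop]
  simp only [enorm_eq_self]
  rw [one_div, ENNReal.rpow_inv_le_iff hq]
  calc ∫⁻ x, (∫⁻ y, F x y ∂ν) ^ q ∂μ ≤ ∫⁻ x, N ^ (q - 1) * ∫⁻ y, F x y ^ q ∂ν ∂μ :=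
        lintegral_mono h1
    _ = N ^ (q - 1) * ∫⁻ x, ∫⁻ y, F x y ^ q ∂ν ∂μ :=
        lintegral_const_mul' _ _ (ENNReal.rpow_ne_top_of_nonneg (by linarith) hNt)
    _ = N ^ (q - 1) * ∫⁻ y, ∫⁻ x, F x y ^ q ∂μ ∂ν := by
        rw [lintegral_lintegral_swap]
        exact (hF.pow_const q).aemeasurable
    _ ≤ N ^ (q - 1) * ∫⁻ _, A ^ q ∂ν := by gcongr with y; exact h3 y
    _ = N ^ (q - 1) * N ^ (1 : ℝ) * A ^ q := by
        rw [lintegral_const, ENNReal.rpow_one]; ring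
    _ = (N * A) ^ q := by
        rw [← ENNReal.rpow_add_of_nonneg _ _ (by linarith) zero_le_one, sub_add_cancel,
          ENNReal.mul_rpow_of_nonneg _ _ hq.le]

end Minkowski

/-! ### Gaussian domination of the weighted kernel -/

section KernelEstimate

variable {n : ℕ}

/-- Powers of comparable numbers are comparable. -/
lemma rpow_le_of_comparable {x y K : ℝ} (hx : 0 < x) (hy : 0 < y) (hK : 1 ≤ K) (h1 : x ≤ K * y)
    (h2 : y ≤ K * x) (s : ℝ) : x ^ s ≤ K ^ |s| * y ^ s := by
  have hK0 : 0 < K := by linarith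
  rcases le_total 0 s with hs | hs
  · rw [abs_of_nonneg hs, ← Real.mul_rpow hK0.le hy.le]
    exact Real.rpow_le_rpow hx.le h1 hs
  · rw [abs_of_nonpos hs, Real.rpow_neg hK0.le, ← Real.inv_rpow hK0.le,
      ← Real.mul_rpow (by positivity) hy.le]
    refine Real.rpow_le_rpow_of_nonpos (by positivity) ?_ hs
    rw [inv_mul_le_iff₀ hK0]
    exact h2

lemma norm_sub_sq_eq (z w : Cn n) : ‖z - w‖ ^ 2 = ‖z‖ ^ 2 - 2 * (inner ℂ z w).re + ‖w‖ ^ 2 := by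
  have := norm_sub_sq (𝕜 := ℂ) z w
  simpa using this

/-- Up to the factor `4(1+|z-w|)²`, `1 + |⟨z,w⟩|` is comparable to `(1+|w|)²`: one direction is
Cauchy–Schwarz, the other is `|w|² ≤ 2|⟨z,w⟩| + |z-w|²`. Polynomial losses in `|z-w|` are later paid
for by the Gaussian. -/
lemma one_add_norm_inner_rpow_le (z w : Cn n) (s : ℝ) :
    (1 + ‖(inner ℂ z w : ℂ)‖) ^ s ≤ (4 * (1 + ‖z - w‖) ^ 2) ^ |s| * ((1 + ‖w‖) ^ 2) ^ s := by
  have hd := norm_nonneg (z - w)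
  have hw := norm_nonneg w
  have h1 : ‖z‖ ≤ ‖w‖ + ‖z - w‖ := by
    have := norm_add_le (z - w) w
    rw [sub_add_cancel] at this; linarith
  have h2 := norm_inner_le_norm (𝕜 := ℂ) z w
  have h3 := Complex.re_le_norm (inner ℂ z w)
  have h4 := norm_sub_sq_eq z w
  have hx := norm_nonneg (inner ℂ z w)
  set t := ‖(inner ℂ z w : ℂ)‖
  set d := ‖z - w‖
  refine rpow_le_of_comparable (by positivity) (by positivity) (by nlinarith) ?_ ?_ s
  · have : t ≤ (‖w‖ + d) * ‖w‖ := h2.trans (by gcongr)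
    nlinarith [mul_nonneg hd hw, mul_nonneg hd (sq_nonneg ‖w‖), sq_nonneg d, sq_nonneg ‖w‖,
      mul_nonneg (sq_nonneg d) hw, mul_nonneg (sq_nonneg d) (sq_nonneg ‖w‖)]
  · have h5 : ‖w‖ ^ 2 ≤ 2 * t + d ^ 2 := by nlinarith [sq_nonneg ‖z‖]
    nlinarith [mul_nonneg hd hx, mul_nonneg (sq_nonneg d) hx, sq_nonneg (‖w‖ - 1), sq_nonneg d]

/-- The first exponential yields exactly `-|z-w|²/2`. The second has exponent at most
`-(|z|²+|w|²)/4 ≤ -|z-w|²/8`, which determines the common constant. -/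
lemma kernelBound_mul_exp_le (σ : ℝ) (z w : Cn n) :
    kernelBound σ (inner ℂ z w) * (Real.exp (-‖z‖ ^ 2 / 2) * Real.exp (-‖w‖ ^ 2 / 2)) ≤
      (4 * (1 + ‖z - w‖) ^ 2) ^ |σ| * ((1 + ‖w‖) ^ 2) ^ σ * (2 * Real.exp (-‖z - w‖ ^ 2 / 8)) := by
  have h1 := one_add_norm_inner_rpow_le z w σ
  have h2 := norm_inner_le_norm (𝕜 := ℂ) z w
  have h4 := norm_sub_sq_eq z w
  have h5 : -(‖z‖ * ‖w‖) ≤ (inner ℂ z w).re :=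
    (neg_le_neg h2).trans (neg_le_of_abs_le (Complex.abs_re_le_norm _))
  have h3 : (Real.exp (inner ℂ z w).re + Real.exp (‖(inner ℂ z w : ℂ)‖ / 2)) *
      (Real.exp (-‖z‖ ^ 2 / 2) * Real.exp (-‖w‖ ^ 2 / 2)) ≤ 2 * Real.exp (-‖z - w‖ ^ 2 / 8) := by
    rw [← Real.exp_add, add_mul, ← Real.exp_add, ← Real.exp_add, two_mul]
    refine add_le_add (Real.exp_le_exp.2 ?_) (Real.exp_le_exp.2 ?_)
    · nlinarith [sq_nonneg ‖z - w‖]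
    · nlinarith [sq_nonneg (‖z‖ - ‖w‖)]
  unfold kernelBound
  rw [mul_assoc]
  exact mul_le_mul h1 h3 (by positivity) (by positivity)

lemma one_add_norm_rpow_le (z w : Cn n) (γ : ℝ) :
    (1 + ‖z‖) ^ (-γ) ≤ (1 + ‖z - w‖) ^ |γ| * (1 + ‖w‖) ^ (-γ) := by
  have hd := norm_nonneg (z - w)
  have hw := norm_nonneg w
  have hz := norm_nonneg z
  have h1 : ‖z‖ ≤ ‖w‖ + ‖z - w‖ := by
    have := norm_add_le (z - w) w
    rw [sub_add_cancel] at this; linarith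
  have h2 : ‖w‖ ≤ ‖z‖ + ‖z - w‖ := by
    have := norm_sub_le z (z - w)
    rw [sub_sub_cancel] at this; linarith
  rw [← abs_neg γ]
  refine rpow_le_of_comparable (by positivity) (by positivity) (by linarith) ?_ ?_ _
  · nlinarith
  · nlinarith

/-- The weighted kernel is dominated by a Gaussian away from the origin. -/
lemma exists_weighted_kernel_le (hn : 1 ≤ n) (α γ : ℝ) {r : ℝ} (hr : 0 < r) :
    ∃ C : ℝ, 0 ≤ C ∧ ∀ z : Cn n, ∀ w ∈ Om n r,
      ‖kernel n α z w‖ * Real.exp (-‖w‖ ^ 2) * ‖w‖ ^ (-α) * weightF γ z ≤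
        C * Real.exp (-(1 / 16) * ‖z - w‖ ^ 2) * weightL γ w := by
  obtain ⟨C1, hC1, h1⟩ := (coeffBound_kernelCoeff hn α).exists_bound
  obtain ⟨C2, hC2, h2⟩ := exists_rpow_le_one_add_rpow hr (-α)
  obtain ⟨C3, hC3, h3⟩ := exists_rpow_le_one_add_rpow hr γ
  -- Half of the decay `e^{-|z-w|²/8}` is spent on all powers of `1 + |z-w|`; `1/16` remains.
  obtain ⟨C4, hC4, h4⟩ := exists_growth_le (2 * |α / 2| + |γ|) 0 (c := 1 / 16) (by norm_num)
  refine ⟨C1 * C2 * C3 * 4 ^ |α / 2| * 2 * C4, by positivity, fun z w hw => ?_⟩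
  have hw1 := mem_Om.1 hw
  have hw0 : 0 < ‖w‖ := hr.trans_le hw1
  have hd := norm_nonneg (z - w)
  -- A factor at least `1`, inserted below to trade `(1+|w|)^{-γ}` for the power `|w|^{-γ}` in
  -- `weightL`.
  have e1 : (1 : ℝ) ≤ C3 * (1 + ‖w‖) ^ γ * ‖w‖ ^ (-γ) := by
    calc (1 : ℝ) = ‖w‖ ^ γ * ‖w‖ ^ (-γ) := by rw [← Real.rpow_add hw0]; simp
      _ ≤ _ := by gcongr; exact h3 _ hw1
  have e2 : ((1 + ‖w‖) ^ 2) ^ (α / 2) = (1 + ‖w‖) ^ α := by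
    rw [← Real.rpow_natCast, ← Real.rpow_mul (by positivity)]
    congr 1; push_cast; ring
  have e3 : (4 * (1 + ‖z - w‖) ^ 2) ^ |α / 2| = 4 ^ |α / 2| * (1 + ‖z - w‖) ^ (2 * |α / 2|) := by
    rw [Real.mul_rpow (by norm_num) (by positivity), Real.rpow_mul (by positivity), Real.rpow_two]
  have e4 := h4 _ hd
  rw [zero_mul, Real.exp_zero, mul_one] at e4
  have e5 := kernelBound_mul_exp_le (α / 2) z w
  rw [e2, e3] at e5
  have e6 : Real.exp (-‖w‖ ^ 2) = Real.exp (-‖w‖ ^ 2 / 2) * Real.exp (-‖w‖ ^ 2 / 2) := by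
    rw [← Real.exp_add]; ring_nf
  have e7 : Real.exp (1 / 16 * ‖z - w‖ ^ 2) * Real.exp (-‖z - w‖ ^ 2 / 8) =
      Real.exp (-(1 / 16) * ‖z - w‖ ^ 2) := by
    rw [← Real.exp_add]; ring_nf
  have e8 : (1 + ‖w‖) ^ α * (1 + ‖w‖) ^ (-α) = 1 := by
    rw [← Real.rpow_add (by positivity)]; simp
  have e9 : (1 + ‖w‖) ^ (-γ) * (1 + ‖w‖) ^ γ = 1 := by
    rw [← Real.rpow_add (by positivity)]; simp
  calc ‖kernel n α z w‖ * Real.exp (-‖w‖ ^ 2) * ‖w‖ ^ (-α) * weightF γ z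
      ≤ (C1 * kernelBound (α / 2) (inner ℂ z w)) * Real.exp (-‖w‖ ^ 2) *
          (C2 * (1 + ‖w‖) ^ (-α)) * (Real.exp (-‖z‖ ^ 2 / 2) *
          ((1 + ‖z - w‖) ^ |γ| * (1 + ‖w‖) ^ (-γ))) * 1 := by
        rw [mul_one]
        unfold weightF
        have := kernelBound_nonneg (α / 2) (inner ℂ z w)
        gcongr
        · exact h1 _
        · exact h2 _ hw1
        · exact one_add_norm_rpow_le z w γ
    _ ≤ (C1 * kernelBound (α / 2) (inner ℂ z w)) * Real.exp (-‖w‖ ^ 2) *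
          (C2 * (1 + ‖w‖) ^ (-α)) * (Real.exp (-‖z‖ ^ 2 / 2) *
          ((1 + ‖z - w‖) ^ |γ| * (1 + ‖w‖) ^ (-γ))) * (C3 * (1 + ‖w‖) ^ γ * ‖w‖ ^ (-γ)) := by
        have := kernelBound_nonneg (α / 2) (inner ℂ z w)
        gcongr
    _ = C1 * C2 * C3 * (kernelBound (α / 2) (inner ℂ z w) *
          (Real.exp (-‖z‖ ^ 2 / 2) * Real.exp (-‖w‖ ^ 2 / 2))) * (1 + ‖w‖) ^ (-α) *
          (1 + ‖z - w‖) ^ |γ| * weightL γ w * ((1 + ‖w‖) ^ (-γ) * (1 + ‖w‖) ^ γ) := by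
        rw [e6, weightL]; ring
    _ ≤ C1 * C2 * C3 * (4 ^ |α / 2| * (1 + ‖z - w‖) ^ (2 * |α / 2|) * (1 + ‖w‖) ^ α *
          (2 * Real.exp (-‖z - w‖ ^ 2 / 8))) * (1 + ‖w‖) ^ (-α) *
          (1 + ‖z - w‖) ^ |γ| * weightL γ w * ((1 + ‖w‖) ^ (-γ) * (1 + ‖w‖) ^ γ) := by
        have := weightL_nonneg γ w
        gcongr
    _ = C1 * C2 * C3 * 4 ^ |α / 2| * 2 * ((1 + ‖z - w‖) ^ (2 * |α / 2| + |γ|)) *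
          Real.exp (-‖z - w‖ ^ 2 / 8) * weightL γ w * ((1 + ‖w‖) ^ α * (1 + ‖w‖) ^ (-α)) := by
        rw [e9, Real.rpow_add (by positivity)]; ring
    _ ≤ C1 * C2 * C3 * 4 ^ |α / 2| * 2 * (C4 * Real.exp (1 / 16 * ‖z - w‖ ^ 2)) *
          Real.exp (-‖z - w‖ ^ 2 / 8) * weightL γ w * 1 := by
        rw [e8]
        have := weightL_nonneg γ w
        gcongr
    _ = _ := by rw [← e7]; ring

end KernelEstimate

/-! ### Convolution with a Gaussian -/

section Convolution

variable {n : ℕ}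

/-- Young's inequality for the convolution with a Gaussian. -/
lemma exists_eLpNorm_convolution_le {p : ℝ≥0∞} (hp : 1 ≤ p) {c : ℝ} (hc : 0 < c) :
    ∃ C : ℝ≥0, ∀ v : Cn n → ℝ≥0∞, Measurable v →
      eLpNorm (fun z => ∫⁻ w, v w * ENNReal.ofReal (Real.exp (-c * ‖z - w‖ ^ 2)) ∂(V n)) p (V n) ≤
        C * eLpNorm v p (V n) := by
  -- The convolution is an average of translates `v(z - u)` over this finite measure, and
  -- translations preserve the `L^p` norm.
  let ν : Measure (Cn n) := (V n).withDensity fun u => ENNReal.ofReal (Real.exp (-c * ‖u‖ ^ 2))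
  have hfin : ∫⁻ u : Cn n, ENNReal.ofReal (Real.exp (-c * ‖u‖ ^ 2)) ∂(V n) ≠ ∞ :=
    (integrable_gaussian hc).lintegral_lt_top.ne
  have : IsFiniteMeasure ν := isFiniteMeasure_withDensity hfin
  refine ⟨(ν Set.univ).toNNReal, fun v hv => ?_⟩
  rw [ENNReal.coe_toNNReal (measure_ne_top _ _)]
  have h1 : ∀ z, ∫⁻ w, v w * ENNReal.ofReal (Real.exp (-c * ‖z - w‖ ^ 2)) ∂(V n) =
      ∫⁻ u, v (z - u) ∂ν := by
    intro z
    rw [lintegral_withDensity_eq_lintegral_mul _ (by fun_prop) (by fun_prop),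
      ← lintegral_sub_left_eq_self _ z]
    refine lintegral_congr fun u => ?_
    simp [mul_comm]
  simp_rw [h1]
  refine eLpNorm_lintegral_le hp (F := fun z u => v (z - u)) ?_ fun u => ?_
  · exact hv.comp (measurable_fst.sub measurable_snd)
  · exact (eLpNorm_comp_measurePreserving hv.aestronglyMeasurable
      (measurePreserving_sub_right (V n) u)).le

end Convolution

/-! ### The operator from `𝓛^{p,r}_β` to `F^p_β` -/

section Projection

variable {n : ℕ}

lemma opP_eq (α r : ℝ) (ψ : Cn n → ℂ) (z : Cn n) : opP n α r (kernel n α) ψ z =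
    ∫ w in Om n r, ψ w * (expSeries (kernelCoeff n α) (inner ℂ w z) *
      ((‖w‖ ^ (-α) * Real.exp (-‖w‖ ^ 2) : ℝ) : ℂ)) ∂(V n) := by
  rw [opP, setIntegral_W]
  refine integral_congr_ae (.of_forall fun w => ?_)
  simp only [integrandP, kernel]
  rw [conj_expSeries, inner_conj_symm]
  push_cast
  ring

lemma integrableOn_opP (hn : 1 ≤ n) {p : ℝ≥0∞} (hp : 1 ≤ p) (α : ℝ) {β r : ℝ} (hr : 0 < r)
    {ψ : Cn n → ℂ} (hψ : ψ ∈ spaceL n p r β) (z : Cn n) :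
    IntegrableOn (fun w => ψ w * (expSeries (kernelCoeff n α) (inner ℂ w z) *
      ((‖w‖ ^ (-α) * Real.exp (-‖w‖ ^ 2) : ℝ) : ℂ))) (Om n r) (V n) := by
  have ha := coeffBound_kernelCoeff hn α
  have hc := ha.differentiable.continuous
  have h1 : Measurable fun w : Cn n => expSeries (kernelCoeff n α) (inner ℂ w z) :=
    Continuous.measurable (by fun_prop)
  have h2 : Measurable fun w : Cn n => ((‖w‖ ^ (-α) * Real.exp (-‖w‖ ^ 2) : ℝ) : ℂ) :=
    Complex.measurable_ofReal.comp (by fun_prop)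
  have hm := integrableOn_Om_majorant hp hr α hψ ha ‖z‖ (norm_nonneg z)
  refine hm.mono' (hψ.1.mul (h1.mul h2).aestronglyMeasurable) (.of_forall fun w => ?_)
  rw [norm_mul, norm_mul, Complex.norm_real, Real.norm_of_nonneg (by positivity), mul_assoc]
  gcongr
  refine tsum_of_norm_bounded (ha.summable _).hasSum fun k => ?_
  have := ha.1 k
  rw [norm_mul, norm_pow, Complex.norm_real, Real.norm_of_nonneg (by positivity)]
  gcongr
  exact norm_inner_le_norm w z

lemma integrableOn_integrandP (hn : 1 ≤ n) {p : ℝ≥0∞} (hp : 1 ≤ p) (α : ℝ) {β r : ℝ} (hr : 0 < r)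
    {ψ : Cn n → ℂ} (hψ : ψ ∈ spaceL n p r β) (z : Cn n) :
    IntegrableOn (integrandP (kernel n α) ψ z) (Om n r) (W n α) := by
  rw [integrableOn_W_iff]
  refine (integrableOn_opP hn hp α hr hψ z).congr (.of_forall fun w => ?_)
  simp only [integrandP, kernel]
  rw [conj_expSeries, inner_conj_symm]
  push_cast
  ring

/-- With both weights inserted, the integral is pointwise at most the Gaussian convolution of `|ψ| ·
weightL` extended by zero, so Young's inequality applies. -/
lemma exists_normF_opP_le (hn : 1 ≤ n) {p : ℝ≥0∞} (hp : 1 ≤ p) (α β : ℝ) {r : ℝ} (hr : 0 < r) :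
    ∃ C : ℝ≥0, ∀ ψ ∈ spaceL n p r β,
      normF n p β (opP n α r (kernel n α) ψ) ≤ C * normL n p r β ψ := by
  set γ := weightExp p β with hγ
  obtain ⟨C1, hC1, h1⟩ := exists_weighted_kernel_le (n := n) hn α γ hr
  obtain ⟨C2, h2⟩ := exists_eLpNorm_convolution_le (n := n) hp (c := 1 / 16) (by norm_num)
  refine ⟨C1.toNNReal * C2, fun ψ hψ => ?_⟩
  rw [normF_eq hp, normL_eq hp, ← hγ]
  have hwm : Measurable fun w : Cn n => (weightL γ w : ℂ) :=
    Complex.measurable_ofReal.comp (measurable_weightL γ)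
  -- A measurable representative is taken because the convolution inequality is stated for
  -- measurable functions.
  let u : Cn n → ℂ := (Om n r).indicator fun w => hψ.1.mk ψ w * (weightL γ w : ℂ)
  have hu : Measurable u :=
    (hψ.1.stronglyMeasurable_mk.measurable.mul hwm).indicator (measurableSet_Om r)
  have hun : eLpNorm (fun w => ‖u w‖ₑ) p (V n) =
      eLpNorm (fun z => ψ z * (weightL γ z : ℂ)) p ((V n).restrict (Om n r)) := by
    rw [eLpNorm_enorm, eLpNorm_indicator_eq_eLpNorm_restrict (measurableSet_Om r)]
    refine eLpNorm_congr_ae ?_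
    filter_upwards [hψ.1.ae_eq_mk] with w hw
    rw [← hw]
  have h3 : ∀ z, ‖opP n α r (kernel n α) ψ z * (weightF γ z : ℂ)‖ₑ ≤
      ENNReal.ofReal C1 * ∫⁻ w, ‖u w‖ₑ * ENNReal.ofReal (Real.exp (-(1 / 16) * ‖z - w‖ ^ 2)) ∂(V n) := by
    intro z
    have hE : ∀ w, expSeries (kernelCoeff n α) (inner ℂ w z) = conj (kernel n α z w) := fun w => by
      rw [kernel, conj_expSeries, inner_conj_symm]
    rw [opP_eq, ← integral_mul_const, ← lintegral_const_mul' _ _ ENNReal.ofReal_ne_top]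
    refine (enorm_integral_le_lintegral_enorm _).trans ?_
    rw [← lintegral_indicator (measurableSet_Om r)]
    refine (lintegral_indicator (measurableSet_Om r) _).trans_le
      (le_trans ?_ (setLIntegral_le_lintegral (Om n r) _))
    refine lintegral_mono_ae ?_
    filter_upwards [hψ.1.ae_eq_mk, ae_restrict_mem (measurableSet_Om r)] with w hw hwO
    have hu1 : u w = ψ w * (weightL γ w : ℂ) := by
      simp only [u, Set.indicator_of_mem hwO, ← hw]
    have hL := weightL_nonneg γ w
    have hF := (weightF_pos γ z).le
    rw [hu1, ← ofReal_norm, ← ofReal_norm, ← ENNReal.ofReal_mul (by positivity),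
      ← ENNReal.ofReal_mul hC1]
    refine ENNReal.ofReal_le_ofReal ?_
    rw [hE]
    simp only [norm_mul, Complex.norm_real, RCLike.norm_conj]
    rw [Real.norm_of_nonneg hF, Real.norm_of_nonneg hL, Real.norm_of_nonneg (by positivity),
      Real.norm_of_nonneg (by positivity)]
    calc ‖ψ w‖ * (‖kernel n α z w‖ * (‖w‖ ^ (-α) * Real.exp (-‖w‖ ^ 2))) * weightF γ z
        = ‖ψ w‖ * (‖kernel n α z w‖ * Real.exp (-‖w‖ ^ 2) * ‖w‖ ^ (-α) * weightF γ z) := by ring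
      _ ≤ ‖ψ w‖ * (C1 * Real.exp (-(1 / 16) * ‖z - w‖ ^ 2) * weightL γ w) := by
          exact mul_le_mul_of_nonneg_left (h1 z w hwO) (norm_nonneg _)
      _ = _ := by ring
  have h4 : eLpNorm (fun z => opP n α r (kernel n α) ψ z * (weightF γ z : ℂ)) p (V n) ≤
      C1.toNNReal • eLpNorm (fun z => ∫⁻ w, ‖u w‖ₑ *
        ENNReal.ofReal (Real.exp (-(1 / 16) * ‖z - w‖ ^ 2)) ∂(V n)) p (V n) :=
    eLpNorm_le_nnreal_smul_eLpNorm_of_ae_le_mul' (.of_forall fun z => by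
      rw [enorm_eq_self]; exact h3 z) p
  refine h4.trans ?_
  have h5 := h2 (fun w => ‖u w‖ₑ) hu.enorm
  rw [hun] at h5
  push_cast
  rw [mul_assoc]
  exact mul_le_mul_right h5 (C1.toNNReal : ℝ≥0∞)

/-- Differentiation under the integral; the integrand is holomorphic in `z` because `inner ℂ w z` is
linear in `z`. Cauchy's estimate on unit circles bounds the derivative of the series, uniformly for
parameters within distance `1` of `z`. -/
lemma differentiable_opP (hn : 1 ≤ n) {p : ℝ≥0∞} (hp : 1 ≤ p) (α : ℝ) {β r : ℝ} (hr : 0 < r)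
    {ψ : Cn n → ℂ} (hψ : ψ ∈ spaceL n p r β) : Differentiable ℂ (opP n α r (kernel n α) ψ) := by
  have ha := coeffBound_kernelCoeff hn α
  set φ := expSeries (kernelCoeff n α) with hφ
  have hφd : Differentiable ℂ φ := ha.differentiable
  have hφ'c : Continuous (deriv φ) :=
    (hφd.contDiff (n := 1)).continuous_deriv le_rfl
  have hφc := hφd.continuous
  obtain ⟨C, hC0, hC⟩ := ha.exists_exp_bound
  have hderiv : ∀ x, ‖deriv φ x‖ ≤ C * Real.exp (2 * (‖x‖ + 1)) := by
    intro x
    have h := Complex.norm_deriv_le_of_forall_mem_sphere_norm_le (c := x) (f := φ) one_pos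
      hφd.diffContOnCl (C := C * Real.exp (2 * (‖x‖ + 1))) fun y hy => (hC y).trans (by
        have : ‖y‖ ≤ ‖x‖ + 1 := by
          have h1 := norm_add_le (y - x) x
          rw [sub_add_cancel, mem_sphere_iff_norm.1 hy] at h1
          linarith
        gcongr)
    simpa using h
  have he : opP n α r (kernel n α) ψ = fun z => ∫ w in Om n r, ψ w * (φ (inner ℂ w z) *
      ((‖w‖ ^ (-α) * Real.exp (-‖w‖ ^ 2) : ℝ) : ℂ)) ∂(V n) := funext fun z => opP_eq α r ψ z
  rw [he]
  intro z
  have hρm : Measurable fun w : Cn n => ((‖w‖ ^ (-α) * Real.exp (-‖w‖ ^ 2) : ℝ) : ℂ) :=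
    Complex.measurable_ofReal.comp (by fun_prop)
  let F' : Cn n → Cn n → Cn n →L[ℂ] ℂ := fun x w =>
    (ψ w * ((‖w‖ ^ (-α) * Real.exp (-‖w‖ ^ 2) : ℝ) : ℂ)) •
      (deriv φ (inner ℂ w x) • innerSL ℂ w)
  let b : Cn n → ℝ := fun w => C * Real.exp (2 * ((‖z‖ + 1) * ‖w‖ + 1)) * ‖w‖ *
    (‖w‖ ^ (-α) * Real.exp (-‖w‖ ^ 2))
  have hbi : IntegrableOn (fun w => ψ w * (b w : ℂ)) (Om n r) (V n) := by
    obtain ⟨D, hD0, hD⟩ := exists_rpow_le_one_add_rpow hr (-α)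
    refine integrableOn_mul_of_spaceL hp hr hψ (Complex.measurable_ofReal.comp (by fun_prop))
      (A := C * Real.exp 2 * D) (M := 1 + -α) (R := 2 * (‖z‖ + 1)) (c := 1 / 2) (by norm_num)
      fun w hw => ?_
    have h2 := hD ‖w‖ (mem_Om.1 hw)
    have hb0 : 0 ≤ b w := by simp only [b]; positivity
    rw [Complex.norm_real, Real.norm_of_nonneg hb0]
    calc b w ≤ C * Real.exp (2 * ((‖z‖ + 1) * ‖w‖ + 1)) * (1 + ‖w‖) *
          (D * (1 + ‖w‖) ^ (-α) * Real.exp (-‖w‖ ^ 2)) := by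
          simp only [b]
          gcongr
          linarith
      _ = C * D * ((1 + ‖w‖) * (1 + ‖w‖) ^ (-α)) *
          (Real.exp (2 * ((‖z‖ + 1) * ‖w‖ + 1)) * Real.exp (-‖w‖ ^ 2)) := by ring
      _ = C * D * (1 + ‖w‖) ^ (1 + -α) * (Real.exp 2 * Real.exp (2 * (‖z‖ + 1) * ‖w‖) *
          Real.exp (-(1 / 2) * ‖w‖ ^ 2) * Real.exp (-‖w‖ ^ 2 / 2)) := by
          rw [Real.rpow_add (by positivity), Real.rpow_one, ← Real.exp_add, ← Real.exp_add,
            ← Real.exp_add, ← Real.exp_add]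
          ring_nf
      _ = _ := by ring
  have h := hasFDerivAt_integral_of_dominated_of_fderiv_le (𝕜 := ℂ) (μ := (V n).restrict (Om n r))
    (F := fun x w => ψ w * (φ (inner ℂ w x) * ((‖w‖ ^ (-α) * Real.exp (-‖w‖ ^ 2) : ℝ) : ℂ)))
    (F' := F') (x₀ := z) (s := Metric.closedBall z 1) (bound := fun w => ‖ψ w * (b w : ℂ)‖)
    (Metric.closedBall_mem_nhds z one_pos)
    (.of_forall fun x => (integrableOn_opP hn hp α hr hψ x).aestronglyMeasurable)
    (integrableOn_opP hn hp α hr hψ z) ?_ (.of_forall fun w x hx => ?_) hbi.norm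
    (.of_forall fun w x _ => ?_)
  · exact h.differentiableAt
  · have h1 : Continuous fun w : Cn n => deriv φ (inner ℂ w z) • innerSL ℂ w :=
      (hφ'c.comp (by fun_prop : Continuous fun w : Cn n => (inner ℂ w z : ℂ))).smul
        (innerSL ℂ).continuous
    exact (hψ.1.mul hρm.aestronglyMeasurable).smul h1.aestronglyMeasurable
  · simp only [F', b]
    rw [norm_smul, norm_mul, norm_mul, norm_smul, innerSL_apply_norm, Complex.norm_real,
      Complex.norm_real, Real.norm_of_nonneg (by positivity), Real.norm_of_nonneg (by positivity)]
    have hx1 : ‖x‖ ≤ ‖z‖ + 1 := by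
      have h1 := norm_add_le (x - z) z
      rw [sub_add_cancel] at h1
      have h2 := mem_closedBall_iff_norm.1 hx
      linarith
    have h3 : ‖(inner ℂ w x : ℂ)‖ ≤ (‖z‖ + 1) * ‖w‖ := by
      refine (norm_inner_le_norm w x).trans ?_
      rw [mul_comm]; gcongr
    have h4 : ‖deriv φ (inner ℂ w x)‖ ≤ C * Real.exp (2 * ((‖z‖ + 1) * ‖w‖ + 1)) :=
      (hderiv _).trans (by gcongr)
    calc ‖ψ w‖ * (‖w‖ ^ (-α) * Real.exp (-‖w‖ ^ 2)) * (‖deriv φ (inner ℂ w x)‖ * ‖w‖)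
        ≤ ‖ψ w‖ * (‖w‖ ^ (-α) * Real.exp (-‖w‖ ^ 2)) *
          (C * Real.exp (2 * ((‖z‖ + 1) * ‖w‖ + 1)) * ‖w‖) := by gcongr
      _ = _ := by ring
  · have h1 : HasFDerivAt (fun x => φ (inner ℂ w x)) (deriv φ (inner ℂ w x) • innerSL ℂ w) x :=
      (hφd _).hasDerivAt.comp_hasFDerivAt x (innerSL ℂ w).hasFDerivAt
    have h2 := (h1.mul_const ((‖w‖ ^ (-α) * Real.exp (-‖w‖ ^ 2) : ℝ) : ℂ)).const_mul (ψ w)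
    simpa only [F', smul_smul, mul_assoc] using h2

/-- The operator `P^r_α` from `𝓛^{p,r}_β` to `F^p_β`. -/
def projL (hn : 1 ≤ n) {p : ℝ≥0∞} (hp : 1 ≤ p) (α β : ℝ) {r : ℝ} (hr : 0 < r) :
    spaceL n p r β →ₗ[ℂ] spaceF n p β where
  toFun ψ := ⟨opP n α r (kernel n α) ψ, differentiable_opP hn hp α hr ψ.2, by
    obtain ⟨C, hC⟩ := exists_normF_opP_le (n := n) hn hp α β hr
    exact (hC ψ ψ.2).trans_lt (ENNReal.mul_lt_top ENNReal.coe_lt_top ψ.2.2)⟩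
  map_add' ψ₁ ψ₂ := by
    ext z
    simp only [Submodule.coe_add, Pi.add_apply]
    rw [opP_eq, opP_eq, opP_eq, ← integral_add (integrableOn_opP hn hp α hr ψ₁.2 z)
      (integrableOn_opP hn hp α hr ψ₂.2 z)]
    refine integral_congr_ae (.of_forall fun w => ?_)
    simp only [Pi.add_apply]
    ring
  map_smul' c ψ := by
    ext z
    simp only [Submodule.coe_smul, Pi.smul_apply, RingHom.id_apply, smul_eq_mul]
    rw [opP_eq, opP_eq, ← integral_const_mul]
    refine integral_congr_ae (.of_forall fun w => ?_)
    simp only [Pi.smul_apply, smul_eq_mul]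
    ring

end Projection

/-! ### The operator as a multiplier on homogeneous parts -/

section Multiplier

variable {n : ℕ}

/-- The radial density of `e^{-|z|²} dW_α` on `Ω_r`. -/
def truncatedDensity (α r : ℝ) (t : ℝ) : ℝ :=
  (Set.Ici r).indicator (fun t => t ^ (-α) * Real.exp (-t ^ 2)) t

/-- The factor by which `P^r_α` multiplies homogeneous polynomials of degree `k`. -/
def multiplier (n : ℕ) (α r : ℝ) (k : ℕ) : ℝ :=
  kernelCoeff n α k * (radialMoment n (truncatedDensity α r) k /
    radialMoment n (fun t => Real.exp (-t ^ 2)) k)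

/-- The integrand of the radial moments. -/
def momentIntegrand (n : ℕ) (α : ℝ) (k : ℕ) (t : ℝ) : ℝ :=
  t ^ (2 * n - 1) * (t ^ (2 * k) * (t ^ (-α) * Real.exp (-t ^ 2)))

/-- The operator is a pairing with the kernel against a radial density which vanishes near the
origin, so no order of vanishing of `f` is required. -/
lemma hasSum_opP (hn : 1 ≤ n) {p : ℝ≥0∞} (hp : 1 ≤ p) (α : ℝ) {β r : ℝ} (hr : 0 < r)
    {f : Cn n → ℂ} (hf : f ∈ spaceF n p β) (z : Cn n) :
    HasSum (fun k => ((multiplier n α r k : ℝ) : ℂ) * homPart k f z)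
      (opP n α r (kernel n α) f z) := by
  have ha := coeffBound_kernelCoeff hn α
  have hρ : ∀ w : Cn n, truncatedDensity α r ‖w‖ =
      (Om n r).indicator (fun w => ‖w‖ ^ (-α) * Real.exp (-‖w‖ ^ 2)) w := by
    intro w
    by_cases hw : w ∈ Om n r
    · rw [Set.indicator_of_mem hw, truncatedDensity, Set.indicator_of_mem (Set.mem_Ici.2 (mem_Om.1 hw))]
    · rw [Set.indicator_of_notMem hw, truncatedDensity, Set.indicator_of_notMem]
      exact fun h => hw (mem_Om.2 (Set.mem_Ici.1 h))
  have hm := integrableOn_Om_majorant hp hr α (spaceF_le_spaceL hp hr β hf) ha ‖z‖ (norm_nonneg z)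
  rw [← integrable_indicator_iff (measurableSet_Om r)] at hm
  have h := hasSum_integral_mul_expSeries hn hf.1 (ρ := truncatedDensity α r)
    (Measurable.indicator (by fun_prop) measurableSet_Ici)
    (fun t ht => Set.indicator_apply_nonneg fun _ => by positivity) ha.1 ha.summable (z := z)
    (hm.congr (.of_forall fun w => by
      simp only [hρ]
      by_cases hw : w ∈ Om n r <;> simp [hw]))
  have e : opP n α r (kernel n α) f z = ∫ w, f w * expSeries (kernelCoeff n α) (inner ℂ w z) *
      (truncatedDensity α r ‖w‖ : ℂ) ∂(V n) := by
    rw [opP_eq, ← integral_indicator (measurableSet_Om r)]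
    refine integral_congr_ae (.of_forall fun w => ?_)
    simp only [hρ]
    by_cases hw : w ∈ Om n r
    · simp only [Set.indicator_of_mem hw]; ring
    · simp [Set.indicator_of_notMem hw]
  rw [e]
  exact h

lemma momentIntegrand_pos {α : ℝ} {k : ℕ} {t : ℝ} (ht : 0 < t) : 0 < momentIntegrand n α k t := by
  unfold momentIntegrand; positivity

lemma momentIntegrand_eq_mul (α : ℝ) {N k : ℕ} (h : N ≤ k) (t : ℝ) :
    momentIntegrand n α k t = (t ^ 2) ^ (k - N) * momentIntegrand n α N t := by
  have e : t ^ (2 * k) = (t ^ 2) ^ (k - N) * t ^ (2 * N) := by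
    rw [← pow_mul, ← pow_add]; congr 1; omega
  unfold momentIntegrand
  rw [e]; ring

lemma integrableOn_momentIntegrand (α : ℝ) (k : ℕ) {r : ℝ} (hr : 0 < r) :
    IntegrableOn (momentIntegrand n α k) (Set.Ioi r) := by
  obtain ⟨C, hC, h⟩ := exists_rpow_le_one_add_rpow hr (-α)
  obtain ⟨D, hD, h'⟩ := exists_growth_le (((2 * n - 1 : ℕ) : ℝ) + ((2 * k : ℕ) : ℝ) + -α) 0
    (c := 1 / 2) (by norm_num)
  have hi : Integrable fun t : ℝ => Real.exp (-(1 / 2) * t ^ 2) :=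
    integrable_exp_neg_mul_sq (by norm_num)
  refine Integrable.mono' ((hi.const_mul (C * D)).integrableOn (s := Set.Ioi r)) ?_ ?_
  · unfold momentIntegrand
    exact (Measurable.aestronglyMeasurable (by fun_prop))
  · filter_upwards [ae_restrict_mem measurableSet_Ioi] with t ht
    have ht0 : 0 < t := hr.trans ht
    rw [Real.norm_of_nonneg (momentIntegrand_pos ht0).le, momentIntegrand]
    have h1 := h t (le_of_lt ht)
    have h2 := h' t ht0.le
    rw [zero_mul, Real.exp_zero, mul_one, Real.rpow_add (by positivity),
      Real.rpow_add (by positivity), Real.rpow_natCast, Real.rpow_natCast] at h2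
    calc t ^ (2 * n - 1) * (t ^ (2 * k) * (t ^ (-α) * Real.exp (-t ^ 2)))
        ≤ (1 + t) ^ (2 * n - 1) * ((1 + t) ^ (2 * k) * (C * (1 + t) ^ (-α) * Real.exp (-t ^ 2))) := by
          gcongr <;> linarith
      _ = C * ((1 + t) ^ (2 * n - 1) * (1 + t) ^ (2 * k) * (1 + t) ^ (-α)) * Real.exp (-t ^ 2) := by
          ring
      _ ≤ C * (D * Real.exp (1 / 2 * t ^ 2)) * Real.exp (-t ^ 2) := by gcongr
      _ = C * D * (Real.exp (1 / 2 * t ^ 2) * Real.exp (-t ^ 2)) := by ring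
      _ = _ := by rw [← Real.exp_add]; ring_nf

lemma setIntegral_momentIntegrand_pos (α : ℝ) (k : ℕ) {r : ℝ} (hr : 0 < r) :
    0 < ∫ t in Set.Ioi r, momentIntegrand n α k t := by
  rw [setIntegral_pos_iff_support_of_nonneg_ae]
  · have : Function.support (momentIntegrand n α k) ∩ Set.Ioi r = Set.Ioi r :=
      Set.inter_eq_right.2 fun t ht => (momentIntegrand_pos (hr.trans ht)).ne'
    rw [this]
    simp
  · filter_upwards [ae_restrict_mem measurableSet_Ioi] with t ht
    exact (momentIntegrand_pos (hr.trans ht)).le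
  · exact integrableOn_momentIntegrand α k hr

lemma radialMoment_truncatedDensity (α : ℝ) (k : ℕ) {r : ℝ} (hr : 0 < r) :
    radialMoment n (truncatedDensity α r) k = ∫ t in Set.Ioi r, momentIntegrand n α k t := by
  have h1 : ∀ t, t ^ (2 * n - 1) * (t ^ (2 * k) * truncatedDensity α r t) =
      (Set.Ici r).indicator (momentIntegrand n α k) t := by
    intro t
    by_cases ht : t ∈ Set.Ici r
    · simp only [truncatedDensity, Set.indicator_of_mem ht, momentIntegrand]
    · simp [truncatedDensity, Set.indicator_of_notMem ht]
  unfold radialMoment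
  simp_rw [h1]
  rw [setIntegral_indicator measurableSet_Ici, Set.inter_eq_right.2, integral_Ici_eq_integral_Ioi]
  exact fun t ht => hr.trans_le ht

lemma multiplier_pos (hn : 1 ≤ n) (α : ℝ) {r : ℝ} (hr : 0 < r) (k : ℕ) :
    0 < multiplier n α r k := by
  rw [multiplier, radialMoment_truncatedDensity α k hr]
  exact mul_pos (kernelCoeff_pos hn α k)
    (div_pos (setIntegral_momentIntegrand_pos α k hr) (radialMoment_gaussian_pos hn k))

/-- The reciprocals of the multipliers converge to `1` geometrically. -/
lemma summable_inv_multiplier_sub_one (hn : 1 ≤ n) (α : ℝ) {r : ℝ} (hr : 0 < r) :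
    Summable fun k => |(multiplier n α r k)⁻¹ - 1| := by
  -- From this degree on, the kernel coefficient is the Gamma quotient and the untruncated moment
  -- converges, so their normalized product is `1`.
  set N := ⌊|α / 2|⌋₊ + 1 with hN
  have hfull : ∀ k, N ≤ k → 0 < ∫ t in Set.Ioi (0 : ℝ), momentIntegrand n α k t ∧
      kernelCoeff n α k * ((∫ t in Set.Ioi (0 : ℝ), momentIntegrand n α k t) /
        radialMoment n (fun t => Real.exp (-t ^ 2)) k) = 1 := by
    intro k hk
    have hk' : ⌊|α / 2|⌋₊ < k := Nat.lt_of_succ_le hk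
    have h1 := (Gamma_args_pos hn (Or.inr hk' : α < 2 * n ∨ _)).2
    have h2 : ∫ t in Set.Ioi (0 : ℝ), momentIntegrand n α k t = Real.Gamma (k + n - α / 2) / 2 :=
      radialMoment_rpow_mul_exp hn h1
    rw [h2, radialMoment_gaussian hn, div_div_div_cancel_right₀ two_ne_zero]
    exact ⟨by have := Real.Gamma_pos_of_pos h1
              positivity, kernelCoeff_mul hn (Or.inr hk')⟩
  have hint : ∀ k, N ≤ k → IntegrableOn (momentIntegrand n α k) (Set.Ioi 0) := fun k hk =>
    Integrable.of_integral_ne_zero (hfull k hk).1.ne'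
  -- Raising the degree from `N` to `k` multiplies the integrand by `t^{2(k-N)}`, at most
  -- `r^{2(k-N)}` on `(0, r]` and at least `(2r)^{2(k-N)}` beyond `2r`. The gap between `r` and `2r`
  -- creates the ratio `1/4`.
  set A := ∫ t in Set.Ioc 0 r, momentIntegrand n α N t with hA
  set B := ∫ t in Set.Ioi (2 * r), momentIntegrand n α N t with hB
  have hr2 : 0 < 2 * r := by positivity
  have hBpos : 0 < B := setIntegral_momentIntegrand_pos α N hr2
  have hbound : ∀ k, N ≤ k → |(multiplier n α r k)⁻¹ - 1| ≤ A / B * (1 / 4) ^ (k - N) := by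
    intro k hk
    have hMr := setIntegral_momentIntegrand_pos (n := n) α k hr
    have hG := radialMoment_gaussian_pos hn k
    have hK := kernelCoeff_pos hn α k
    obtain ⟨h0, h1⟩ := hfull k hk
    have hsplit : ∫ t in Set.Ioi (0 : ℝ), momentIntegrand n α k t =
        (∫ t in Set.Ioc 0 r, momentIntegrand n α k t) +
          ∫ t in Set.Ioi r, momentIntegrand n α k t := by
      rw [← Set.Ioc_union_Ioi_eq_Ioi hr.le]
      exact setIntegral_union (Set.Ioc_disjoint_Ioi le_rfl) measurableSet_Ioi
        ((hint k hk).mono_set Set.Ioc_subset_Ioi_self) (integrableOn_momentIntegrand α k hr)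
    -- The reciprocal is full moment over truncated moment, so subtracting `1` leaves the missing
    -- part over the truncated one.
    have hinv : (multiplier n α r k)⁻¹ - 1 = (∫ t in Set.Ioc 0 r, momentIntegrand n α k t) /
        ∫ t in Set.Ioi r, momentIntegrand n α k t := by
      rw [multiplier, radialMoment_truncatedDensity α k hr]
      rw [hsplit] at h1
      field_simp at h1 ⊢
      linarith
    have hnum0 : 0 ≤ ∫ t in Set.Ioc 0 r, momentIntegrand n α k t :=
      setIntegral_nonneg measurableSet_Ioc fun t ht => (momentIntegrand_pos ht.1).le
    have hnum : ∫ t in Set.Ioc 0 r, momentIntegrand n α k t ≤ (r ^ 2) ^ (k - N) * A := by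
      rw [hA, ← integral_const_mul]
      refine setIntegral_mono_on ((hint k hk).mono_set Set.Ioc_subset_Ioi_self)
        (((hint N le_rfl).mono_set Set.Ioc_subset_Ioi_self).const_mul _) measurableSet_Ioc
        fun t ht => ?_
      rw [momentIntegrand_eq_mul α hk]
      have := (momentIntegrand_pos (n := n) (α := α) (k := N) ht.1).le
      have h2 := ht.1.le
      have h3 := ht.2
      gcongr
    have hden : ((2 * r) ^ 2) ^ (k - N) * B ≤ ∫ t in Set.Ioi r, momentIntegrand n α k t := by
      refine le_trans ?_ (setIntegral_mono_set (integrableOn_momentIntegrand α k hr) ?_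
        (Set.Ioi_subset_Ioi (by linarith : r ≤ 2 * r)).eventuallyLE)
      · rw [hB, ← integral_const_mul]
        refine setIntegral_mono_on ((integrableOn_momentIntegrand α N hr2).const_mul _)
          (integrableOn_momentIntegrand α k hr2) measurableSet_Ioi fun t ht => ?_
        have ht' : 2 * r < t := ht
        rw [momentIntegrand_eq_mul α hk]
        have := (momentIntegrand_pos (n := n) (α := α) (k := N) (hr2.trans ht')).le
        gcongr
      · filter_upwards [ae_restrict_mem measurableSet_Ioi] with t ht
        exact (momentIntegrand_pos (hr.trans ht)).le
    rw [hinv, abs_of_nonneg (div_nonneg hnum0 hMr.le)]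
    have hA0 : 0 ≤ A :=
      setIntegral_nonneg measurableSet_Ioc fun t ht => (momentIntegrand_pos ht.1).le
    calc _ ≤ ((r ^ 2) ^ (k - N) * A) / (((2 * r) ^ 2) ^ (k - N) * B) :=
          div_le_div₀ (by positivity) hnum (by positivity) hden
      _ = _ := by
        rw [mul_pow 2 r, mul_pow, one_div, inv_pow, show (2 : ℝ) ^ 2 = 4 by norm_num]
        field_simp
  rw [← summable_nat_add_iff N]
  refine Summable.of_nonneg_of_le (fun k => abs_nonneg _) (fun k => hbound (k + N) (by omega)) ?_
  simp only [Nat.add_sub_cancel]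
  exact (summable_geometric_of_lt_one (by norm_num) (by norm_num)).mul_left _

end Multiplier

/-! ### Multipliers as averages of rotations -/

section CircleMultiplier

variable {n : ℕ}

/-- The function with Fourier coefficients `e k`. -/
def fourierSum (e : ℕ → ℝ) (θ : ℝ) : ℂ := ∑' k, (e k : ℂ) * (rot θ ^ k)⁻¹

/-- The operator multiplying the homogeneous part of degree `k` by `e k`. -/
def circleMultiplier (e : ℕ → ℝ) (f : Cn n → ℂ) (z : Cn n) : ℂ :=
  ∫ θ, f (rot θ • z) * fourierSum e θ ∂circ

variable {e : ℕ → ℝ}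

lemma norm_fourier_term (e : ℕ → ℝ) (k : ℕ) (θ : ℝ) : ‖(e k : ℂ) * (rot θ ^ k)⁻¹‖ = |e k| := by
  simp

lemma continuous_fourierSum (he : Summable fun k => |e k|) : Continuous (fourierSum e) :=
  continuous_tsum (fun k => by
    fun_prop (disch := intros; exact pow_ne_zero _ (rot_ne_zero _))) he
    fun k θ => (norm_fourier_term e k θ).le

lemma norm_fourierSum_le (he : Summable fun k => |e k|) (θ : ℝ) :
    ‖fourierSum e θ‖ ≤ ∑' k, |e k| :=
  tsum_of_norm_bounded he.hasSum fun k => (norm_fourier_term e k θ).le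

/-- Expanding the kernel on the circle, each term `e k · e^{-ikθ}` extracts `e k` times the
homogeneous part of degree `k`. -/
lemma hasSum_circleMultiplier (he : Summable fun k => |e k|) {f : Cn n → ℂ}
    (hf : Differentiable ℂ f) (z : Cn n) :
    HasSum (fun k => (e k : ℂ) * homPart k f z) (circleMultiplier e f z) := by
  have hfc := hf.continuous
  have hs : ∀ θ, HasSum (fun k => (e k : ℂ) * (rot θ ^ k)⁻¹) (fourierSum e θ) := fun θ =>
    (Summable.of_norm_bounded he fun k => (norm_fourier_term e k θ).le).hasSum
  have h := hasSum_integral_of_dominated_convergence (μ := circ)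
    (F := fun k θ => f (rot θ • z) * ((e k : ℂ) * (rot θ ^ k)⁻¹))
    (f := fun θ => f (rot θ • z) * fourierSum e θ)
    (fun k θ => ‖f (rot θ • z)‖ * |e k|)
    (fun k => Continuous.aestronglyMeasurable (by
      fun_prop (disch := intros; exact pow_ne_zero _ (rot_ne_zero _))))
    (fun k => .of_forall fun θ => by rw [norm_mul, norm_fourier_term])
    (.of_forall fun θ => he.mul_left _)
    (by
      simp_rw [tsum_mul_left]
      exact integrable_circ_of_continuous (by fun_prop))
    (.of_forall fun θ => (hs θ).mul_left _)
  have e1 : ∀ k, (e k : ℂ) * homPart k f z =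
      ∫ θ, f (rot θ • z) * ((e k : ℂ) * (rot θ ^ k)⁻¹) ∂circ := by
    intro k
    rw [homPart_eq_integral_circ hf, ← integral_const_mul]
    refine integral_congr_ae (.of_forall fun θ => ?_)
    ring
  simp_rw [e1]
  exact h

lemma differentiable_circleMultiplier (he : Summable fun k => |e k|) {f : Cn n → ℂ}
    (hf : Differentiable ℂ f) : Differentiable ℂ (circleMultiplier e f) := by
  have hq := continuous_fourierSum he
  have h1 := hf.continuous
  have h2 := continuous_fderiv_of_entire hf
  refine differentiable_integral_circ
    (F' := fun z θ => (fourierSum e θ * rot θ) • fderiv ℂ f (rot θ • z)) ?_ ?_ fun z θ => ?_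
  · fun_prop
  · fun_prop
  · have h3 : HasFDerivAt f (fderiv ℂ f (rot θ • z)) (rot θ • z) := (hf _).hasFDerivAt
    have h4 : HasFDerivAt (fun x : Cn n => rot θ • x)
        (rot θ • ContinuousLinearMap.id ℂ (Cn n)) z := (hasFDerivAt_id z).const_smul (rot θ)
    have h5 := (h3.comp z h4).mul_const (fourierSum e θ)
    refine h5.congr_fderiv ?_
    ext v
    simp [mul_assoc]

/-- The circle kernel is bounded by `∑ |e k|`, and the weight is radial, so each rotation is an
isometry for the norm; Minkowski's inequality averages them. -/
lemma normF_circleMultiplier_le (he : Summable fun k => |e k|) {p : ℝ≥0∞} (hp : 1 ≤ p) (β : ℝ)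
    {f : Cn n → ℂ} (hf : Differentiable ℂ f) :
    normF n p β (circleMultiplier e f) ≤ (∑' k, |e k|).toNNReal * normF n p β f := by
  set E := ∑' k, |e k|
  rw [normF_eq hp, normF_eq hp]
  set γ := weightExp p β
  let u : Cn n → ℂ := fun z => f z * (weightF γ z : ℂ)
  have hu : Continuous u := hf.continuous.mul (Complex.continuous_ofReal.comp (continuous_weightF γ))
  have hw : ∀ θ (z : Cn n), weightF γ (rot θ • z) = weightF γ z := by
    intro θ z; simp [weightF, norm_smul]
  have h1 : ∀ z, ‖circleMultiplier e f z * (weightF γ z : ℂ)‖ₑ ≤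
      ENNReal.ofReal E * ∫⁻ θ, ‖u (rot θ • z)‖ₑ ∂circ := by
    intro z
    rw [circleMultiplier, ← integral_mul_const, ← lintegral_const_mul' _ _ ENNReal.ofReal_ne_top]
    refine (enorm_integral_le_lintegral_enorm _).trans (lintegral_mono fun θ => ?_)
    simp only [u]
    rw [hw, mul_right_comm, enorm_mul, mul_comm]
    gcongr
    rw [← ofReal_norm]
    exact ENNReal.ofReal_le_ofReal (norm_fourierSum_le he θ)
  have h2 := eLpNorm_lintegral_le (μ := V n) (ν := circ) hp
    (F := fun z θ => ‖u (rot θ • z)‖ₑ) (A := eLpNorm u p (V n))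
    (by
      have : Continuous fun x : Cn n × ℝ => u (rot x.2 • x.1) := by fun_prop
      exact this.measurable.enorm)
    (fun θ => by
      rw [eLpNorm_enorm]
      exact (eLpNorm_comp_measurePreserving hu.aestronglyMeasurable (measurePreserving_rot θ)).le)
  rw [measure_univ, one_mul] at h2
  have h3 : eLpNorm (fun z => circleMultiplier e f z * (weightF γ z : ℂ)) p (V n) ≤
      E.toNNReal • eLpNorm (fun z => ∫⁻ θ, ‖u (rot θ • z)‖ₑ ∂circ) p (V n) :=
    eLpNorm_le_nnreal_smul_eLpNorm_of_ae_le_mul' (.of_forall fun z => by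
      rw [enorm_eq_self]; exact h1 z) p
  exact h3.trans (mul_le_mul_right h2 (E.toNNReal : ℝ≥0∞))

lemma normF_add_le {p : ℝ≥0∞} (hp : 1 ≤ p) (β : ℝ) {f g : Cn n → ℂ} (hf : Continuous f)
    (hg : Continuous g) : normF n p β (f + g) ≤ normF n p β f + normF n p β g := by
  rw [normF_eq hp, normF_eq hp, normF_eq hp]
  have hw : Continuous fun z : Cn n => (weightF (weightExp p β) z : ℂ) :=
    Complex.continuous_ofReal.comp (continuous_weightF _)
  have h : (fun z => (f + g) z * (weightF (weightExp p β) z : ℂ)) =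
      (fun z => f z * (weightF (weightExp p β) z : ℂ)) +
        fun z => g z * (weightF (weightExp p β) z : ℂ) := by
    funext z; simp [add_mul]
  rw [h]
  exact eLpNorm_add_le (hf.mul hw).aestronglyMeasurable (hg.mul hw).aestronglyMeasurable hp

end CircleMultiplier

/-! ### The inverse on `F^p_β` -/

section Inverse

variable {n : ℕ}

/-- The inverse of `P^r_α` on `F^p_β`. -/
def invP (n : ℕ) (α r : ℝ) (f : Cn n → ℂ) : Cn n → ℂ :=
  f + circleMultiplier (fun k => (multiplier n α r k)⁻¹ - 1) f

/-- The identity is split off because the reciprocals tend to `1` and are not summable themselves;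
only their deviations from `1` form an admissible circle multiplier. -/
lemma hasSum_invP (hn : 1 ≤ n) (α : ℝ) {r : ℝ} (hr : 0 < r) {f : Cn n → ℂ}
    (hf : Differentiable ℂ f) (z : Cn n) :
    HasSum (fun k => ((multiplier n α r k)⁻¹ : ℂ) * homPart k f z) (invP n α r f z) := by
  have h := (hasSum_homPart hf z).add
    (hasSum_circleMultiplier (summable_inv_multiplier_sub_one hn α hr) hf z)
  have e : ∀ k, homPart k f z + (((multiplier n α r k)⁻¹ - 1 : ℝ) : ℂ) * homPart k f z =
      ((multiplier n α r k)⁻¹ : ℂ) * homPart k f z := by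
    intro k; push_cast; ring
  simp_rw [e] at h
  exact h

lemma differentiable_invP (hn : 1 ≤ n) (α : ℝ) {r : ℝ} (hr : 0 < r) {f : Cn n → ℂ}
    (hf : Differentiable ℂ f) : Differentiable ℂ (invP n α r f) :=
  hf.add (differentiable_circleMultiplier (summable_inv_multiplier_sub_one hn α hr) hf)

lemma exists_normF_invP_le (hn : 1 ≤ n) {p : ℝ≥0∞} (hp : 1 ≤ p) (α β : ℝ) {r : ℝ} (hr : 0 < r) :
    ∃ C : ℝ≥0, ∀ f : Cn n → ℂ, Differentiable ℂ f →
      normF n p β (invP n α r f) ≤ C * normF n p β f := by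
  have he := summable_inv_multiplier_sub_one hn α hr
  refine ⟨1 + (∑' k, |(multiplier n α r k)⁻¹ - 1|).toNNReal, fun f hf => ?_⟩
  refine (normF_add_le hp β hf.continuous
    (differentiable_circleMultiplier he hf).continuous).trans ?_
  push_cast
  rw [add_mul, one_mul]
  gcongr
  exact normF_circleMultiplier_le he hp β hf

lemma homPart_of_hasSum_mul {f g : Cn n → ℂ} (hg : Differentiable ℂ g) {m : ℕ → ℂ}
    (h : ∀ z, HasSum (fun k => m k * homPart k f z) (g z)) (k : ℕ) (z : Cn n) :
    homPart k g z = m k * homPart k f z := by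
  refine homPart_eq_of_hasSum hg (b := fun k => m k * homPart k f z) (fun c => ?_) k
  simpa only [homPart_smul, mul_assoc, mul_comm (c ^ _)] using h (c • z)

lemma invP_mem_spaceF (hn : 1 ≤ n) {p : ℝ≥0∞} (hp : 1 ≤ p) (α : ℝ) {β r : ℝ} (hr : 0 < r)
    {f : Cn n → ℂ} (hf : f ∈ spaceF n p β) : invP n α r f ∈ spaceF n p β := by
  obtain ⟨C, hC⟩ := exists_normF_invP_le (n := n) hn hp α β hr
  exact ⟨differentiable_invP hn α hr hf.1,
    (hC f hf.1).trans_lt (ENNReal.mul_lt_top ENNReal.coe_lt_top hf.2)⟩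

/-- Both operators are diagonal in the homogeneous expansion with reciprocal factors, and an entire
function is determined by its expansion. -/
lemma opP_invP (hn : 1 ≤ n) {p : ℝ≥0∞} (hp : 1 ≤ p) (α : ℝ) {β r : ℝ} (hr : 0 < r)
    {f : Cn n → ℂ} (hf : f ∈ spaceF n p β) :
    opP n α r (kernel n α) (invP n α r f) = f := by
  funext z
  have h := hasSum_opP hn hp α hr (invP_mem_spaceF hn hp α hr hf) z
  have e : ∀ k, ((multiplier n α r k : ℝ) : ℂ) * homPart k (invP n α r f) z = homPart k f z := by
    intro k
    rw [homPart_of_hasSum_mul (differentiable_invP hn α hr hf.1) (hasSum_invP hn α hr hf.1) k z,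
      mul_inv_cancel_left₀ (Complex.ofReal_ne_zero.2 (multiplier_pos hn α hr k).ne')]
  simp_rw [e] at h
  exact h.unique (hasSum_homPart hf.1 z)

lemma invP_opP (hn : 1 ≤ n) {p : ℝ≥0∞} (hp : 1 ≤ p) (α : ℝ) {β r : ℝ} (hr : 0 < r)
    {f : Cn n → ℂ} (hf : f ∈ spaceF n p β) :
    invP n α r (opP n α r (kernel n α) f) = f := by
  funext z
  have hd := differentiable_opP hn hp α hr (spaceF_le_spaceL hp hr β hf)
  have h := hasSum_invP hn α hr hd z
  have e : ∀ k, ((multiplier n α r k)⁻¹ : ℂ) * homPart k (opP n α r (kernel n α) f) z =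
      homPart k f z := by
    intro k
    rw [homPart_of_hasSum_mul hd (hasSum_opP hn hp α hr hf) k z,
      inv_mul_cancel_left₀ (Complex.ofReal_ne_zero.2 (multiplier_pos hn α hr k).ne')]
  simp_rw [e] at h
  exact h.unique (hasSum_homPart hf.1 z)

/-- The operator `P^r_α` on `F^p_β`. -/
def projF (hn : 1 ≤ n) {p : ℝ≥0∞} (hp : 1 ≤ p) (α β : ℝ) {r : ℝ} (hr : 0 < r) :
    spaceF n p β ≃ₗ[ℂ] spaceF n p β :=
  LinearEquiv.ofBijective
    ((projL hn hp α β hr).comp (Submodule.inclusion (spaceF_le_spaceL hp hr β))) <| by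
    refine ⟨fun f g hfg => Subtype.ext ?_, fun f =>
      ⟨⟨invP n α r f, invP_mem_spaceF hn hp α hr f.2⟩, Subtype.ext (opP_invP hn hp α hr f.2)⟩⟩
    have h : opP n α r (kernel n α) f = opP n α r (kernel n α) g := congrArg Subtype.val hfg
    rw [← invP_opP hn hp α hr f.2, h, invP_opP hn hp α hr g.2]

lemma projF_symm_apply (hn : 1 ≤ n) {p : ℝ≥0∞} (hp : 1 ≤ p) (α β : ℝ) {r : ℝ} (hr : 0 < r)
    (f : spaceF n p β) : ((projF hn hp α β hr).symm f : Cn n → ℂ) = invP n α r f := by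
  have h : (projF hn hp α β hr).symm f = ⟨invP n α r f, invP_mem_spaceF hn hp α hr f.2⟩ := by
    rw [LinearEquiv.symm_apply_eq]
    exact Subtype.ext (opP_invP hn hp α hr f.2).symm
  rw [h]

end Inverse

end Fock

end

/-! ### Assembly of the theorem -/

theorem theorem5p4 (n : ℕ) (hn : 1 ≤ n) (p : ENNReal) (hp : 1 ≤ p) (α β : ℝ) :
    -- the reproducing kernel `K^α` of `F^2_α` exists and is unique
    (∃! K : Fock.Cn n → Fock.Cn n → ℂ, Fock.IsReproducingKernel n α K) ∧
    ∀ K : Fock.Cn n → Fock.Cn n → ℂ, Fock.IsReproducingKernel n α K →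
      -- `P_α^r : 𝓛^{p,r}_β → F^p_β` is a well-defined bounded linear operator for every `r > 0`
      (∀ r : ℝ, 0 < r →
        (∀ ψ ∈ Fock.spaceL n p r β, ∀ z : Fock.Cn n,
          MeasureTheory.IntegrableOn (Fock.integrandP K ψ z) (Fock.Om n r) (Fock.W n α)) ∧
        ∃ T : Fock.spaceL n p r β →ₗ[ℂ] Fock.spaceF n p β,
          (∀ (ψ : Fock.spaceL n p r β) (z : Fock.Cn n),
            (T ψ : Fock.Cn n → ℂ) z = Fock.opP n α r K ψ z) ∧
          ∃ C : NNReal, ∀ ψ : Fock.spaceL n p r β,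
            Fock.normF n p β (T ψ) ≤ C * Fock.normL n p r β ψ) ∧
      -- `P_α^r : F^p_β → F^p_β` is well defined, bounded and boundedly invertible for small `r`
      (∃ r₀ : ℝ, 0 < r₀ ∧ ∀ r : ℝ, 0 < r → r < r₀ →
        (∀ f ∈ Fock.spaceF n p β, ∀ z : Fock.Cn n,
          MeasureTheory.IntegrableOn (Fock.integrandP K f z) (Fock.Om n r) (Fock.W n α)) ∧
        ∃ T : Fock.spaceF n p β ≃ₗ[ℂ] Fock.spaceF n p β,
          (∀ (f : Fock.spaceF n p β) (z : Fock.Cn n),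
            (T f : Fock.Cn n → ℂ) z = Fock.opP n α r K f z) ∧
          ∃ C : NNReal, ∀ f : Fock.spaceF n p β,
            Fock.normF n p β (T f) ≤ C * Fock.normF n p β f ∧
            Fock.normF n p β (T.symm f) ≤ C * Fock.normF n p β f) := by
  have hker := Fock.isReproducingKernel_kernel hn α
  refine ⟨⟨_, hker, fun K hK => hK.unique hker⟩, fun K hK => ?_⟩
  obtain rfl : K = Fock.kernel n α := hK.unique hker
  -- The threshold is taken to be `1`; any positive number would do, since the inverse is available
  -- for every `r > 0`.
  refine ⟨fun r hr => ⟨fun ψ hψ z => Fock.integrableOn_integrandP hn hp α hr hψ z,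
    Fock.projL hn hp α β hr, fun ψ z => rfl, ?_⟩, 1, one_pos, fun r hr _ =>
    ⟨fun f hf z => Fock.integrableOn_integrandP hn hp α hr (Fock.spaceF_le_spaceL hp hr β hf) z,
      Fock.projF hn hp α β hr, fun f z => rfl, ?_⟩⟩
  · obtain ⟨C, hC⟩ := Fock.exists_normF_opP_le (n := n) hn hp α β hr
    exact ⟨C, fun ψ => hC ψ ψ.2⟩
  · obtain ⟨C₁, h₁⟩ := Fock.exists_normF_opP_le (n := n) hn hp α β hr
    obtain ⟨C₂, h₂⟩ := Fock.exists_normL_le_normF (n := n) hp hr β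
    obtain ⟨C₃, h₃⟩ := Fock.exists_normF_invP_le (n := n) hn hp α β hr
    refine ⟨C₁ * C₂ + C₃, fun f => ⟨?_, ?_⟩⟩
    · calc Fock.normF n p β (Fock.projF hn hp α β hr f)
          ≤ C₁ * Fock.normL n p r β f := h₁ f (Fock.spaceF_le_spaceL hp hr β f.2)
        _ ≤ C₁ * (C₂ * Fock.normF n p β f) := by gcongr; exact h₂ f
        _ = (C₁ * C₂ : NNReal) * Fock.normF n p β f := by push_cast; ring
        _ ≤ _ := by
          gcongr
          exact le_self_add
    · rw [Fock.projF_symm_apply]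
      refine (h₃ f f.2.1).trans ?_
      gcongr
      exact le_add_self
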